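/- Let $k$ be a field, let $X$ and $Y$ be separated $k$-schemes locally of finite type, and let $\varphi:X\to Y$ be a $k$-morphism. Assume that $Y$ is smooth over $k$, that $X$ is a locally complete intersection over $k$, and that the locus $U\subset X$ where $\varphi$ is étale is dense in $X$. Let $\Delta_X\subset X$ be the different of $\varphi$, i.e. the effective Cartier divisor associated (by Knudsen and Mumford) to $\Omega^1_{X/Y}$: if $0\to\mathcal O_{X,x}^n\xrightarrow{\,f\,}\mathcal O_{X,x}^n\to(\Omega^1_{X/Y})_x\to 0$ is exact, then $\det f$ is an equation of $\Delta_X$ at $x$. One has $X\setminus\Delta_X=U$. Products without subscript are over $k$. Let $I_1,I_2\subset\mathcal O_{X\times X}$ be the ideal sheaves of the diagonal and of $X\times_YX$. Put $D=\Delta_X\times X$ and $\tilde D=X\times\Delta_X$, and let $j:U\times U\hookrightarrow X\times X$ be the open immersion. For an integer $r\ge 2$ let $\mathcal A_r\subset j_*\mathcal O_{U\times U}$ be the $\mathcal O_{X\times X}$-subalgebra generated by $I_1((r-1)D)$, $I_2(rD)$, $I_1((r-1)\tilde D)$ and $I_2(r\tilde D)$. Let $\Gamma_r=\operatorname{Spec}\mathcal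 A_r$ (relative spectrum, a scheme affine over $X\times X$), and let $p_1,p_2:\Gamma_r\to X$ be the compositions of $\Gamma_r\to X\times X$ with the two projections. Then there is a unique way to make $\Gamma_r\to X\times X$ into a groupoid on $X$ in the category of $k$-schemes. That is, there is exactly one triple consisting of a composition $c:\Gamma_r\times_{p_2,X,p_1}\Gamma_r\to\Gamma_r$, a unit $e:X\to\Gamma_r$ and an inversion $i:\Gamma_r\to\Gamma_r$ which, with $p_1$ as source and $p_2$ as target, satisfies the groupoid axioms. ($\Gamma_r$ with this structure is called the $r$-th Newton groupoid of $\varphi$.) -/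

import Mathlib

open CategoryTheory Limits AlgebraicGeometry

universe u

namespace NewtonGroupoid

/-! ### Groupoids in a category with fibre products -/

/-- A groupoid structure on a pair of morphisms `p₁ p₂ : Γ ⟶ X` ("source" and "target") of a
category with fibre products: a composition `c : Γ ×_X Γ ⟶ Γ` (defined on the pairs `(g, h)` with
`p₂ g = p₁ h`), a unit `e : X ⟶ Γ` and an inversion `i : Γ ⟶ Γ`, subject to the usual
identities; associativity is written on `T`-valued points. -/
@[ext]
structure GroupoidStructure {C : Type*} [Category C] [HasPullbacks C] {Γ X : C}
    (p₁ p₂ : Γ ⟶ X) where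
  /-- The composition law. -/
  c : pullback p₂ p₁ ⟶ Γ
  /-- The unit. -/
  e : X ⟶ Γ
  /-- The inversion. -/
  i : Γ ⟶ Γ
  c_p₁ : c ≫ p₁ = pullback.fst p₂ p₁ ≫ p₁
  c_p₂ : c ≫ p₂ = pullback.snd p₂ p₁ ≫ p₂
  e_p₁ : e ≫ p₁ = 𝟙 X
  e_p₂ : e ≫ p₂ = 𝟙 X
  i_p₁ : i ≫ p₁ = p₂
  i_p₂ : i ≫ p₂ = p₁
  assoc : ∀ {T : C} (g₁ g₂ g₃ : T ⟶ Γ) (h₁₂ : g₁ ≫ p₂ = g₂ ≫ p₁) (h₂₃ : g₂ ≫ p₂ = g₃ ≫ p₁),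
    pullback.lift (pullback.lift g₁ g₂ h₁₂ ≫ c) g₃
        (by rw [Category.assoc, c_p₂, pullback.lift_snd_assoc, h₂₃]) ≫ c =
      pullback.lift g₁ (pullback.lift g₂ g₃ h₂₃ ≫ c)
        (by rw [Category.assoc, c_p₁, pullback.lift_fst_assoc, h₁₂]) ≫ c
  unit_left : pullback.lift (p₁ ≫ e) (𝟙 Γ) (by simp [e_p₂]) ≫ c = 𝟙 Γ
  unit_right : pullback.lift (𝟙 Γ) (p₂ ≫ e) (by simp [e_p₁]) ≫ c = 𝟙 Γ
  inv_right : pullback.lift (𝟙 Γ) i (by simp [i_p₁]) ≫ c = p₁ ≫ e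
  inv_left : pullback.lift i (𝟙 Γ) (by simp [i_p₂]) ≫ c = p₂ ≫ e

/-! ### Relative spectra of quasi-coherent subalgebras of `j_* 𝒪_W` -/

section RelativeSpectrum

variable {T : Scheme.{u}}

/-- The restriction `Γ(T, V) ⟶ Γ(T, W ⊓ V) = Γ(V, j_* 𝒪_W)` of functions, for an open
`j : W ↪ T`. -/
def res (W V : T.Opens) : Γ(T, V) →+* Γ(T, W ⊓ V) :=
  (T.presheaf.map (homOfLE (inf_le_right : W ⊓ V ≤ V)).op).hom

/-- The restriction `Γ(V, j_* 𝒪_W) ⟶ Γ(V', j_* 𝒪_W)` for `V' ≤ V`. -/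
def resW (W : T.Opens) {V' V : T.Opens} (h : V' ≤ V) : Γ(T, W ⊓ V) →+* Γ(T, W ⊓ V') :=
  (T.presheaf.map (homOfLE (inf_le_inf_left W h)).op).hom

lemma resW_res (W : T.Opens) {V' V : T.Opens} (h : V' ≤ V) (a : Γ(T, V)) :
    resW W h (res W V a) = res W V' ((T.presheaf.map (homOfLE h).op).hom a) := by
  simp only [res, resW, ← CommRingCat.comp_apply, ← Functor.map_comp]
  rfl

lemma resW_self (W V : T.Opens) (a : Γ(T, W ⊓ V)) : resW W le_rfl a = a := by
  simp [resW]

lemma resW_resW (W : T.Opens) {V'' V' V : T.Opens} (h : V'' ≤ V') (h' : V' ≤ V)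
    (a : Γ(T, W ⊓ V)) : resW W h (resW W h' a) = resW W (h.trans h') a := by
  simp only [resW, ← CommRingCat.comp_apply, ← Functor.map_comp]
  rfl

lemma isCompact_inf [IsLocallyNoetherian T] (W : T.Opens) (V : T.affineOpens) :
    IsCompact ((W ⊓ V.1 : T.Opens) : Set T) := by
  have h := (W.ι.isCompact_preimage V.2.isCompact).image W.ι.continuous
  convert! h using 1
  ext x
  constructor
  · rintro ⟨hxW, hxV⟩
    exact ⟨⟨x, hxW⟩, hxV, rfl⟩
  · rintro ⟨y, hy, rfl⟩
    exact ⟨y.2, hy⟩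

lemma isQuasiSeparated_inf [IsLocallyNoetherian T] (W : T.Opens) (V : T.affineOpens) :
    IsQuasiSeparated ((W ⊓ V.1 : T.Opens) : Set T) :=
  (isQuasiSeparated_univ (α := T)).of_subset (Set.subset_univ _)

lemma basicOpen_res_eq (W V : T.Opens) (f : Γ(T, V)) :
    W ⊓ T.basicOpen f = T.basicOpen (res W V f) := by
  refine Eq.symm ((T.basicOpen_res f _).trans ?_)
  rw [inf_assoc, inf_eq_right.mpr (T.basicOpen_le f)]

lemma exists_of_map_eq {U O : T.Opens} (hU : IsCompact (U : Set T))
    (hU' : IsQuasiSeparated (U : Set T)) (g : Γ(T, U)) (hO : O = T.basicOpen g) (h : O ≤ U)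
    (a b : Γ(T, U)) (hab : (T.presheaf.map (homOfLE h).op).hom a =
      (T.presheaf.map (homOfLE h).op).hom b) : ∃ n : ℕ, g ^ n * a = g ^ n * b := by
  subst hO
  exact exists_of_res_eq_of_qcqs hU hU' hab

lemma exists_map_eq {U O : T.Opens} (hU : IsCompact (U : Set T))
    (hU' : IsQuasiSeparated (U : Set T)) (g : Γ(T, U)) (hO : O = T.basicOpen g) (h : O ≤ U)
    (s : Γ(T, O)) : ∃ (n : ℕ) (t : Γ(T, U)), (T.presheaf.map (homOfLE h).op).hom t =
      (T.presheaf.map (homOfLE h).op).hom g ^ n * s := by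
  subst hO
  exact exists_eq_pow_mul_of_isCompact_of_isQuasiSeparated T U hU hU' g s

lemma exists_of_resW_eq [IsLocallyNoetherian T] (W : T.Opens) (V V' : T.affineOpens)
    (f : Γ(T, V.1)) (hV' : V'.1 = T.basicOpen f) (h : V'.1 ≤ V.1) (a b : Γ(T, W ⊓ V.1))
    (hab : resW W h a = resW W h b) :
    ∃ n : ℕ, res W V.1 f ^ n * a = res W V.1 f ^ n * b :=
  exists_of_map_eq (isCompact_inf W V) (isQuasiSeparated_inf W V) _
    (by rw [hV']; exact basicOpen_res_eq W V.1 f) _ a b hab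

lemma exists_resW_eq [IsLocallyNoetherian T] (W : T.Opens) (V V' : T.affineOpens)
    (f : Γ(T, V.1)) (hV' : V'.1 = T.basicOpen f) (h : V'.1 ≤ V.1) (s : Γ(T, W ⊓ V'.1)) :
    ∃ (n : ℕ) (t : Γ(T, W ⊓ V.1)), resW W h t = resW W h (res W V.1 f) ^ n * s :=
  exists_map_eq (isCompact_inf W V) (isQuasiSeparated_inf W V) _
    (by rw [hV']; exact basicOpen_res_eq W V.1 f) _ s

/-- A quasi-coherent `𝒪_T`-subalgebra of `j_* 𝒪_W`, where `j : W ↪ T` is an open subscheme, given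
by its sections over the affine opens of `T`. -/
structure QCohSubalgebra (W : T.Opens) where
  /-- The sections over an affine open. -/
  carrier : ∀ V : T.affineOpens, Subring Γ(T, W ⊓ V.1)
  res_mem : ∀ (V : T.affineOpens) (a : Γ(T, V.1)), res W V.1 a ∈ carrier V
  resW_mem : ∀ {V' V : T.affineOpens} (h : V'.1 ≤ V.1) (s : Γ(T, W ⊓ V.1)),
    s ∈ carrier V → resW W h s ∈ carrier V'
  exists_pow : ∀ (V V' : T.affineOpens) (f : Γ(T, V.1)) (_ : V'.1 = T.basicOpen f)
    (h : V'.1 ≤ V.1) (s : Γ(T, W ⊓ V'.1)), s ∈ carrier V' →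
    ∃ n : ℕ, ∃ t ∈ carrier V, resW W h t = resW W h (res W V.1 f) ^ n * s

namespace QCohSubalgebra

variable {W : T.Opens} (A : QCohSubalgebra W)

/-- The functor `V ↦ 𝒜(V)` on the affine opens of `T`. -/
def functor : T.AffineZariskiSiteᵒᵖ ⥤ CommRingCat.{u} where
  obj V := .of (A.carrier ⟨V.unop.1, V.unop.2⟩)
  map {V V'} h := CommRingCat.ofHom <|
    ((resW W (Scheme.AffineZariskiSite.toOpens_mono h.unop.le)).comp
      (A.carrier ⟨V.unop.1, V.unop.2⟩).subtype).codRestrict (A.carrier ⟨V'.unop.1, V'.unop.2⟩)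
      fun s ↦ A.resW_mem (V' := ⟨V'.unop.1, V'.unop.2⟩) (V := ⟨V.unop.1, V.unop.2⟩) _ s.1 s.2
  map_id _ := CommRingCat.hom_ext (RingHom.ext fun s ↦ Subtype.ext (resW_self _ _ s.1))
  map_comp h h' := CommRingCat.hom_ext (RingHom.ext fun s ↦ Subtype.ext
    (resW_resW W (Scheme.AffineZariskiSite.toOpens_mono h'.unop.le)
      (Scheme.AffineZariskiSite.toOpens_mono h.unop.le) s.1).symm)

/-- The structure morphism `𝒪_T ⟶ 𝒜`. -/
def structureMap : (Scheme.AffineZariskiSite.toOpensFunctor T).op ⋙ T.presheaf ⟶ A.functor where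
  app V := CommRingCat.ofHom <|
    (res W V.unop.1).codRestrict (A.carrier ⟨V.unop.1, V.unop.2⟩)
      fun a ↦ A.res_mem ⟨V.unop.1, V.unop.2⟩ a
  naturality V V' h := by
    ext a
    exact Subtype.ext (resW_res W (Scheme.AffineZariskiSite.toOpens_mono h.unop.le) a).symm

lemma coequifibered [IsLocallyNoetherian T] : A.structureMap.Coequifibered := by
  refine Scheme.AffineZariskiSite.coequifibered_iff_forall_isLocalizationAway.mpr fun V f ↦ ?_
  let algA := (A.functor.map (homOfLE (V.basicOpen_le f)).op).hom.toAlgebra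
  have hunit : IsUnit ((T.presheaf.map (homOfLE (T.basicOpen_le f)).op).hom f) :=
    RingedSpace.isUnit_res_basicOpen _ f
  have hval (t : A.functor.obj (.op V)) : ((algebraMap (A.functor.obj (.op V))
      (A.functor.obj (.op (V.basicOpen f))) t).1 : Γ(T, W ⊓ T.basicOpen f)) =
      resW W (T.basicOpen_le f) t.1 := rfl
  have hval' : ((A.structureMap.app (.op V) f).1 : Γ(T, W ⊓ V.1)) = res W V.1 f := rfl
  constructor; constructor
  · rintro ⟨_, n, rfl⟩
    simp only [map_pow]
    refine IsUnit.pow _ ?_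
    have : algebraMap (A.functor.obj (.op V)) (A.functor.obj (.op (V.basicOpen f)))
        (A.structureMap.app (.op V) f) = (A.structureMap.app (.op (V.basicOpen f))).hom
          ((T.presheaf.map (homOfLE (T.basicOpen_le f)).op).hom f) :=
      Subtype.ext (resW_res W (T.basicOpen_le f) f)
    rw [this]
    exact hunit.map (A.structureMap.app (.op (V.basicOpen f))).hom
  · intro s
    obtain ⟨n, t, ht, h⟩ := A.exists_pow ⟨V.1, V.2⟩ (T.affineBasicOpen (U := ⟨V.1, V.2⟩) f) f rfl
      (T.basicOpen_le f) s.1 s.2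
    refine ⟨(⟨t, ht⟩, ⟨_, n, rfl⟩), Subtype.ext ?_⟩
    refine Eq.trans ?_ h.symm
    rw [mul_comm]
    change _ * _ = _ * _
    congr 1
    simp only [map_pow]
    rfl
  · intro a b hab
    have h1 : resW W (T.basicOpen_le f) a.1 = resW W (T.basicOpen_le f) b.1 :=
      congr_arg Subtype.val hab
    obtain ⟨n, hc⟩ := exists_of_resW_eq W ⟨V.1, V.2⟩ (T.affineBasicOpen (U := ⟨V.1, V.2⟩) f) f
      rfl (T.basicOpen_le f) a.1 b.1 h1
    refine ⟨⟨_, n, rfl⟩, Subtype.ext ?_⟩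
    change ((A.structureMap.app (.op V) f) ^ n : A.functor.obj (.op V)).1 * a.1 =
      ((A.structureMap.app (.op V) f) ^ n : A.functor.obj (.op V)).1 * b.1
    exact hc

/-- The relative spectrum `Spec 𝒜` as a scheme: the gluing of the schemes `Spec 𝒜(V)`, with `V`
running over the affine opens of `T`. -/
noncomputable def spec [IsLocallyNoetherian T] : Scheme.{u} :=
  (Scheme.AffineZariskiSite.relativeGluingData A.coequifibered).glued

/-- The structure morphism `Spec 𝒜 ⟶ T`. -/
noncomputable def specHom [IsLocallyNoetherian T] : A.spec ⟶ T :=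
  (Scheme.AffineZariskiSite.relativeGluingData A.coequifibered).toBase

end QCohSubalgebra

/-! ### Twists of ideals and the algebra `𝒜_r` -/

/-- The sections over an affine open `V` of `I(mD) ⊆ j_* 𝒪_W`, where `j : W ↪ T` is the
complement of (a closed subset containing) the effective Cartier divisor with ideal sheaf `D`: the
functions `s` on `W ⊓ V` such that `a s ∈ I` for all `a ∈ D ^ m`. -/
def twist (W : T.Opens) (I D : T.IdealSheafData) (m : ℕ) (V : T.affineOpens) :
    Set Γ(T, W ⊓ V.1) :=
  {s | ∀ a ∈ (D ^ m).ideal V, ∃ b ∈ I.ideal V, res W V.1 a * s = res W V.1 b}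

/-- The multipliers of `t` into `I`. -/
def multipliers (W : T.Opens) (I : T.IdealSheafData) (V : T.affineOpens)
    (t : Γ(T, W ⊓ V.1)) : Ideal Γ(T, V.1) where
  carrier := {a | ∃ b ∈ I.ideal V, res W V.1 a * t = res W V.1 b}
  zero_mem' := ⟨0, zero_mem _, by simp⟩
  add_mem' := by
    rintro a a' ⟨b, hb, h⟩ ⟨b', hb', h'⟩
    exact ⟨b + b', add_mem hb hb', by rw [map_add, add_mul, h, h', map_add]⟩
  smul_mem' := by
    rintro c a ⟨b, hb, h⟩
    exact ⟨c * b, Ideal.mul_mem_left _ _ hb, by rw [smul_eq_mul, map_mul, mul_assoc, h, map_mul]⟩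

lemma mem_twist_iff (W : T.Opens) (I D : T.IdealSheafData) (m : ℕ) (V : T.affineOpens)
    (s : Γ(T, W ⊓ V.1)) : s ∈ twist W I D m V ↔ (D ^ m).ideal V ≤ multipliers W I V s :=
  Iff.rfl

lemma resW_mem_twist (W : T.Opens) (I D : T.IdealSheafData) (m : ℕ) {V' V : T.affineOpens}
    (h : V'.1 ≤ V.1) (s : Γ(T, W ⊓ V.1)) (hs : s ∈ twist W I D m V) :
    resW W h s ∈ twist W I D m V' := by
  rw [mem_twist_iff, ← (D ^ m).map_ideal (U := V') (V := V) h, Ideal.map_le_iff_le_comap]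
  intro a ha
  obtain ⟨b, hb, e⟩ := hs a ha
  refine ⟨(T.presheaf.map (homOfLE h).op).hom b, I.ideal_le_comap_ideal (U := V') (V := V) h hb, ?_⟩
  have e' := congr_arg (resW W h) e
  rw [map_mul, resW_res, resW_res] at e'
  exact e'

lemma exists_pow_twist [IsLocallyNoetherian T] (W : T.Opens) (I D : T.IdealSheafData) (m : ℕ)
    (V V' : T.affineOpens) (f : Γ(T, V.1)) (hV' : V'.1 = T.basicOpen f) (h : V'.1 ≤ V.1)
    (s : Γ(T, W ⊓ V'.1)) (hs : s ∈ twist W I D m V') :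
    ∃ n : ℕ, ∃ t ∈ twist W I D m V, resW W h t = resW W h (res W V.1 f) ^ n * s := by
  obtain ⟨n, t, ht⟩ := exists_resW_eq W V V' f hV' h s
  let ρ : Γ(T, V.1) →+* Γ(T, V'.1) := (T.presheaf.map (homOfLE h).op).hom
  have hρ (x : Γ(T, V.1)) : resW W h (res W V.1 x) = res W V'.1 (ρ x) := resW_res W h x
  have step (a : Γ(T, V.1)) (ha : a ∈ (D ^ m).ideal V) :
      ∃ N : ℕ, f ^ N * a ∈ multipliers W I V t := by
    have ha' : ρ a ∈ (D ^ m).ideal V' :=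
      (D ^ m).ideal_le_comap_ideal (U := V') (V := V) h ha
    obtain ⟨b, hb, e⟩ := hs _ ha'
    let inst : Algebra Γ(T, V.1) Γ(T, V'.1) := ρ.toAlgebra
    have hloc : IsLocalization.Away f Γ(T, V'.1) :=
      V.2.isLocalization_of_eq_basicOpen f (homOfLE h) hV'
    rw [← I.map_ideal (U := V') (V := V) h] at hb
    obtain ⟨⟨⟨c, hc⟩, ⟨_, l, rfl⟩⟩, hbc⟩ :=
      (IsLocalization.mem_map_algebraMap_iff (.powers f) Γ(T, V'.1)).mp hb
    replace hbc : b * ρ (f ^ l) = ρ c := hbc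
    have key : resW W h (res W V.1 (f ^ l * a) * t) = resW W h (res W V.1 (f ^ n * c)) := by
      rw [map_mul, ht, hρ, hρ, hρ, map_mul ρ (f ^ n), ← hbc]
      simp only [map_mul, map_pow]
      rw [← e]
      ring
    obtain ⟨M, hM⟩ := exists_of_resW_eq W V V' f hV' h _ _ key
    refine ⟨M + l, f ^ M * (f ^ n * c), Ideal.mul_mem_left _ _ (Ideal.mul_mem_left _ _ hc), ?_⟩
    rw [pow_add, mul_assoc, map_mul, mul_assoc, map_pow, hM, map_mul (res W V.1) (f ^ M), map_pow]
  have : IsNoetherianRing Γ(T, V.1) := IsLocallyNoetherian.component_noetherian V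
  obtain ⟨S, hS⟩ := (isNoetherianRing_iff_ideal_fg _).mp this ((D ^ m).ideal V)
  have hS' : ∀ a ∈ S, a ∈ (D ^ m).ideal V := fun a ha ↦ hS ▸ Ideal.subset_span ha
  have : ∃ N : ℕ, ∀ a ∈ S, f ^ N * a ∈ multipliers W I V t := by
    choose! N hN using step
    refine ⟨S.sup N, fun a ha ↦ ?_⟩
    obtain ⟨d, hd⟩ := Nat.exists_eq_add_of_le (Finset.le_sup (f := N) ha)
    rw [hd, add_comm, pow_add, mul_assoc]
    exact Ideal.mul_mem_left _ _ (hN a (hS' a ha))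
  obtain ⟨N, hN⟩ := this
  refine ⟨N + n, res W V.1 f ^ N * t, ?_, ?_⟩
  · rw [mem_twist_iff, ← hS, Ideal.span_le]
    intro a ha
    obtain ⟨b, hb, e⟩ := hN a ha
    exact ⟨b, hb, by rw [← e, map_mul, map_pow]; ring⟩
  · rw [map_mul, ht, map_pow, pow_add, mul_assoc]

/-- Let `j : W ↪ T` be an open subscheme, and `I₁`, `I₂`, `D`, `D'` ideal sheaves on `T`. This is
the `𝒪_T`-subalgebra of `j_* 𝒪_W` generated by `I₁((r-1)D)`, `I₂(rD)`, `I₁((r-1)D')` and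
`I₂(rD')`. -/
noncomputable def blowUpAlgebra [IsLocallyNoetherian T] (W : T.Opens)
    (I₁ I₂ D D' : T.IdealSheafData) (r : ℕ) : QCohSubalgebra W where
  carrier V := Subring.closure (Set.range (res W V.1) ∪
    (twist W I₁ D (r - 1) V ∪ twist W I₂ D r V ∪ twist W I₁ D' (r - 1) V ∪ twist W I₂ D' r V))
  res_mem V a := Subring.subset_closure (Or.inl ⟨a, rfl⟩)
  resW_mem {V' V} h s hs := by
    rw [← Subring.mem_comap]
    refine (Subring.closure_le (t := Subring.comap (resW W h) _)).mpr ?_ hs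
    rintro s (⟨a, rfl⟩ | ((hs | hs) | hs) | hs)
    · exact Subring.subset_closure (Or.inl ⟨_, (resW_res W h a).symm⟩)
    · exact Subring.subset_closure (Or.inr (Or.inl (Or.inl (Or.inl (resW_mem_twist _ _ _ _ h _ hs)))))
    · exact Subring.subset_closure (Or.inr (Or.inl (Or.inl (Or.inr (resW_mem_twist _ _ _ _ h _ hs)))))
    · exact Subring.subset_closure (Or.inr (Or.inl (Or.inr (resW_mem_twist _ _ _ _ h _ hs))))
    · exact Subring.subset_closure (Or.inr (Or.inr (resW_mem_twist _ _ _ _ h _ hs)))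
  exists_pow V V' f hV' h s hs := by
    have hf : res W V.1 f ∈ Subring.closure (Set.range (res W V.1) ∪
        (twist W I₁ D (r - 1) V ∪ twist W I₂ D r V ∪ twist W I₁ D' (r - 1) V ∪
          twist W I₂ D' r V)) := Subring.subset_closure (Or.inl ⟨f, rfl⟩)
    induction hs using Subring.closure_induction with
    | mem s hs =>
      rcases hs with ⟨a, rfl⟩ | ((hs | hs) | hs) | hs
      · obtain ⟨n, b, hb⟩ := exists_map_eq V.2.isCompact V.2.isQuasiSeparated f hV' h a
        refine ⟨n, res W V.1 b, Subring.subset_closure (Or.inl ⟨b, rfl⟩), ?_⟩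
        rw [resW_res, hb, resW_res, map_mul, map_pow]
      · obtain ⟨n, t, ht, e⟩ := exists_pow_twist W I₁ D (r - 1) V V' f hV' h s hs
        exact ⟨n, t, Subring.subset_closure (Or.inr (Or.inl (Or.inl (Or.inl ht)))), e⟩
      · obtain ⟨n, t, ht, e⟩ := exists_pow_twist W I₂ D r V V' f hV' h s hs
        exact ⟨n, t, Subring.subset_closure (Or.inr (Or.inl (Or.inl (Or.inr ht)))), e⟩
      · obtain ⟨n, t, ht, e⟩ := exists_pow_twist W I₁ D' (r - 1) V V' f hV' h s hs
        exact ⟨n, t, Subring.subset_closure (Or.inr (Or.inl (Or.inr ht))), e⟩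
      · obtain ⟨n, t, ht, e⟩ := exists_pow_twist W I₂ D' r V V' f hV' h s hs
        exact ⟨n, t, Subring.subset_closure (Or.inr (Or.inr ht)), e⟩
    | zero => exact ⟨0, 0, zero_mem _, by simp⟩
    | one => exact ⟨0, 1, one_mem _, by simp⟩
    | add x y _ _ hx hy =>
      obtain ⟨n, t, ht, e⟩ := hx
      obtain ⟨n', t', ht', e'⟩ := hy
      refine ⟨n + n', res W V.1 f ^ n' * t + res W V.1 f ^ n * t',
        add_mem (mul_mem (pow_mem hf _) ht) (mul_mem (pow_mem hf _) ht'), ?_⟩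
      simp only [map_add, map_mul, map_pow, e, e']
      ring
    | neg x _ hx =>
      obtain ⟨n, t, ht, e⟩ := hx
      exact ⟨n, -t, neg_mem ht, by rw [map_neg, e, mul_neg]⟩
    | mul x y _ _ hx hy =>
      obtain ⟨n, t, ht, e⟩ := hx
      obtain ⟨n', t', ht', e'⟩ := hy
      refine ⟨n + n', t * t', mul_mem ht ht', ?_⟩
      simp only [map_mul, e, e']
      ring

end RelativeSpectrum

/-! ### The étale locus, the different, local complete intersections -/

/-- The étale locus of `φ`: the largest open on which `φ` is étale. -/
def etaleLocus {X Y : Scheme.{u}} (φ : X ⟶ Y) : X.Opens :=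
  sSup {V : X.Opens | Etale (V.ι ≫ φ)}

/-- `d` is an equation of the divisor associated to the `R`-module `M`, i.e. `d = det f` for some
resolution `0 ⟶ Rⁿ ⟶ Rⁿ ⟶ M ⟶ 0` with first map `f`. -/
def IsDivisorEquation (R M : Type*) [CommRing R] [AddCommGroup M] [Module R M] (d : R) : Prop :=
  ∃ (n : ℕ) (f : (Fin n → R) →ₗ[R] (Fin n → R)) (g : (Fin n → R) →ₗ[R] M),
    Function.Injective f ∧ Function.Exact f g ∧ Function.Surjective g ∧ d = LinearMap.det f

/-- The ideal of the divisor associated to the module of differentials `Ω¹_{X/Y}` in the local ring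
of `X` at `x`; here `(Ω¹_{X/Y})_x` is the module of differentials of `𝒪_{X,x}` over
`𝒪_{Y,φ(x)}`. -/
noncomputable def differentStalk {X Y : Scheme.{u}} (φ : X ⟶ Y) (x : X) : Ideal (X.presheaf.stalk x) :=
  letI := (φ.stalkMap x).hom.toAlgebra
  Ideal.span {d | IsDivisorEquation (X.presheaf.stalk x)
    (Ω[X.presheaf.stalk x⁄Y.presheaf.stalk (φ x)]) d}

/-- The ideal sheaf of the different `Δ_X` of `φ`, i.e. of the effective Cartier divisor on `X`
associated to `Ω¹_{X/Y}`: the ideal sheaf of the functions whose germs at all points lie in the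
ideals `differentStalk φ x`. -/
noncomputable def different {X Y : Scheme.{u}} (φ : X ⟶ Y) : X.IdealSheafData :=
  .ofIdeals fun V ↦ ⨅ x : V.1,
    (differentStalk φ x.1).comap (X.presheaf.germ V.1 x.1 x.2).hom

/-- A scheme `X` over a field `k` is a locally complete intersection if every point has an open
neighbourhood which is isomorphic, over `k`, to the spectrum of the quotient of a polynomial ring
`k[t₁, …, tₙ]` by a regular sequence. -/
def IsLocallyCompleteIntersection {k : Type u} [Field k] {X : Scheme.{u}}
    (p : X ⟶ Spec (.of k)) : Prop :=
  ∀ x : X, ∃ V : X.Opens, x ∈ V ∧ ∃ (n : ℕ) (f : List (MvPolynomial (Fin n) k)),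
    RingTheory.Sequence.IsRegular (MvPolynomial (Fin n) k) f ∧
    ∃ e : V.toScheme ≅ Spec (.of (MvPolynomial (Fin n) k ⧸ Ideal.ofList f)),
      e.hom ≫ Spec.map (CommRingCat.ofHom
        (algebraMap k (MvPolynomial (Fin n) k ⧸ Ideal.ofList f))) = V.ι ≫ p

/-! ### The scheme `Γ_r` over `X × X` -/

instance isLocallyNoetherian_pullback {k : Type u} [Field k] {X : Scheme.{u}}
    (p : X ⟶ Spec (.of k)) [LocallyOfFiniteType p] : IsLocallyNoetherian (pullback p p) := by
  have : IsLocallyNoetherian X := LocallyOfFiniteType.isLocallyNoetherian p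
  infer_instance

section Newton

variable {X Y S : Scheme.{u}} (φ : X ⟶ Y) (q : Y ⟶ S)
  [IsLocallyNoetherian (pullback (φ ≫ q) (φ ≫ q))]

/-- The algebra `𝒜_r` on `X ×_S X`, where `X` is an `S`-scheme via `φ ≫ q`: the subalgebra of
`j_* 𝒪_{U × U}`, with `U` the étale locus of `φ`, generated by `I₁((r-1)D)`, `I₂(rD)`,
`I₁((r-1)D')`, `I₂(rD')`. Here `I₁` and `I₂` are the ideal sheaves of the diagonal and of
`X ×_Y X`, and `D = Δ_X × X`, `D' = X × Δ_X`. -/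
noncomputable def newtonAlgebra (r : ℕ) :
    QCohSubalgebra (pullback.fst (φ ≫ q) (φ ≫ q) ⁻¹ᵁ etaleLocus φ ⊓
      pullback.snd (φ ≫ q) (φ ≫ q) ⁻¹ᵁ etaleLocus φ) :=
  blowUpAlgebra _
    (pullback.diagonal (φ ≫ q)).ker
    (pullback.mapDesc φ φ q).ker
    ((different φ).comap (pullback.fst (φ ≫ q) (φ ≫ q)))
    ((different φ).comap (pullback.snd (φ ≫ q) (φ ≫ q)))
    r

/-- The scheme `Γ_r = Spec 𝒜_r`. -/
noncomputable def newtonScheme (r : ℕ) : Scheme.{u} :=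
  (newtonAlgebra φ q r).spec

/-- The affine morphism `Γ_r ⟶ X ×_S X`. -/
noncomputable def newtonHom (r : ℕ) : newtonScheme φ q r ⟶ pullback (φ ≫ q) (φ ≫ q) :=
  (newtonAlgebra φ q r).specHom

/-- The first projection `Γ_r ⟶ X`. -/
noncomputable def newtonP₁ (r : ℕ) : newtonScheme φ q r ⟶ X :=
  newtonHom φ q r ≫ pullback.fst (φ ≫ q) (φ ≫ q)

/-- The second projection `Γ_r ⟶ X`. -/
noncomputable def newtonP₂ (r : ℕ) : newtonScheme φ q r ⟶ X :=
  newtonHom φ q r ≫ pullback.snd (φ ≫ q) (φ ≫ q)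

end Newton

end NewtonGroupoid

/-! Let `d` be a local equation of the different, and let `(a, b)` be a pair of points of `X` with
values in a `k`-scheme. The generators of `𝒜_r` force the following at a point of `Γ_r` outside the
preimage of `U × U`: `d(a)` and `d(b)` divide each other, `a ≡ b` modulo `d(a) ^ (r - 1)`, and `φ a
≡ φ b` modulo `d(a) ^ r`. This condition (`Close` in a chart, `Good` globally) is an equivalence
relation. So the operations have to be `(a, b), (b, c) ↦ (a, c)`, `a ↦ (a, a)` and `(a, b) ↦ (b,
a)`, and every axiom, as well as uniqueness, follows as soon as the maps in question are determined
by their two projections.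

The difficulty is that `𝒜_r` only consists of functions on `U × U`. Hence a good pair lifts to `Γ_r`
(`exists_newton_lift`), and lifts uniquely (`newton_hom_ext`), only from a scheme in which the
preimage of `U` is schematically dense. This holds for schemes flat over `X`, because `d` is a
nonzerodivisor (`schDense_of_flat`). Everything thus rests on the flatness of the first projection
(`flat_newtonP₁`).

Over `U × U` the scheme `Γ_r` is `X × X`, which is flat over `X`; all its other points lie over the
diagonal. There, take étale coordinates `y` on `Y` and write `X` by `n` equations `f` in `n` further
variables `x` over `k[y]`, with Jacobian matrix `J = ∂f/∂x` and `d = det J`. Substitute `y + d ^ r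
v` and `x + d ^ (r - 1) w`. As `2(r - 1) ≥ r`, Taylor expansion gives `f = d ^ (r - 1) J w + d ^ r
q`, and multiplication by the adjugate of `J` gives `d ^ r G` with `G = w + adj(J) q`. The algebra
`R[v, w]/(G)` with `det ∂G/∂w` inverted is étale over `R[v]`, hence flat over `R` (`exists_model`),
and near the diagonal it is `𝒜_r` (`flat_twistAlgebra`).

The square shape comes from the complete intersection hypothesis (`exists_chart`). For `X = Spec
k[t₁, …, t_N]/(g₁, …, g_m)` and `Y` étale over affine `ε`-space, adjoin the equations of the graph;
that `m + ε = N` is seen at a generic point, where `φ` is étale. Polynomial rings are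
Cohen–Macaulay, so the `g_i` have no embedded primes and `d`, which lies in no minimal prime, is a
nonzerodivisor. Finally `J` presents `Ω¹_{X/Y}`, so `d` is an equation of the different. -/

namespace NewtonGroupoid

open MvPolynomial

/-! ### First-order Taylor expansion and adjugate matrices -/

section Taylor

variable {A B n : Type*} [CommRing A] [CommRing B]

lemma eval₂_sub_eval₂_mem (I : Ideal B) (σ τ : A →+* B) (h : ∀ a, σ a - τ a ∈ I) (x : n → B)
    (p : MvPolynomial n A) : eval₂ σ x p - eval₂ τ x p ∈ I := by
  rw [← Ideal.Quotient.eq, hom_eval₂, hom_eval₂]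
  congr 1
  ext a
  exact Ideal.Quotient.eq.mpr (h a)

/-- Only divisibility of the remainder by `c ^ 2` is claimed, so no factorials occur and the
characteristic plays no role. Induction on the polynomial, with the Leibniz rule for multiplication
by a variable. -/
lemma eval₂_taylor_mem [Fintype n] [DecidableEq n] (τ : A →+* B) (x w : n → B) (c : B)
    (p : MvPolynomial n A) :
    eval₂ τ (fun l ↦ x l + c * w l) p - eval₂ τ x p -
      c * ∑ l, w l * eval₂ τ x (pderiv l p) ∈ Ideal.span {c ^ 2} := by
  induction p using MvPolynomial.induction_on with
  | C a => simp
  | add p q hp hq =>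
    convert add_mem hp hq using 1
    simp only [eval₂_add, map_add, mul_add, Finset.sum_add_distrib]
    ring
  | mul_X p m hp =>
    rw [Ideal.mem_span_singleton] at hp ⊢
    obtain ⟨s, hs⟩ := hp
    refine ⟨s * (x m + c * w m) + w m * ∑ l, w l * eval₂ τ x (pderiv l p), ?_⟩
    have h1 : ∑ l, w l * eval₂ τ x (pderiv l (p * X m)) =
        (∑ l, w l * eval₂ τ x (pderiv l p)) * x m + w m * eval₂ τ x p := by
      have (l : n) : w l * eval₂ τ x (pderiv l (p * X m)) =
          w l * eval₂ τ x (pderiv l p) * x m + if l = m then w m * eval₂ τ x p else 0 := by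
        rw [pderiv_mul, eval₂_add, eval₂_mul, eval₂_mul, eval₂_X, pderiv_X]
        by_cases h : l = m
        · subst h; simp; ring
        · simp [h, Ne.symm h]; ring
      simp only [this, Finset.sum_add_distrib, Finset.sum_mul]
      simp
    rw [h1, eval₂_mul, eval₂_mul, eval₂_X, eval₂_X]
    linear_combination (x m + c * w m) * hs

lemma pderiv_eval₂_C_add [DecidableEq n] {D : Type*} [CommRing D] (σ : A →+* D) (x : n → D)
    (c : D) (m : n) (p : MvPolynomial n A) :
    pderiv m (eval₂ (C.comp σ) (fun l ↦ C (x l) + C c * X l) p : MvPolynomial n D) =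
      C c * eval₂ (C.comp σ) (fun l ↦ C (x l) + C c * X l) (pderiv m p) := by
  induction p using MvPolynomial.induction_on with
  | C a => simp
  | add p q hp hq => simp only [eval₂_add, map_add, hp, hq, mul_add]
  | mul_X p l hp =>
    rw [eval₂_mul, eval₂_X, pderiv_mul, hp, pderiv_mul, eval₂_add, eval₂_mul, eval₂_mul, eval₂_X,
      pderiv_X, map_add, pderiv_mul, pderiv_C, pderiv_C, pderiv_X]
    by_cases h : m = l
    · subst h; simp; ring
    · simp [Ne.symm h]; ring

end Taylor

section Adjugate

variable {A B n : Type*} [CommRing A] [CommRing B] [Fintype n] [DecidableEq n]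

/-- Since `adj J · J = det J` and `c · det J = e`, the linear term acquires the same factor `e` as
the error term. -/
lemma sum_adjugate_mul_eq (ρ : A →+* B) (J : Matrix n n A) (c e : B) (w q F : n → B)
    (he : c * ρ J.det = e) (hF : ∀ i, F i = c * ∑ l, w l * ρ (J i l) + e * q i) (l : n) :
    ∑ i, ρ (J.adjugate l i) * F i = e * (w l + ∑ i, ρ (J.adjugate l i) * q i) := by
  have hadj : (J.map ρ).adjugate = J.adjugate.map ρ := (ρ.map_adjugate J).symm
  have key : ∑ i, ρ (J.adjugate l i) * ∑ m, w m * ρ (J i m) = ρ J.det * w l := by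
    have h : ((J.map ρ).adjugate * J.map ρ).mulVec w l = ρ J.det * w l := by
      rw [Matrix.adjugate_mul, Matrix.smul_mulVec, Matrix.one_mulVec, ← RingHom.mapMatrix_apply,
        ← RingHom.map_det]
      rfl
    rw [← h, ← Matrix.mulVec_mulVec, hadj]
    simp only [Matrix.mulVec, dotProduct, Matrix.map_apply, mul_comm (w _)]
  simp only [hF, mul_add, Finset.sum_add_distrib]
  congr 1
  · rw [← he, mul_assoc, ← key, Finset.mul_sum]
    exact Finset.sum_congr rfl fun i _ ↦ by ring
  · rw [Finset.mul_sum]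
    exact Finset.sum_congr rfl fun i _ ↦ by ring

/-- The hypothesis reads `adj J · F = det J · G`. Multiplication by `J` gives `det J · F = det J · J
G`; cancel `det J` and take determinants in `F = J G`. -/
lemma det_mul_det_eq (ρ : A →+* B) (J : Matrix n n A) (hJ : ρ J.det ∈ nonZeroDivisors B)
    (G F : n → n → B) (h : ∀ l m, ∑ i, ρ (J.adjugate l i) * F i m = ρ J.det * G l m) :
    ρ J.det * (Matrix.of G).det = (Matrix.of F).det := by
  have hadj : (J.map ρ).adjugate = J.adjugate.map ρ := (ρ.map_adjugate J).symm
  have hdet : (J.map ρ).det = ρ J.det := (ρ.map_det J).symm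
  have hmat : (J.map ρ).adjugate * Matrix.of F = ρ J.det • Matrix.of G := by
    ext l m
    rw [hadj, Matrix.mul_apply]
    exact h l m
  have h1 : J.map ρ * ((J.map ρ).adjugate * Matrix.of F) = ρ J.det • Matrix.of F := by
    rw [← mul_assoc, Matrix.mul_adjugate, hdet, Matrix.smul_mul, one_mul]
  rw [hmat, Matrix.mul_smul] at h1
  have h2 : J.map ρ * Matrix.of G = Matrix.of F := by
    ext i m
    exact (mul_cancel_left_mem_nonZeroDivisors hJ).mp congr($h1 i m)
  rw [← h2, Matrix.det_mul, hdet]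

end Adjugate

/-! ### Square presentations and the deformed equations -/

/-- A presentation of a `k`-algebra `R` with coordinate functions `y`, by as many equations as
further variables. -/
structure SquarePresentation (k R : Type*) [CommRing k] [CommRing R] [Algebra k R]
    (ι n : Type*) where
  y : ι → R
  x : n → R
  f : n → MvPolynomial n (MvPolynomial ι k)
  surjective : Function.Surjective (eval₂Hom (aeval (R := k) y).toRingHom x)
  ker_eq : RingHom.ker (eval₂Hom (aeval (R := k) y).toRingHom x) = Ideal.span (Set.range f)

namespace SquarePresentation

variable {k R ι n : Type*} [CommRing k] [CommRing R] [Algebra k R]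
  (P : SquarePresentation k R ι n)

/-- The homomorphism `k[y] ⟶ R`. -/
noncomputable abbrev coeffHom : MvPolynomial ι k →+* R := (aeval (R := k) P.y).toRingHom

/-- The homomorphism `k[y][x] ⟶ R`. -/
noncomputable abbrev evalHom : MvPolynomial n (MvPolynomial ι k) →+* R := eval₂Hom P.coeffHom P.x

/-- The Jacobian matrix with respect to `x`. -/
noncomputable def jac : Matrix n n R := .of fun i l ↦ P.evalHom (pderiv l (P.f i))

/-- The Jacobian determinant with respect to `x`. -/
noncomputable def det [Fintype n] [DecidableEq n] : R := P.jac.det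

lemma evalHom_f (i : n) : P.evalHom (P.f i) = 0 := by
  rw [← RingHom.mem_ker]
  exact P.ker_eq ▸ Ideal.subset_span ⟨i, rfl⟩

lemma ringHom_ext {N : Type*} [CommRing N] {a b : R →+* N}
    (h : a.comp (algebraMap k R) = b.comp (algebraMap k R)) (hy : ∀ j, a (P.y j) = b (P.y j))
    (hx : ∀ l, a (P.x l) = b (P.x l)) : a = b := by
  have : a.comp P.evalHom = b.comp P.evalHom := by
    refine MvPolynomial.ringHom_ext' (MvPolynomial.ringHom_ext' ?_ ?_) ?_
    · ext c
      simpa using! congr($h c)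
    · simpa using! hy
    · simpa using! hx
  ext s
  obtain ⟨s, rfl⟩ := P.surjective s
  exact congr($this s)

section Deformation

variable (r : ℕ) (d : R)

/-- The homomorphism `k[y] ⟶ R[v]`, `y ↦ y + d ^ r v`. -/
noncomputable def shiftCoeff : MvPolynomial ι k →+* MvPolynomial ι R :=
  eval₂Hom (C.comp (algebraMap k R)) fun j ↦ C (P.y j) + C (d ^ r) * X j

/-- The homomorphism `k[y][x] ⟶ R[v][w]`, `y ↦ y + d ^ r v`, `x ↦ x + d ^ (r - 1) w`. -/
noncomputable def shift : MvPolynomial n (MvPolynomial ι k) →+* MvPolynomial n (MvPolynomial ι R) :=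
  eval₂Hom (C.comp (P.shiftCoeff r d)) fun l ↦ C (C (P.x l)) + C (C (d ^ (r - 1))) * X l

lemma shiftCoeff_sub_mem (a : MvPolynomial ι k) :
    P.shiftCoeff r d a - C (P.coeffHom a) ∈ Ideal.span {(C (d ^ r) : MvPolynomial ι R)} := by
  rw [← Ideal.Quotient.eq]
  have : (Ideal.Quotient.mk (Ideal.span {(C (d ^ r) : MvPolynomial ι R)})).comp (P.shiftCoeff r d) =
      (Ideal.Quotient.mk _).comp (C.comp P.coeffHom) := by
    refine MvPolynomial.ringHom_ext (fun c ↦ ?_) fun j ↦ ?_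
    · simp [shiftCoeff]
    · simp only [shiftCoeff, RingHom.comp_apply, coe_eval₂Hom, eval₂_X, AlgHom.toRingHom_eq_coe,
        RingHom.coe_coe, aeval_X]
      rw [Ideal.Quotient.eq, add_sub_cancel_left]
      exact Ideal.mul_mem_right _ _ (Ideal.mem_span_singleton_self _)
  exact congr($this a)

lemma C_C_mem_nonZeroDivisors {a : R} (ha : a ∈ nonZeroDivisors R) :
    (C (C a) : MvPolynomial n (MvPolynomial ι R)) ∈ nonZeroDivisors _ := by
  rw [mem_nonZeroDivisors_iff_right] at ha ⊢
  intro p hp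
  ext i j
  refine ha _ ?_
  rw [mul_comm, ← coeff_C_mul, ← coeff_C_mul, mul_comm, hp]
  simp

variable [Fintype n] [DecidableEq n]

/-- Two errors go into `d ^ r q`: the displacement of the coefficients by `d ^ r v`, and the
quadratic Taylor remainder in `d ^ (r - 1) w`. The constant term vanishes because `x` solves the
equations. -/
lemma exists_shift_f_eq (hr : 2 ≤ r) (i : n) :
    ∃ q, P.shift r d (P.f i) = C (C (d ^ (r - 1))) * ∑ l, X l * C (C (P.jac i l)) +
      C (C (d ^ r)) * q := by
  let τ : MvPolynomial ι k →+* MvPolynomial n (MvPolynomial ι R) := C.comp (C.comp P.coeffHom)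
  let D : MvPolynomial n (MvPolynomial ι R) := C (C (d ^ r))
  have h1 : P.shift r d (P.f i) - eval₂ τ (fun l ↦ C (C (P.x l)) + C (C (d ^ (r - 1))) * X l) (P.f i)
      ∈ Ideal.span {D} := by
    refine eval₂_sub_eval₂_mem _ _ _ (fun a ↦ ?_) _ _
    obtain ⟨s, hs⟩ := Ideal.mem_span_singleton.mp (P.shiftCoeff_sub_mem r d a)
    refine Ideal.mem_span_singleton.mpr ⟨C s, ?_⟩
    simp only [τ, D, RingHom.comp_apply, ← map_sub, ← map_mul]
    exact congr(C $hs)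
  have h2 := eval₂_taylor_mem τ (fun l ↦ C (C (P.x l))) X (C (C (d ^ (r - 1)))) (P.f i)
  have h3 : Ideal.span {(C (C (d ^ (r - 1))) : MvPolynomial n (MvPolynomial ι R)) ^ 2} ≤
      Ideal.span {D} := by
    -- The remainder is a multiple of `d ^ (2 (r - 1))`, and `2 (r - 1) ≥ r` because `r ≥ 2`.
    rw [Ideal.span_singleton_le_span_singleton, ← map_pow, ← map_pow, ← pow_mul]
    exact map_dvd _ (map_dvd _ (pow_dvd_pow _ (by omega)))
  have h4 (p) : eval₂ τ (fun l ↦ C (C (P.x l))) p =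
      (C (C (P.evalHom p)) : MvPolynomial n (MvPolynomial ι R)) := by
    exact (hom_eval₂ p P.coeffHom (C.comp C) P.x).symm
  have h5 := Ideal.mem_span_singleton.mp (add_mem h1 (h3 h2))
  obtain ⟨q, hq⟩ := h5
  refine ⟨q, ?_⟩
  simp only [h4, evalHom_f, map_zero, sub_zero] at hq
  simp only [jac, Matrix.of_apply]
  linear_combination hq

/-- The Newton step: the factor `d ^ (r - 1)` of the linear term and the factor `d` of `adj J · J`
combine to `d ^ r`, which is also the factor of the error. The quotient `G` is `w` plus the adjugate
applied to the error. -/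
lemma exists_deformation (hr : 2 ≤ r) : ∃ G : n → MvPolynomial n (MvPolynomial ι R), ∀ l,
    ∑ i, C (C (P.jac.adjugate l i)) * P.shift r P.det (P.f i) = C (C (P.det ^ r)) * G l := by
  choose q hq using P.exists_shift_f_eq r P.det hr
  refine ⟨_, sum_adjugate_mul_eq (C.comp C) P.jac (C (C (P.det ^ (r - 1)))) (C (C (P.det ^ r)))
    X q _ ?_ hq⟩
  rw [RingHom.comp_apply, ← map_mul, ← map_mul, ← det, ← pow_succ, Nat.sub_add_cancel (by omega)]

/-- Differentiating the relation that defines `G` with respect to `w` produces `d ^ (r - 1)` on the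
left by the chain rule, against `d ^ r` on the right. After cancellation, `adj J` times the Jacobian
matrix at the displaced point is `d` times `∂G/∂w`, and `det_mul_det_eq` applies. So `det ∂G/∂w` is
the factor by which `d` changes under the displacement. -/
lemma det_mul_det_deformation (hr : 2 ≤ r) (hd : P.det ∈ nonZeroDivisors R)
    (G : n → MvPolynomial n (MvPolynomial ι R))
    (hG : ∀ l, ∑ i, C (C (P.jac.adjugate l i)) * P.shift r P.det (P.f i) = C (C (P.det ^ r)) * G l) :
    C (C P.det) * (Matrix.of fun l m ↦ pderiv m (G l)).det =
      (Matrix.of fun i m ↦ P.shift r P.det (pderiv m (P.f i))).det := by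
  have hreg (N : ℕ) : (C (C (P.det ^ N)) : MvPolynomial n (MvPolynomial ι R)) ∈ nonZeroDivisors _ :=
    C_C_mem_nonZeroDivisors (pow_mem hd N)
  refine det_mul_det_eq (C.comp C) P.jac ?_ _ _ fun l m ↦ ?_
  · simpa [det] using hreg 1
  · have h := congr(pderiv m $(hG l))
    have h2 (i : n) : pderiv m (P.shift r P.det (P.f i)) =
        C (C (P.det ^ (r - 1))) * P.shift r P.det (pderiv m (P.f i)) :=
      pderiv_eval₂_C_add _ _ _ _ _
    simp only [map_sum, pderiv_C_mul, h2] at h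
    have e1 : (C (C (P.det ^ r)) : MvPolynomial n (MvPolynomial ι R)) =
        C (C (P.det ^ (r - 1))) * C (C P.det) := by
      rw [← map_mul, ← map_mul, ← pow_succ, Nat.sub_add_cancel (by omega)]
    rw [e1, mul_assoc] at h
    simp only [mul_left_comm _ (C (C (P.det ^ (r - 1)))), ← Finset.mul_sum] at h
    exact (mul_cancel_left_mem_nonZeroDivisors (hreg (r - 1))).mp h

end Deformation

end SquarePresentation
end NewtonGroupoid

/-! ### The smooth model of the groupoid over a chart -/

namespace NewtonGroupoid

open MvPolynomial

namespace SquarePresentation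

/-- There are as many relations as variables, so inverting the Jacobian makes the presentation
submersive of relative dimension zero. -/
lemma etale_away_jacobian {A : Type*} {σ : Type} [CommRing A] [Fintype σ] [DecidableEq σ]
    (G : σ → MvPolynomial σ A) :
    Algebra.Etale A (Localization.Away
      (Ideal.Quotient.mk (Ideal.span (Set.range G)) (Matrix.of fun l m ↦ pderiv m (G l)).det)) := by
  let P₀ := Algebra.PreSubmersivePresentation.naive (v := G) (id : σ → σ) Function.injective_id
  have hjac : P₀.jacobian = Ideal.Quotient.mk (Ideal.span (Set.range G))
      (Matrix.of fun l m ↦ pderiv m (G l)).det := by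
    rw [Algebra.PreSubmersivePresentation.jacobian_eq_jacobiMatrix_det, ← Matrix.det_transpose]
    change Ideal.Quotient.mk _ _ = _
    congr 2
    refine Matrix.ext fun i j ↦ ?_
    exact Algebra.PreSubmersivePresentation.jacobiMatrix_naive (v := G) (R := A) id
      Function.injective_id _ (Function.surjInv_eq _) j i
  rw [← hjac]
  let Q₀ := Algebra.SubmersivePresentation.localizationAway (Localization.Away P₀.jacobian) P₀.jacobian
  let P₁ : Algebra.SubmersivePresentation A (Localization.Away P₀.jacobian) _ _ :=
    { toPreSubmersivePresentation := Q₀.toPreSubmersivePresentation.comp P₀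
      jacobian_isUnit := by
        rw [Algebra.PreSubmersivePresentation.comp_jacobian_eq_jacobian_smul_jacobian,
          Algebra.smul_def]
        exact (IsLocalization.Away.algebraMap_isUnit _).mul Q₀.jacobian_isUnit }
  refine Algebra.Etale.iff_isStandardSmoothOfRelativeDimension_zero.mpr
    ⟨_, _, _, inferInstance, P₁, ?_⟩
  simp [Algebra.Presentation.dimension]

/-- Hides the quotient and the localization behind an opaque ring `E`, keeping what is needed later:
flatness, the shape of the elements and the mapping property. -/
lemma exists_flat_away_jacobian {A : Type u} {σ : Type} [CommRing A] [Fintype σ] [DecidableEq σ]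
    (G : σ → MvPolynomial σ A) (g : MvPolynomial σ A)
    (hg : g = (Matrix.of fun l m ↦ pderiv m (G l)).det) :
    ∃ (E : Type u) (_ : CommRing E) (_ : Algebra A E) (κ : MvPolynomial σ A →+* E),
      Module.Flat A E ∧ (∀ a, κ (C a) = algebraMap A E a) ∧ (∀ l, κ (G l) = 0) ∧
      IsUnit (κ g) ∧ (∀ z : E, ∃ q N, z * κ g ^ N = κ q) ∧
      ∀ (N : Type u) [CommRing N] (ψ : MvPolynomial σ A →+* N), (∀ l, ψ (G l) = 0) →
        IsUnit (ψ g) → ∃ ψ' : E →+* N, ψ'.comp κ = ψ := by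
  subst hg
  have := etale_away_jacobian G
  refine ⟨Localization.Away (Ideal.Quotient.mk (Ideal.span (Set.range G))
    (Matrix.of fun l m ↦ pderiv m (G l)).det), _, _,
    (algebraMap _ _).comp (Ideal.Quotient.mk _), inferInstance, fun _ ↦ rfl, fun l ↦ ?_,
    IsLocalization.Away.algebraMap_isUnit (Ideal.Quotient.mk (Ideal.span (Set.range G)) _),
    fun z ↦ ?_, ?_⟩
  · have : Ideal.Quotient.mk (Ideal.span (Set.range G)) (G l) = 0 :=
      Ideal.Quotient.eq_zero_iff_mem.mpr (Ideal.subset_span ⟨l, rfl⟩)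
    rw [RingHom.comp_apply, this, map_zero]
  · obtain ⟨⟨q, ⟨_, N, rfl⟩⟩, hz⟩ := IsLocalization.surj (Submonoid.powers
      (Ideal.Quotient.mk (Ideal.span (Set.range G)) (Matrix.of fun l m ↦ pderiv m (G l)).det)) z
    obtain ⟨q, rfl⟩ := Ideal.Quotient.mk_surjective q
    refine ⟨q, N, ?_⟩
    rw [map_pow] at hz
    exact hz
  · intro N _ ψ hψ hu
    have hle : ∀ a ∈ Ideal.span (Set.range G), ψ a = 0 := by
      change _ ≤ RingHom.ker ψ
      rw [Ideal.span_le]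
      rintro _ ⟨l, rfl⟩
      exact hψ l
    refine ⟨IsLocalization.Away.lift (Ideal.Quotient.mk (Ideal.span (Set.range G))
      (Matrix.of fun l m ↦ pderiv m (G l)).det) (g := Ideal.Quotient.lift _ ψ hle) (by rw [Ideal.Quotient.lift_mk]; exact hu), ?_⟩
    refine RingHom.ext fun p ↦ ?_
    rw [RingHom.comp_apply, RingHom.comp_apply, IsLocalization.Away.lift_eq, Ideal.Quotient.lift_mk]

variable {k R : Type u} {ι n : Type} [CommRing k] [CommRing R] [Algebra k R]
  (P : SquarePresentation k R ι n) [Fintype n] [DecidableEq n] (r : ℕ)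

/-- The smooth `R`-algebra whose points are the solutions `(y + d ^ r v, x + d ^ (r - 1) w)` of the
equations of `P` at which the Jacobian determinant is a unit times `d`. -/
lemma exists_model (hr : 2 ≤ r) (hd : P.det ∈ nonZeroDivisors R) :
    ∃ (E : Type u) (_ : CommRing E) (_ : Algebra R E) (v : ι → E) (w : n → E) (u u' : E)
      (b : R →+* E), Module.Flat R E ∧ u * u' = 1 ∧
      b.comp (algebraMap k R) = (algebraMap R E).comp (algebraMap k R) ∧
      (∀ j, b (P.y j) = algebraMap R E (P.y j) + algebraMap R E P.det ^ r * v j) ∧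
      (∀ l, b (P.x l) = algebraMap R E (P.x l) + algebraMap R E P.det ^ (r - 1) * w l) ∧
      b P.det = algebraMap R E P.det * u ∧
      Subring.closure (Set.range (algebraMap R E) ∪ Set.range v ∪ Set.range w ∪ {u'}) = ⊤ ∧
      ∀ (N : Type u) [CommRing N] (α β : R →+* N),
        α.comp (algebraMap k R) = β.comp (algebraMap k R) → IsUnit (α P.det) → IsUnit (β P.det) →
        ∃ ψ : E →+* N, ψ.comp (algebraMap R E) = α ∧ ψ.comp b = β := by
  obtain ⟨G, hG⟩ := P.exists_deformation r hr
  have hdet := P.det_mul_det_deformation r hr hd G hG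
  obtain ⟨g, hg⟩ : ∃ g : MvPolynomial n (MvPolynomial ι R), g = (Matrix.of fun l m ↦ pderiv m (G l)).det := ⟨_, rfl⟩
  rw [← hg] at hdet
  obtain ⟨E, _, _, κ, hE, hκC, hκG, hκg, hsurj, hlift⟩ := exists_flat_away_jacobian G g hg
  let : Algebra R E := (κ.comp (C.comp C)).toAlgebra
  have hRE (a : R) : algebraMap R E a = κ (C (C a)) := rfl
  have hflat : Module.Flat R E := by
    have : IsScalarTower R (MvPolynomial ι R) E := .of_algebraMap_eq fun a ↦ hκC (C a)
    exact Module.Flat.trans R (MvPolynomial ι R) E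
  obtain ⟨u', hu'⟩ := hκg.exists_right_inv
  have hdE : algebraMap R E P.det ∈ nonZeroDivisors E := by
    have h1 := Module.Flat.isSMulRegular_of_nonZeroDivisors (M := E) hd
    rw [mem_nonZeroDivisors_iff_right]
    intro z hz
    apply h1
    simp only [Algebra.smul_def]
    rw [mul_comm, hz, mul_zero]
  -- In `E` the adjugate of `J` kills the displaced equations, since the result is `d ^ r G = 0`.
  -- Multiplication by `J` turns this into `d` times each equation, and `d` is regular on the flat
  -- algebra `E`.
  have hshift (i : n) : κ (P.shift r P.det (P.f i)) = 0 := by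
    have h1 : (P.jac.map (algebraMap R E)).adjugate.mulVec
        (fun i ↦ κ (P.shift r P.det (P.f i))) = 0 := by
      ext l
      have := congr(κ $(hG l))
      rw [map_mul, hκG, mul_zero, map_sum] at this
      simp only [map_mul, ← hRE] at this
      rw [← RingHom.mapMatrix_apply, ← RingHom.map_adjugate]
      exact this
    have h2 := congr((P.jac.map (algebraMap R E)).mulVec $h1 i)
    rw [Matrix.mulVec_mulVec, Matrix.mul_adjugate, Matrix.smul_mulVec, Matrix.one_mulVec,
      Matrix.mulVec_zero, ← RingHom.mapMatrix_apply, ← RingHom.map_det] at h2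
    refine (mem_nonZeroDivisors_iff_right.mp hdE) _ ?_
    rw [mul_comm]
    exact h2
  let β₀ := κ.comp (P.shift r P.det)
  have hker : RingHom.ker P.evalHom ≤ RingHom.ker β₀ := by
    rw [P.ker_eq, Ideal.span_le]
    rintro _ ⟨i, rfl⟩
    exact hshift i
  let b : R →+* E := RingHom.liftOfSurjective P.evalHom P.surjective ⟨β₀, hker⟩
  have hb (p) : b (P.evalHom p) = κ (P.shift r P.det p) :=
    RingHom.liftOfRightInverse_comp_apply _ _ _ ⟨β₀, hker⟩ p
  refine ⟨E, inferInstance, inferInstance, fun j ↦ κ (C (X j)), fun l ↦ κ (X l), κ g, u', b, hflat,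
    hu', ?_, fun j ↦ ?_, fun l ↦ ?_, ?_, ?_, ?_⟩
  · ext c
    have := hb (C (C c))
    simpa [shift, shiftCoeff, hRE] using! this
  · have := hb (C (X j))
    simpa [shift, shiftCoeff, hRE] using! this
  · have := hb (X l)
    simpa [shift, hRE] using! this
  · rw [hRE, ← map_mul, hdet]
    have h3 := hb (Matrix.of fun i m ↦ pderiv m (P.f i)).det
    have h1 := RingHom.map_det P.evalHom (Matrix.of fun i m ↦ pderiv m (P.f i))
    have h2 := RingHom.map_det (P.shift r P.det) (Matrix.of fun i m ↦ pderiv m (P.f i))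
    exact (congrArg (fun z ↦ b z) h1).symm.trans (h3.trans (congrArg (fun z ↦ κ z) h2))
  · rw [eq_top_iff]
    set S := Subring.closure (Set.range (algebraMap R E) ∪ Set.range (fun j ↦ κ (C (X j))) ∪
      Set.range (fun l ↦ κ (X l)) ∪ {u'})
    have hC₂ (p : MvPolynomial n (MvPolynomial ι R)) : κ p ∈ S := by
      induction p using MvPolynomial.induction_on with
      | C q =>
        induction q using MvPolynomial.induction_on with
        | C a => exact Subring.subset_closure (.inl (.inl (.inl ⟨a, rfl⟩)))
        | add p q hp hq => simpa only [map_add] using add_mem hp hq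
        | mul_X p j hp =>
          simpa only [map_mul] using mul_mem hp (Subring.subset_closure (.inl (.inl (.inr ⟨j, rfl⟩))))
      | add p q hp hq => simpa only [map_add] using add_mem hp hq
      | mul_X p j hp =>
        simpa only [map_mul] using mul_mem hp (Subring.subset_closure (.inl (.inr ⟨j, rfl⟩)))
    rintro z -
    -- `E` is a localization at `κ g`, so its elements are polynomials in `v`, `w` times powers of
    -- the inverse `u'`.
    obtain ⟨q, N, hz⟩ := hsurj z
    have : z = κ q * u' ^ N := by rw [← hz, mul_assoc, ← mul_pow, hu', one_pow, mul_one]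
    rw [this]
    exact mul_mem (hC₂ q) (pow_mem (Subring.subset_closure (.inr rfl)) _)
  · intro N _ α β hαβ hα hβ
    obtain ⟨δ, hδ⟩ := hα.exists_right_inv
    -- With `δ` inverse to `α d`, the images of `v` and `w` are forced by the requirement that `y +
    -- d ^ r v` and `x + d ^ (r - 1) w` go to `β y` and `β x`.
    obtain ⟨ψ₂, hψα, hψv, hψw⟩ : ∃ ψ₂ : MvPolynomial n (MvPolynomial ι R) →+* N,
        (∀ a, ψ₂ (C (C a)) = α a) ∧ (∀ j, ψ₂ (C (X j)) = (β (P.y j) - α (P.y j)) * δ ^ r) ∧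
          ∀ l, ψ₂ (X l) = (β (P.x l) - α (P.x l)) * δ ^ (r - 1) :=
      ⟨eval₂Hom (eval₂Hom α fun j ↦ (β (P.y j) - α (P.y j)) * δ ^ r)
        fun l ↦ (β (P.x l) - α (P.x l)) * δ ^ (r - 1), by simp, by simp, by simp⟩
    have hδp (N : ℕ) : α P.det ^ N * δ ^ N = 1 := by rw [← mul_pow, hδ, one_pow]
    have hψβ : ψ₂.comp (P.shift r P.det) = β.comp P.evalHom := by
      refine MvPolynomial.ringHom_ext' (MvPolynomial.ringHom_ext' ?_ ?_) ?_
      · ext c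
        have := congr($hαβ c)
        simpa [shift, shiftCoeff, hψα] using! this
      · intro j
        have := hδp r
        simp [shift, shiftCoeff, hψα, hψv]
        linear_combination (β (P.y j) - α (P.y j)) * this
      · intro l
        have := hδp (r - 1)
        simp [shift, hψα, hψw]
        linear_combination (β (P.x l) - α (P.x l)) * this
    have hψG (l : n) : ψ₂ (G l) = 0 := by
      have h := congr(ψ₂ $(hG l))
      rw [map_mul, hψα, map_sum] at h
      have h0 (i : n) : ψ₂ (P.shift r P.det (P.f i)) = 0 := by
        have := congr($hψβ (P.f i))
        rwa [RingHom.comp_apply, RingHom.comp_apply, P.evalHom_f, map_zero] at this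
      simp only [map_mul, h0, mul_zero, Finset.sum_const_zero, map_pow] at h
      exact ((hα.pow r).mul_right_eq_zero).mp h.symm
    have hψg : IsUnit (ψ₂ g) := by
      have h := congr(ψ₂ $hdet)
      rw [map_mul, hψα, RingHom.map_det] at h
      have h1 : (ψ₂.mapMatrix (Matrix.of fun i m ↦ P.shift r P.det (pderiv m (P.f i)))).det =
          β P.det := by
        rw [det, RingHom.map_det]
        congr 1
        ext i m
        exact congr($hψβ (pderiv m (P.f i)))
      rw [h1] at h
      exact isUnit_of_mul_isUnit_right (h ▸ hβ)
    obtain ⟨ψ, hψ'⟩ := hlift N ψ₂ hψG hψg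
    have hψ (p : MvPolynomial n (MvPolynomial ι R)) : ψ (κ p) = ψ₂ p := congr($hψ' p)
    refine ⟨ψ, ?_, ?_⟩
    · ext a
      simp [hRE, hψ, hψα]
    · ext a
      obtain ⟨p, rfl⟩ := P.surjective a
      simp only [RingHom.comp_apply]
      rw [hb, hψ]
      exact congr($hψβ p)

end SquarePresentation
end NewtonGroupoid

/-! ### The algebra generated by the twists is a localization of the model -/

namespace NewtonGroupoid

/-- The elements `s` of an `M`-algebra `N` such that `δ ^ m s` is in the image of `I`. -/
def twistSet {M : Type*} (N : Type*) [CommRing M] [CommRing N] [Algebra M N] (I : Ideal M) (δ : M)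
    (m : ℕ) : Set N :=
  {s | ∃ i ∈ I, algebraMap M N (δ ^ m) * s = algebraMap M N i}

namespace SquarePresentation

variable {k R M₀ M N : Type u} {ι n : Type} [CommRing k] [CommRing R] [Algebra k R]
  [CommRing M₀] [CommRing M] [CommRing N] [Algebra M₀ M] [Algebra M N]

/-- Where `d` becomes invertible, the relations for `b` can be solved for `v`, `w` and `u`, so the
two maps `a` and `b` determine everything. -/
lemma model_hom_ext {E L : Type*} [CommRing E] [CommRing L] {v : ι → E} {w : n → E} {u u' d : E}
    {r : ℕ} {a b : R →+* E} {y : ι → R} {x : n → R} (δ : R) (hd : a δ = d)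
    (huu : u * u' = 1)
    (hy : ∀ j, b (y j) = a (y j) + d ^ r * v j) (hx : ∀ l, b (x l) = a (x l) + d ^ (r - 1) * w l)
    (hu : b δ = d * u)
    (hgen : Subring.closure (Set.range a ∪ Set.range v ∪ Set.range w ∪ {u'}) = ⊤)
    {f g : E →+* L} (ha : f.comp a = g.comp a) (hb : f.comp b = g.comp b)
    (hunit : IsUnit (f d)) : f = g := by
  have ha' (s) : f (a s) = g (a s) := congr($ha s)
  have hb' (s) : f (b s) = g (b s) := congr($hb s)
  have hd' : f d = g d := by rw [← hd, ha']
  have hfu : f u = g u := by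
    have := hb' δ
    rw [hu, map_mul, map_mul, ← hd'] at this
    exact hunit.mul_left_cancel this
  have hfu' : f u' = g u' := by
    have h1 : f u * f u' = 1 := by rw [← map_mul, huu, map_one]
    have h2 : g u * g u' = 1 := by rw [← map_mul, huu, map_one]
    calc f u' = (g u * g u') * f u' := by rw [h2, one_mul]
      _ = (f u * f u') * g u' := by rw [hfu]; ring
      _ = g u' := by rw [h1, one_mul]
  refine RingHom.eq_of_eqOn_set_dense hgen ?_
  rintro z (((⟨s, rfl⟩ | ⟨j, rfl⟩) | ⟨l, rfl⟩) | rfl)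
  · exact ha' s
  · have := hb' (y j)
    rw [hy, map_add, map_add, ha', add_right_inj, map_mul, map_mul, map_pow, map_pow, ← hd'] at this
    exact (hunit.pow _).mul_left_cancel this
  · have := hb' (x l)
    rw [hx, map_add, map_add, ha', add_right_inj, map_mul, map_mul, map_pow, map_pow, ← hd'] at this
    exact (hunit.pow _).mul_left_cancel this
  · exact hfu'

lemma sub_dvd_of_presentation {E : Type*} [CommRing E] (P : SquarePresentation k R ι n) (a b : R →+* E)
    (c : E) (hk : b.comp (algebraMap k R) = a.comp (algebraMap k R))
    (hy : ∀ j, c ∣ b (P.y j) - a (P.y j)) (hx : ∀ l, c ∣ b (P.x l) - a (P.x l)) (s : R) :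
    c ∣ b s - a s := by
  simp only [← Ideal.mem_span_singleton, ← Ideal.Quotient.eq] at hy hx ⊢
  have : (Ideal.Quotient.mk (Ideal.span {c})).comp b = (Ideal.Quotient.mk _).comp a :=
    P.ringHom_ext (by rw [RingHom.comp_assoc, hk, RingHom.comp_assoc]) hy hx
  exact congr($this s)

/-- Over a chart with a square presentation, the algebra generated by the twists is flat. -/
lemma flat_twistAlgebra (P : SquarePresentation k R ι n) [Fintype n] [DecidableEq n] {r : ℕ}
    (hr : 2 ≤ r) (hd : P.det ∈ nonZeroDivisors R) (a b : R →+* M₀)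
    (hext : ∀ (E : Type u) [CommRing E] (F G : M₀ →+* E), F.comp a = G.comp a →
      F.comp b = G.comp b → F = G)
    (hk : a.comp (algebraMap k R) = b.comp (algebraMap k R))
    (hpush : ∀ (E : Type u) [CommRing E] (α β : R →+* E),
      α.comp (algebraMap k R) = β.comp (algebraMap k R) →
      ∃ F : M₀ →+* E, F.comp a = α ∧ F.comp b = β)
    (h : M₀) [IsLocalization.Away h M]
    [IsLocalization.Away (algebraMap M₀ M (a P.det) * algebraMap M₀ M (b P.det)) N]
    (I₁ I₂ : Ideal M) (hI₁ : I₁ = Ideal.span (Set.range fun s ↦ algebraMap M₀ M (a s - b s)))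
    (hI₂ : I₂ = Ideal.span (Set.range fun j ↦ algebraMap M₀ M (a (P.y j) - b (P.y j))))
    (A : Subring N)
    (hA : A = Subring.closure (Set.range (algebraMap M N) ∪
      (twistSet N I₁ (algebraMap M₀ M (a P.det)) (r - 1) ∪
        twistSet N I₂ (algebraMap M₀ M (a P.det)) r ∪
        twistSet N I₁ (algebraMap M₀ M (b P.det)) (r - 1) ∪
        twistSet N I₂ (algebraMap M₀ M (b P.det)) r)))
    (g : R →+* A) (hg : ∀ s, (g s : N) = algebraMap M N (algebraMap M₀ M (a s))) : g.Flat := by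
  -- `M₀` is the coproduct of two copies of `R` over `k`, known through `hext` and `hpush`. It maps
  -- to the model `E` by `F`, and `E` maps to `N` by `ψ`. The plan is that `E` localized at `F h`
  -- maps isomorphically onto `A`.
  obtain ⟨E, _, _, v, w, u, u', b', hflat, huu, hk', hy, hx, hu, hgenE, hlift⟩ := P.exists_model r hr hd
  obtain ⟨F, hFa, hFb⟩ := hpush E (algebraMap R E) b' hk'.symm
  replace hFa (s) : F (a s) = algebraMap R E s := congr($hFa s)
  replace hFb (s) : F (b s) = b' s := congr($hFb s)
  let ρ : M₀ →+* N := (algebraMap M N).comp (algebraMap M₀ M)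
  have hunit : IsUnit (ρ (a P.det) * ρ (b P.det)) := by
    have := IsLocalization.Away.algebraMap_isUnit (S := N)
      (algebraMap M₀ M (a P.det) * algebraMap M₀ M (b P.det))
    rwa [map_mul] at this
  have hua := isUnit_of_mul_isUnit_left hunit
  have hub := isUnit_of_mul_isUnit_right hunit
  obtain ⟨ψ, hψa, hψb⟩ := hlift N (ρ.comp a) (ρ.comp b) (congrArg ρ.comp hk) hua hub
  replace hψa (s) : ψ (algebraMap R E s) = ρ (a s) := congr($hψa s)
  replace hψb (s) : ψ (b' s) = ρ (b s) := congr($hψb s)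
  have hψF (m : M₀) : ψ (F m) = ρ m := by
    have : ψ.comp F = ρ := by
      refine hext N _ _ (RingHom.ext fun s ↦ ?_) (RingHom.ext fun s ↦ ?_)
      · rw [RingHom.comp_apply, RingHom.comp_apply, hFa, hψa]
        rfl
      · rw [RingHom.comp_apply, RingHom.comp_apply, hFb, hψb]
        rfl
    exact congr($this m)
  have hρh : IsUnit (ρ h) :=
    (IsLocalization.Away.algebraMap_isUnit (S := M) h).map (algebraMap M N)
  have hψh : IsUnit (ψ (F h)) := by rwa [hψF]
  let Eh := Localization.Away (F h)
  let ψ' : Eh →+* N := IsLocalization.Away.lift (F h) hψh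
  have hψ' (e : E) : ψ' (algebraMap E Eh e) = ψ e := IsLocalization.Away.lift_eq _ _ _
  have hdE : algebraMap R E P.det ∈ nonZeroDivisors E := by
    have h1 := Module.Flat.isSMulRegular_of_nonZeroDivisors (M := E) hd
    rw [mem_nonZeroDivisors_iff_right]
    intro z hz
    apply h1
    simp only [Algebra.smul_def]
    rw [mul_comm, hz, mul_zero]
  -- After inverting `d` and `F h` there is a map `θ` back from `N`, and `θ ∘ ψ` is the localization
  -- map by `model_hom_ext`. An element of `E` killed by `ψ` is therefore killed by a power of `d ·
  -- F h`, and `d` is regular on `E`.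
  have hinj : Function.Injective ψ' := by
    rw [injective_iff_map_eq_zero]
    intro z hz
    obtain ⟨m, e, hze⟩ := IsLocalization.Away.surj (F h) z
    have he : ψ e = 0 := by rw [← hψ', ← hze, map_mul, hz, zero_mul]
    let L := Localization.Away (algebraMap R E P.det * F h)
    have hL : IsUnit (algebraMap E L (algebraMap R E P.det) * algebraMap E L (F h)) := by
      rw [← map_mul]
      exact IsLocalization.Away.algebraMap_isUnit _
    have hLd := isUnit_of_mul_isUnit_left hL
    have hLh := isUnit_of_mul_isUnit_right hL
    let θ₁ : M →+* L := IsLocalization.Away.lift (g := (algebraMap E L).comp F) h hLh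
    have hθ₁ (m) : θ₁ (algebraMap M₀ M m) = algebraMap E L (F m) := IsLocalization.Away.lift_eq _ _ _
    have hLu : IsUnit (algebraMap E L u) := IsUnit.map _ (IsUnit.of_mul_eq_one _ huu)
    let θ : N →+* L := IsLocalization.Away.lift (g := θ₁)
      (algebraMap M₀ M (a P.det) * algebraMap M₀ M (b P.det)) (by
        rw [map_mul, hθ₁, hθ₁, hFa, hFb, hu, map_mul]
        exact hLd.mul (hLd.mul hLu))
    have hθ (m) : θ (ρ m) = algebraMap E L (F m) := by
      simp only [θ, ρ, RingHom.comp_apply]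
      rw [IsLocalization.Away.lift_eq, hθ₁]
    have hext : θ.comp ψ = algebraMap E L := by
      refine model_hom_ext (a := algebraMap R E) (b := b') P.det rfl huu hy hx hu hgenE ?_ ?_ ?_
      · ext s
        simp only [RingHom.comp_apply]
        rw [hψa, hθ, hFa]
      · ext s
        simp only [RingHom.comp_apply]
        rw [hψb, hθ, hFb]
      · rw [RingHom.comp_apply, hψa, hθ, hFa]
        exact hLd
    have h0 : algebraMap E L e = 0 := by rw [← hext, RingHom.comp_apply, he, map_zero]
    obtain ⟨⟨_, N, rfl⟩, hN⟩ := (IsLocalization.map_eq_zero_iff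
      (Submonoid.powers (algebraMap R E P.det * F h)) L e).mp h0
    have h1 : F h ^ N * e = 0 := by
      refine (mem_nonZeroDivisors_iff_right.mp (pow_mem hdE N)) _ ?_
      rw [mul_comm, ← mul_assoc, ← mul_pow]
      exact hN
    have h2 : algebraMap E Eh (F h) ^ (N + m) * z = 0 := by
      rw [pow_add, mul_assoc, mul_comm _ z, hze, ← map_pow, ← map_mul, h1, map_zero]
    exact ((IsLocalization.Away.algebraMap_isUnit (F h)).pow (N + m)).mul_right_eq_zero.mp h2
  have hρψ (m) : ρ m ∈ ψ'.range := ⟨algebraMap E Eh (F m), by rw [hψ', hψF]⟩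
  have hrM (m : M) : algebraMap M N m ∈ ψ'.range := by
    obtain ⟨q, c, hc⟩ := IsLocalization.Away.surj h m
    obtain ⟨t, ht⟩ := (IsLocalization.Away.algebraMap_isUnit (S := Eh) (F h)).exists_right_inv
    have h3 : algebraMap M N m * ρ h ^ q = ρ c := by
      simp only [ρ, RingHom.comp_apply]
      rw [← hc, map_mul, map_pow]
    have h4 : ρ h * ψ' t = 1 := by rw [← hψF, ← hψ', ← map_mul, ht, map_one]
    have h5 : algebraMap M N m = ρ c * ψ' t ^ q := by
      rw [← h3, mul_assoc, ← mul_pow, h4, one_pow, mul_one]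
    rw [h5]
    exact mul_mem (hρψ c) (pow_mem (RingHom.mem_range_self ψ' t) q)
  have hdvd (c : E) (G : Set M) (hG : ∀ m ∈ G, ∃ e, algebraMap M N m = ψ (c * e)) (I : Ideal M)
      (hI : I = Ideal.span G) (m : M) (hm : m ∈ I) :
      ∃ z ∈ ψ'.range, algebraMap M N m = ψ c * z := by
    subst hI
    induction hm using Submodule.span_induction with
    | mem m hm =>
      obtain ⟨e, he⟩ := hG m hm
      exact ⟨ψ e, ⟨algebraMap E Eh e, hψ' e⟩, by rw [he, map_mul]⟩
    | zero => exact ⟨0, zero_mem _, by simp⟩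
    | add x y _ _ hx hy =>
      obtain ⟨z, hz, e⟩ := hx
      obtain ⟨z', hz', e'⟩ := hy
      exact ⟨z + z', add_mem hz hz', by rw [map_add, e, e', mul_add]⟩
    | smul c x _ hx =>
      obtain ⟨z, hz, e⟩ := hx
      exact ⟨algebraMap M N c * z, mul_mem (hrM c) hz, by rw [smul_eq_mul, map_mul, e]; ring⟩
  have hI₁' (m : M) (hm : m ∈ I₁) : ∃ z ∈ ψ'.range, algebraMap M N m = ρ (a P.det) ^ (r - 1) * z := by
    have := hdvd (algebraMap R E P.det ^ (r - 1)) _ ?_ I₁ hI₁ m hm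
    · rwa [map_pow, hψa] at this
    · rintro _ ⟨s, rfl⟩
      obtain ⟨e, he⟩ := P.sub_dvd_of_presentation (algebraMap R E) b'
        (algebraMap R E P.det ^ (r - 1)) hk'
        (fun j ↦ by
          rw [hy, add_sub_cancel_left]
          exact Dvd.dvd.mul_right (pow_dvd_pow _ (by omega)) _)
        (fun l ↦ by rw [hx, add_sub_cancel_left]; exact dvd_mul_right _ _) s
      refine ⟨-e, ?_⟩
      change ρ _ = _
      rw [mul_neg, ← he, neg_sub, map_sub, map_sub, hψa, hψb]
  have hI₂' (m : M) (hm : m ∈ I₂) : ∃ z ∈ ψ'.range, algebraMap M N m = ρ (a P.det) ^ r * z := by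
    have := hdvd (algebraMap R E P.det ^ r) _ ?_ I₂ hI₂ m hm
    · rwa [map_pow, hψa] at this
    · rintro _ ⟨j, rfl⟩
      refine ⟨-v j, ?_⟩
      have := hy j
      change ρ _ = _
      rw [mul_neg, ← sub_eq_iff_eq_add'.mpr this, neg_sub, map_sub, map_sub, hψa, hψb]
  -- The two determinants differ by the unit `u`, so passing from one divisor to the other only
  -- multiplies fractions by powers of `u'`.
  have hρb : ρ (b P.det) = ρ (a P.det) * ψ u := by rw [← hψb, hu, map_mul, hψa]
  have hψuu : ψ u * ψ u' = 1 := by rw [← map_mul, huu, map_one]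
  have htwist (I : Ideal M) (m : ℕ)
      (hI : ∀ i ∈ I, ∃ z ∈ ψ'.range, algebraMap M N i = ρ (a P.det) ^ m * z) (s : N) :
      (s ∈ twistSet N I (algebraMap M₀ M (a P.det)) m → s ∈ ψ'.range) ∧
      (s ∈ twistSet N I (algebraMap M₀ M (b P.det)) m → s ∈ ψ'.range) := by
    constructor
    · rintro ⟨i, hi, e⟩
      obtain ⟨z, hz, e'⟩ := hI i hi
      rw [e', map_pow] at e
      rwa [(hua.pow m).mul_left_cancel e]
    · rintro ⟨i, hi, e⟩
      obtain ⟨z, hz, e'⟩ := hI i hi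
      have e2 : ρ (b P.det) ^ m * s = ρ (a P.det) ^ m * z := by rw [← e', ← e, map_pow]; rfl
      rw [hρb, mul_pow, mul_assoc] at e2
      have e3 := (hua.pow m).mul_left_cancel e2
      have : s = ψ u' ^ m * z := by
        rw [← e3, ← mul_assoc, ← mul_pow, mul_comm (ψ u'), hψuu, one_pow, one_mul]
      rw [this]
      exact mul_mem (pow_mem (RingHom.mem_range.mpr ⟨algebraMap E Eh u', hψ' _⟩) _) hz
  have hle : A ≤ ψ'.range := by
    rw [hA, Subring.closure_le]
    rintro s (⟨m, rfl⟩ | ((hs | hs) | hs) | hs)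
    · exact hrM m
    · exact (htwist I₁ _ hI₁' s).1 hs
    · exact (htwist I₂ _ hI₂' s).1 hs
    · exact (htwist I₁ _ hI₁' s).2 hs
    · exact (htwist I₂ _ hI₂' s).2 hs
  have hMA (m : M) : algebraMap M N m ∈ A := hA ▸ Subring.subset_closure (.inl ⟨m, rfl⟩)
  have hbI₁ (s) : algebraMap M₀ M (b s - a s) ∈ I₁ := by
    rw [hI₁, ← neg_sub, map_neg]
    exact neg_mem (Ideal.subset_span ⟨s, rfl⟩)
  have hbI₂ (j) : algebraMap M₀ M (b (P.y j) - a (P.y j)) ∈ I₂ := by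
    rw [hI₂, ← neg_sub, map_neg]
    exact neg_mem (Ideal.subset_span ⟨j, rfl⟩)
  have hψA (e : E) : ψ e ∈ A := by
    have : e ∈ (⊤ : Subring E) := trivial
    rw [← hgenE] at this
    rw [← Subring.mem_comap]
    refine (Subring.closure_le (t := A.comap ψ)).mpr ?_ this
    rintro z (((⟨s, rfl⟩ | ⟨j, rfl⟩) | ⟨l, rfl⟩) | rfl)
    · change ψ _ ∈ A
      rw [hψa]
      exact hMA _
    · refine hA ▸ Subring.subset_closure (.inr (.inl (.inl (.inr ⟨_, hbI₂ j, ?_⟩))))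
      change _ = ρ _
      rw [map_sub, ← hψb, ← hψa, hy, ← map_sub, add_sub_cancel_left, map_mul, map_pow, map_pow ψ, hψa]
      rfl
    · refine hA ▸ Subring.subset_closure (.inr (.inl (.inl (.inl ⟨_, hbI₁ (P.x l), ?_⟩))))
      change _ = ρ _
      rw [map_sub, ← hψb, ← hψa, hx, ← map_sub, add_sub_cancel_left, map_mul, map_pow, map_pow ψ, hψa]
      rfl
    -- The inverse of `u` is the ratio of `a d` by `b d`, so `1 - u'` is `(b d - a d) / b d`, a
    -- section of the first ideal twisted once along the second divisor. The factor `(b d) ^ (r -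
    -- 2)` raises the denominator to the required power `r - 1`.
    · have h1 : 1 - ψ z ∈ A := by
        refine hA ▸ Subring.subset_closure (.inr (.inl (.inr
          ⟨algebraMap M₀ M (b P.det ^ (r - 2)) * _, Ideal.mul_mem_left _ _ (hbI₁ P.det), ?_⟩)))
        rw [← map_mul]
        change _ = ρ _
        have : r - 1 = (r - 2) + 1 := by omega
        rw [map_pow, map_mul, map_pow, this, pow_succ, map_sub]
        change ρ (b P.det) ^ (r - 2) * ρ (b P.det) * (1 - ψ z) = _
        have : ρ (b P.det) * ψ z = ρ (a P.det) := by rw [hρb, mul_assoc, hψuu, mul_one]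
        linear_combination - ρ (b P.det) ^ (r - 2) * this
      have := sub_mem (one_mem A) h1
      rwa [sub_sub_cancel] at this
  have hge : ψ'.range ≤ A := by
    rintro _ ⟨z, rfl⟩
    obtain ⟨q, e, hze⟩ := IsLocalization.Away.surj (F h) z
    obtain ⟨t, ht⟩ := (IsLocalization.Away.algebraMap_isUnit (S := M) h).exists_right_inv
    have h1 : ρ h * algebraMap M N t = 1 := by
      change algebraMap M N (algebraMap M₀ M h) * _ = 1
      rw [← map_mul, ht, map_one]
    have h2 : ψ' z * ρ h ^ q = ψ e := by
      rw [← hψ', ← hze, map_mul, map_pow, hψ', hψF]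
    have : ψ' z = ψ e * algebraMap M N t ^ q := by
      rw [← h2, mul_assoc, ← mul_pow, h1, one_pow, mul_one]
    rw [this]
    exact mul_mem (hψA e) (pow_mem (hMA t) q)
  let φ : Eh →+* A := ψ'.codRestrict A fun z ↦ hge ⟨z, rfl⟩
  have hφ : Function.Bijective φ := by
    refine ⟨fun x y hxy ↦ hinj congr(($hxy : N)), fun s ↦ ?_⟩
    obtain ⟨z, hz⟩ := hle s.2
    exact ⟨z, Subtype.ext hz⟩
  have hgφ : g = φ.comp ((algebraMap E Eh).comp (algebraMap R E)) := by
    ext s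
    rw [hg]
    change _ = ψ' (algebraMap E Eh (algebraMap R E s))
    rw [hψ', hψa]
    rfl
  rw [hgφ]
  refine RingHom.Flat.comp (RingHom.Flat.comp ?_ ?_) (RingHom.Flat.of_bijective hφ)
  · exact RingHom.flat_algebraMap_iff.mpr hflat
  · exact RingHom.flat_algebraMap_iff.mpr (IsLocalization.flat _ (Submonoid.powers (F h)))

end SquarePresentation
end NewtonGroupoid

/-! ### Cohen–Macaulay property of polynomial rings and unmixedness -/

namespace NewtonGroupoid

section FullDepth

open RingTheory.Sequence IsLocalRing Abelian

/-- In the local ring at `Q` each term of the sequence lowers the dimension by exactly one, and the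
quotient still has nonnegative dimension. -/
lemma length_le_height_of_isWeaklyRegular {A : Type*} [CommRing A] [IsNoetherianRing A] {gs : List A}
    (hgs : IsWeaklyRegular A gs) (Q : Ideal A) [Q.IsPrime] (hQ : ∀ g ∈ gs, g ∈ Q) :
    gs.length ≤ Q.height := by
  have h := hgs.isRegular_of_isLocalization_of_mem (Localization.AtPrime Q) Q hQ
  have h1 := ringKrullDim_add_length_eq_ringKrullDim_of_isRegular _ h
  have : Nontrivial (Localization.AtPrime Q ⧸
      Ideal.ofList (gs.map (algebraMap A (Localization.AtPrime Q)))) := by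
    rw [Ideal.Quotient.nontrivial_iff]
    intro h2
    apply h.top_ne_smul
    rw [h2, smul_eq_mul, Ideal.top_mul]
  rw [IsLocalization.AtPrime.ringKrullDim_eq_height Q (Localization.AtPrime Q), List.length_map] at h1
  have h2 : (gs.length : WithBot ℕ∞) ≤ (Q.height : WithBot ℕ∞) := by
    rw [← h1]
    exact le_add_of_nonneg_left ringKrullDim_nonneg_of_nontrivial
  exact_mod_cast h2

/-- The ring `B` has a regular sequence of length `dim B`. -/
def HasFullDepth (B : Type*) [CommRing B] : Prop :=
  ∃ rs : List B, IsRegular B rs ∧ ringKrullDim B ≤ rs.length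

lemma HasFullDepth.of_ringEquiv {B B' : Type*} [CommRing B] [CommRing B'] (e : B ≃+* B')
    (h : HasFullDepth B) : HasFullDepth B' := by
  obtain ⟨rs, hrs, hl⟩ := h
  refine ⟨rs.map e, ?_, ?_⟩
  · refine (e.toAddEquiv.isRegular_congr ?_).mp hrs
    exact List.forall₂_map_right_iff.mpr (List.forall₂_same.mpr fun r _ x ↦ map_mul e r x)
  · rw [← ringKrullDim_eq_of_ringEquiv e, List.length_map]
    exact hl

/-- All local rings of `A` have regular sequences of full length. -/
def IsLocallyFullDepth (A : Type*) [CommRing A] : Prop :=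
  ∀ (P : Ideal A) [P.IsPrime], HasFullDepth (Localization.AtPrime P)

lemma IsLocallyFullDepth.of_ringEquiv {A A' : Type*} [CommRing A] [CommRing A'] (e : A ≃+* A')
    (h : IsLocallyFullDepth A) : IsLocallyFullDepth A' := fun p _ ↦
  (h (p.comap e)).of_ringEquiv <| IsLocalization.ringEquivOfRingEquiv
    (Localization.AtPrime (p.comap e)) (Localization.AtPrime p) e (e.map_primeCompl_comap_eq p)

lemma isLocallyFullDepth_of_field (k : Type*) [Field k] : IsLocallyFullDepth k := by
  intro P _
  refine ⟨[], .nil _ _, ?_⟩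
  rw [IsLocalization.AtPrime.ringKrullDim_eq_height P]
  exact (Ideal.height_le_ringKrullDim_of_ne_top Ideal.IsPrime.ne_top').trans
    (ringKrullDim_eq_zero_of_field k).le

open Polynomial in
lemma isSMulRegular_quotient_of_monic {C : Type*} [CommRing C] (I : Ideal C) {y : C[X]}
    (hy : y.Monic) : IsSMulRegular (C[X] ⧸ (I.map Polynomial.C : Submodule C[X] C[X])) y := by
  refine (isSMulRegular_quotient_iff_mem_of_smul_mem (I.map Polynomial.C : Submodule C[X] C[X]) y).mpr ?_
  intro f hf
  have hker (g : C[X]) : g ∈ I.map Polynomial.C ↔ g.map (Ideal.Quotient.mk I) = 0 := by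
    rw [← Ideal.mk_ker (I := I), ← Polynomial.ker_mapRingHom, RingHom.mem_ker, coe_mapRingHom, Ideal.mk_ker]
  have hf' : y • f ∈ I.map Polynomial.C := hf
  change f ∈ I.map Polynomial.C
  rw [hker, smul_eq_mul, Polynomial.map_mul] at hf'
  rw [hker]
  exact ((hy.map _).mul_right_eq_zero_iff).mp hf'

open Polynomial in
-- A prime over the maximal ideal `m` is either `m[X]`, of the same height as `m`, or is generated
-- by `m` and a monic polynomial. In the second case that polynomial extends the regular sequence by
-- one, and the height is at most one larger.
lemma HasFullDepth.polynomial {C : Type*} [CommRing C] [IsLocalRing C] [IsNoetherianRing C]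
    (h : HasFullDepth C) (P : Ideal C[X]) [P.IsPrime] (hP : P.comap Polynomial.C = maximalIdeal C) :
    HasFullDepth (Localization.AtPrime P) := by
  obtain ⟨rs, hrs, hl⟩ := h
  have hmax : (maximalIdeal C).height ≤ rs.length := by
    rw [← maximalIdeal_height_eq_ringKrullDim] at hl
    exact_mod_cast hl
  have hmem : ∀ r ∈ rs, r ∈ maximalIdeal C := by
    intro r hr
    refine le_maximalIdeal (J := Ideal.ofList rs) (fun e ↦ ?_) (Ideal.subset_span hr)
    apply hrs.top_ne_smul
    rw [e, smul_eq_mul, Ideal.top_mul]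
  have h1 : IsWeaklyRegular C[X] (rs.map Polynomial.C) := hrs.toIsWeaklyRegular.of_flat
  have h1m : ∀ r ∈ rs.map Polynomial.C, r ∈ P := by
    intro r hr
    obtain ⟨c, hc, rfl⟩ := List.mem_map.mp hr
    exact (hP ▸ hmem c hc : c ∈ P.comap Polynomial.C)
  by_cases hc : P = (maximalIdeal C).map Polynomial.C
  · refine ⟨_, h1.isRegular_of_isLocalization_of_mem _ P h1m, ?_⟩
    rw [IsLocalization.AtPrime.ringKrullDim_eq_height P, List.length_map, List.length_map]
    rw [hc, height_map_C]
    exact_mod_cast hmax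
  · have hmax' : (P.comap Polynomial.C).IsMaximal := hP ▸ inferInstance
    obtain ⟨y, hy, hPy⟩ := Polynomial.exists_monic_span_sup_map_eq C P hmax' (by rwa [hP])
    have h2 : IsWeaklyRegular C[X] (rs.map Polynomial.C ++ [y]) := by
      rw [isWeaklyRegular_append_iff, isWeaklyRegular_singleton_iff]
      refine ⟨h1, ?_⟩
      have := isSMulRegular_quotient_of_monic (Ideal.ofList rs) hy
      rwa [Ideal.map_ofList, ← Ideal.mul_top (Ideal.ofList _), ← smul_eq_mul] at this
    have h2m : ∀ r ∈ rs.map Polynomial.C ++ [y], r ∈ P := by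
      intro r hr
      rcases List.mem_append.mp hr with hr | hr
      · exact h1m r hr
      · rw [List.mem_singleton.mp hr, hPy]
        exact Ideal.mem_sup_right (Ideal.mem_span_singleton_self y)
    refine ⟨_, h2.isRegular_of_isLocalization_of_mem _ P h2m, ?_⟩
    rw [IsLocalization.AtPrime.ringKrullDim_eq_height P, List.length_map, List.length_append,
      List.length_map, List.length_singleton]
    -- Only an upper bound for the height of `P` is needed, so `P` may be replaced by a maximal
    -- ideal `M` above it; `M` still contracts to the maximal ideal, hence has height one more.
    obtain ⟨M, hM, hPM⟩ := Ideal.exists_le_maximal P Ideal.IsPrime.ne_top'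
    have : M.LiesOver (maximalIdeal C) := ⟨by
      rw [Ideal.under_def, algebraMap_eq]
      refine (IsLocalRing.maximalIdeal.isMaximal C).eq_of_le ?_ ?_
      · exact Ideal.IsPrime.ne_top (Ideal.IsPrime.comap _)
      · rw [← hP]
        exact Ideal.comap_mono hPM⟩
    have h3 : P.height ≤ rs.length + 1 := by
      refine (Ideal.height_mono hPM).trans ?_
      rw [height_eq_height_add_one (maximalIdeal C) M]
      gcongr
    exact_mod_cast h3

open Polynomial in
-- Localizing the coefficients at the contraction of the prime reduces to primes lying over the
-- maximal ideal of a local ring.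
lemma IsLocallyFullDepth.polynomial {R : Type*} [CommRing R] [IsNoetherianRing R]
    (h : IsLocallyFullDepth R) : IsLocallyFullDepth R[X] := by
  intro p hp
  let q := p.comap C
  let S := (Localization.AtPrime q)[X]
  let pc := Submonoid.map Polynomial.C.toMonoidHom q.primeCompl
  let : Algebra R[X] S := algebra R (Localization.AtPrime q)
  have : IsLocalization pc S := Polynomial.isLocalization _ _
  let pS := p.map (algebraMap R[X] S)
  have disj : Disjoint (pc : Set R[X]) (p : Set R[X]) := by
    simpa [pc, q] using! Set.disjoint_image_left.mpr
      (Set.disjoint_compl_left_iff_subset.mpr (fun _ a ↦ a))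
  have : pS.IsPrime := IsLocalization.isPrime_of_isPrime_disjoint pc _ _ ‹_› disj
  have : IsLocalization.AtPrime (Localization.AtPrime pS) p := by
    convert IsLocalization.isLocalization_isLocalization_atPrime_isLocalization pc
      (Localization.AtPrime pS) pS
    exact (IsLocalization.under_map_of_isPrime_disjoint pc _ ‹_› disj).symm
  have eq : Ideal.comap C pS = maximalIdeal (Localization.AtPrime q) := by
    rw [← IsLocalization.map_under q.primeCompl _ (Ideal.comap C pS),
      ← IsLocalization.map_under q.primeCompl _ (maximalIdeal (Localization.AtPrime q))]
    simp only [Ideal.comap_comap, S, pS]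
    rw [← Polynomial.algebraMap_eq (R := Localization.AtPrime q),
      ← IsScalarTower.algebraMap_eq R (Localization.AtPrime q) (Localization.AtPrime q)[X],
      IsScalarTower.algebraMap_eq R R[X] (Localization.AtPrime q)[X], ← Ideal.comap_comap,
      ← Ideal.under_def R[X], IsLocalization.under_map_of_isPrime_disjoint pc _ ‹_› disj]
    simp [q, IsLocalization.AtPrime.under_maximalIdeal (Localization.AtPrime q) q]
  exact ((h q).polynomial pS eq).of_ringEquiv (IsLocalization.algEquiv p.primeCompl
    (Localization.AtPrime pS) (Localization.AtPrime p)).toRingEquiv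

lemma isLocallyFullDepth_mvPolynomial (k : Type*) [Field k] (ι : Type*) [Finite ι] :
    IsLocallyFullDepth (MvPolynomial ι k) := by
  induction ι using Finite.induction_empty_option with
  | of_equiv e H => exact H.of_ringEquiv (MvPolynomial.renameEquiv _ e).toRingEquiv
  | h_empty =>
    exact (isLocallyFullDepth_of_field k).of_ringEquiv (MvPolynomial.isEmptyRingEquiv k _).symm
  | h_option IH =>
    exact IH.polynomial.of_ringEquiv (MvPolynomial.optionEquivLeft _ _).toRingEquiv.symm

/-- Dimension shifting: by the long exact sequence of multiplication by `g`, each term of the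
sequence uses up one degree of the vanishing of `Ext`, and after the last one degree zero is left.
-/
lemma subsingleton_linearMap_quotient_ofList {B : Type u} [CommRing B] (N : ModuleCat.{u} B)
    (gs : List B) (M : ModuleCat.{u} B) (hgs : IsWeaklyRegular M gs)
    (h : ∀ i < gs.length + 1, Subsingleton (Ext N M i)) :
    Subsingleton (N →ₗ[B] (M ⧸ (Ideal.ofList gs • ⊤ : Submodule B M))) := by
  induction gs generalizing M with
  | nil =>
    have : Subsingleton (N ⟶ M) := Ext.addEquiv₀.subsingleton_congr.mp (h 0 (by simp))
    have : Subsingleton (N →ₗ[B] M) := ModuleCat.homAddEquiv.symm.subsingleton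
    let e : M ≃ₗ[B] (M ⧸ (Ideal.ofList ([] : List B) • ⊤ : Submodule B M)) :=
      (Submodule.quotEquivOfEqBot _ (by simp)).symm
    exact (LinearEquiv.congrRight (M := N) e).symm.toEquiv.subsingleton
  | cons g gs ih =>
    rw [isWeaklyRegular_cons_iff] at hgs
    have := ih (ModuleCat.of B (QuotSMulTop g M)) hgs.2 fun i hi ↦ by
      have zero1 := AddCommGrpCat.isZero_of_iff_subsingleton.mpr
        (h i (by rw [List.length_cons]; omega))
      have zero2 := AddCommGrpCat.isZero_of_iff_subsingleton.mpr
        (h (i + 1) (by rw [List.length_cons]; omega))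
      exact AddCommGrpCat.subsingleton_of_isZero <| ShortComplex.Exact.isZero_of_both_zeros
        ((Ext.covariant_sequence_exact₃' N hgs.1.smulShortComplex_shortExact) i (i + 1) rfl)
        (zero1.eq_zero_of_src _) (zero2.eq_zero_of_tgt _)
    exact (LinearEquiv.congrRight (M := N)
      (Submodule.quotOfListConsSMulTopEquivQuotSMulTopInner M g gs)).toEquiv.subsingleton

/-- The unmixedness theorem. -/
lemma IsLocallyFullDepth.mem_minimalPrimes_of_mem_associatedPrimes {A : Type u} [CommRing A]
    [IsNoetherianRing A] (hA : IsLocallyFullDepth A) {gs : List A} (hgs : IsWeaklyRegular A gs)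
    (P : Ideal A) (a : A) [hP : P.IsPrime] (ha : ∀ s, s * a ∈ Ideal.ofList gs ↔ s ∈ P) :
    P ∈ (Ideal.ofList gs).minimalPrimes := by
  have hIP : Ideal.ofList gs ≤ P := fun g hg ↦ (ha g).mp (Ideal.mul_mem_right _ _ hg)
  have hgP : ∀ g ∈ gs, g ∈ P := fun g hg ↦ hIP (Ideal.subset_span hg)
  let B := Localization.AtPrime P
  obtain ⟨rs, hrs, hl⟩ := hA P
  have hmem : ∀ r ∈ rs, r ∈ maximalIdeal B := by
    intro r hr
    refine le_maximalIdeal (J := Ideal.ofList rs) (fun e ↦ ?_) (Ideal.subset_span hr)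
    apply hrs.top_ne_smul
    rw [e, smul_eq_mul, Ideal.top_mul]
  have hB := hgs.isRegular_of_isLocalization_of_mem B P hgP
  -- A longer regular sequence would make `Ext^i` of the residue field into `B` vanish for all `i`
  -- up to the length of `gs`, so the residue field would have no nonzero map to `B/(gs)`. But
  -- multiplication by `a` is such a map.
  have hlen : rs.length ≤ gs.length := by
    by_contra! hlt
    have hext := ModuleCat.subsingleton_ext_of_exists_isRegular (maximalIdeal B)
      (ModuleCat.of B (B ⧸ maximalIdeal B)) (by
        rw [Module.support_eq_zeroLocus, Ideal.annihilator_quotient]) (ModuleCat.of B B) (by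
        rw [smul_eq_mul, Ideal.mul_top, lt_top_iff_ne_top]
        exact Ideal.IsPrime.ne_top') rs hmem hrs
    have hs := subsingleton_linearMap_quotient_ofList (ModuleCat.of B (B ⧸ maximalIdeal B))
      (gs.map (algebraMap A B)) (ModuleCat.of B B) hB.toIsWeaklyRegular
      fun i hi ↦ hext i (by rw [List.length_map] at hi; omega)
    let J : Submodule B B := Ideal.ofList (gs.map (algebraMap A B)) • ⊤
    have hJ : J = (Ideal.ofList gs).map (algebraMap A B) := by
      rw [Ideal.map_ofList]
      exact Ideal.mul_top _
    let f : B →ₗ[B] B ⧸ J := J.mkQ.comp (LinearMap.toSpanSingleton B B (algebraMap A B a))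
    have hf : maximalIdeal B ≤ LinearMap.ker f := by
      rw [← Localization.AtPrime.map_eq_maximalIdeal, Ideal.map_le_iff_le_comap]
      intro p hp
      change f _ = 0
      simp only [f, LinearMap.comp_apply, LinearMap.toSpanSingleton_apply]
      rw [Submodule.mkQ_apply, Submodule.Quotient.mk_eq_zero, hJ, smul_eq_mul, ← map_mul]
      exact Ideal.mem_map_of_mem _ ((ha p).mpr hp)
    have h0 : (Submodule.liftQ _ f hf : (B ⧸ maximalIdeal B) →ₗ[B] B ⧸ J) = 0 :=
      @Subsingleton.elim _ hs _ _
    have h1 : f 1 = 0 := congr($h0 (Submodule.Quotient.mk 1))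
    simp only [f, LinearMap.comp_apply, LinearMap.toSpanSingleton_apply, one_smul] at h1
    rw [Submodule.mkQ_apply, Submodule.Quotient.mk_eq_zero, hJ] at h1
    obtain ⟨⟨⟨i, hi⟩, s⟩, hs⟩ := (IsLocalization.mem_map_algebraMap_iff P.primeCompl B).mp h1
    rw [← map_mul] at hs
    obtain ⟨t, ht⟩ := (IsLocalization.eq_iff_exists P.primeCompl B).mp hs
    refine (mul_mem t.2 s.2 : (t * s : A) ∈ P.primeCompl) ((ha _).mp ?_)
    rw [mul_assoc, mul_comm (s : A), ht]
    exact Ideal.mul_mem_left _ _ hi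
  have hheight : P.height ≤ gs.length := by
    rw [IsLocalization.AtPrime.ringKrullDim_eq_height P] at hl
    have : P.height ≤ rs.length := by exact_mod_cast hl
    exact this.trans (by exact_mod_cast hlen)
  -- A strictly smaller prime containing `gs` has height at least the length of `gs`, and then `P`
  -- would have height greater than that length.
  refine ⟨⟨hP, hIP⟩, fun Q ⟨hQ, hIQ⟩ hQP ↦ ?_⟩
  by_contra hne
  have hlt : Q < P := lt_of_le_not_ge hQP hne
  have h1 := length_le_height_of_isWeaklyRegular hgs Q fun g hg ↦ hIQ (Ideal.subset_span hg)
  have h2 := (Ideal.height_add_one_le_of_lt_of_isPrime hlt).trans hheight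
  have h3 := (add_le_add_left h1 1).trans h2
  exact absurd h3 (by norm_cast; omega)

end FullDepth
end NewtonGroupoid

/-! ### Rank of the conormal module -/

namespace NewtonGroupoid

section ConormalRank

open scoped TensorProduct

/-- As `B` and `L` are both formally smooth, the conormal sequence `0 → J/J² → L ⊗ Ω_B → Ω_L → 0` is
split exact, so `J/J²`, which appears here as the kernel of `β`, is free over the local ring `L`.
Its rank is the least number of generators of `J` by Nakayama's lemma. -/
lemma exists_conormal_rank (k B L : Type u) [CommRing k] [CommRing B] [CommRing L] [Algebra k B]
    [Algebra k L] [Algebra B L] [IsScalarTower k B L] [IsLocalRing B] [IsNoetherianRing B]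
    [Nontrivial L] [Algebra.FormallySmooth k B] [Algebra.FormallySmooth k L]
    (hs : Function.Surjective (algebraMap B L)) [Module.Free B Ω[B⁄k]] [Module.Finite B Ω[B⁄k]]
    [Module.Free L Ω[L⁄k]] [Module.Finite L Ω[L⁄k]] :
    ∃ ρ : ℕ, ρ + Module.finrank L Ω[L⁄k] = Module.finrank B Ω[B⁄k] ∧
      (∃ s : Fin ρ → B, RingHom.ker (algebraMap B L) = Ideal.span (Set.range s)) ∧
      ∀ (m : ℕ) (t : Fin m → B), RingHom.ker (algebraMap B L) = Ideal.span (Set.range t) →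
        ρ ≤ m := by
  have : IsLocalRing L := .of_surjective' _ hs
  let β := KaehlerDifferential.mapBaseChange k B L
  have hβ : Function.Surjective β := KaehlerDifferential.mapBaseChange_surjective k B L hs
  obtain ⟨γ, hγ⟩ := Module.projective_lifting_property β LinearMap.id hβ
  let α := KaehlerDifferential.kerCotangentToTensor k B L
  obtain ⟨l, hl⟩ := (Algebra.FormallySmooth.iff_split_injection (R := k) hs).mp inferInstance
  have hα : Function.Injective α := Function.LeftInverse.injective (g := l) fun x ↦ congr($hl x)
  have hex : Function.Exact α β :=
    KaehlerDifferential.exact_kerCotangentToTensor_mapBaseChange k B L hs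
  let π : L ⊗[B] Ω[B⁄k] →ₗ[L] LinearMap.ker β :=
    (LinearMap.id - γ ∘ₗ β).codRestrict _ fun x ↦ by
      have h1 : β (γ (β x)) = β x := congr($hγ (β x))
      simp [h1]
  have hπ (x : LinearMap.ker β) : π x = x := by
    refine Subtype.ext ?_
    simp [π]
  have hπs : Function.Surjective π := fun x ↦ ⟨x, hπ x⟩
  have : Module.Finite L (LinearMap.ker β) := .of_surjective π hπs
  have : Module.Projective L (LinearMap.ker β) :=
    .of_split (LinearMap.ker β).subtype π (LinearMap.ext hπ)
  have : Module.Free L (LinearMap.ker β) :=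
    Module.free_of_flat_of_isLocalRing (R := L) (P := LinearMap.ker β)
  let e : (L ⊗[B] Ω[B⁄k]) ≃ₗ[L] LinearMap.ker β × Ω[L⁄k] :=
    .ofBijective (π.prod β) ⟨by
      rw [injective_iff_map_eq_zero]
      intro x hx
      have h1 : π x = 0 := congr(($hx).1)
      have h2 : β x = 0 := congr(($hx).2)
      have h3 := congr(($h1 : L ⊗[B] Ω[B⁄k]))
      simpa [π, h2] using h3, by
      rintro ⟨x, y⟩
      have h1 : β (γ y) = y := congr($hγ y)
      have h2 : π (γ y) = 0 := Subtype.ext (by simp [π, h1])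
      refine ⟨x + γ y, Prod.ext ?_ ?_⟩
      · simp [h2, hπ]
      · simp [h1]⟩
  have hfr := e.finrank_eq
  rw [Module.finrank_prod, Module.finrank_baseChange] at hfr
  let J := RingHom.ker (algebraMap B L)
  have hmem (j : J) : α (J.toCotangent j) ∈ LinearMap.ker β :=
    (hex _).mpr ⟨_, rfl⟩
  have hJfg : J.FG := J.fg_of_isNoetherianRing
  have hJle : J ≤ Ideal.jacobson ⊥ := by
    rw [IsLocalRing.jacobson_eq_maximalIdeal _ bot_ne_top]
    exact IsLocalRing.le_maximalIdeal (RingHom.ker_ne_top _)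
  refine ⟨Module.finrank L (LinearMap.ker β), hfr.symm, ?_, ?_⟩
  · let b := Module.finBasis L (LinearMap.ker β)
    have hb (i) : ∃ j : J, α (J.toCotangent j) = (b i : L ⊗[B] Ω[B⁄k]) := by
      obtain ⟨c, hc⟩ := (hex _).mp (b i).2
      obtain ⟨j, rfl⟩ := J.toCotangent_surjective c
      exact ⟨j, hc⟩
    choose s hs' using hb
    refine ⟨fun i ↦ s i, le_antisymm ?_ ?_⟩
    -- Lifts of a basis of `J/J²` generate `J` modulo `J · J`.
    · refine Submodule.le_of_le_smul_of_le_jacobson_bot (I := J) hJfg hJle ?_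
      intro j hj
      obtain ⟨f, hf⟩ : ∃ f : Fin _ → L, ∑ i, f i • b i = ⟨_, hmem ⟨j, hj⟩⟩ := ⟨_, b.sum_repr _⟩
      choose g hg using fun i ↦ hs (f i)
      have h1 : J.toCotangent ⟨j, hj⟩ = J.toCotangent (∑ i, g i • s i) := by
        apply hα
        have h2 := congr(($hf : L ⊗[B] Ω[B⁄k]))
        rw [map_sum, map_sum]
        refine h2.symm.trans ?_
        rw [Submodule.coe_sum]
        refine Finset.sum_congr rfl fun i _ ↦ ?_
        rw [map_smul, map_smul, hs', ← hg]
        exact algebraMap_smul L (g i) _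
      rw [Ideal.toCotangent_eq] at h1
      have h3 : j = ((∑ i, g i • s i : J) : B) + (j - ((∑ i, g i • s i : J) : B)) := by ring
      rw [h3]
      refine Submodule.add_mem_sup ?_ ?_
      · simp only [Submodule.coe_sum, Submodule.coe_smul]
        exact sum_mem fun i _ ↦ Ideal.mul_mem_left _ _ (Ideal.subset_span ⟨i, rfl⟩)
      · rw [smul_eq_mul, ← sq]
        exact h1
    · rw [Ideal.span_le]
      rintro _ ⟨i, rfl⟩
      exact (s i).2
  · intro m t ht
    have htJ (i) : t i ∈ J := by
      change t i ∈ RingHom.ker (algebraMap B L)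
      rw [ht]
      exact Ideal.subset_span ⟨i, rfl⟩
    have := finrank_le_of_span_eq_top (R := L)
      (v := fun i : Fin m ↦ (⟨_, hmem ⟨t i, htJ i⟩⟩ : LinearMap.ker β)) ?_
    · simpa using this
    · rw [eq_top_iff]
      rintro ⟨x, hx⟩ -
      obtain ⟨c, hc⟩ := (hex _).mp hx
      obtain ⟨⟨j, hj⟩, rfl⟩ := J.toCotangent_surjective c
      have hj' := hj
      change j ∈ RingHom.ker (algebraMap B L) at hj'
      rw [ht] at hj'
      obtain ⟨g, hg⟩ := (Ideal.mem_span_range_iff_exists_fun).mp hj'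
      have h1 : (⟨x, hx⟩ : LinearMap.ker β) =
          ∑ i, algebraMap B L (g i) • (⟨_, hmem ⟨t i, htJ i⟩⟩ : LinearMap.ker β) := by
        have h2 : (⟨j, hj⟩ : J) = ∑ i, g i • ⟨t i, htJ i⟩ := Subtype.ext (by simp [← hg])
        refine Subtype.ext (hc.symm.trans ?_)
        rw [h2, map_sum, map_sum, Submodule.coe_sum]
        refine Finset.sum_congr rfl fun i _ ↦ ?_
        rw [map_smul, map_smul]
        exact (algebraMap_smul L (g i) _).symm
      rw [h1]
      exact sum_mem fun i _ ↦ Submodule.smul_mem _ _ (Submodule.subset_span ⟨i, rfl⟩)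

end ConormalRank
end NewtonGroupoid

/-! ### Complete intersections: the number of equations, square presentations, regularity -/

namespace NewtonGroupoid

open MvPolynomial RingTheory.Sequence

lemma exists_evalHom {k A ι n : Type*} [CommRing k] [CommRing A] [Algebra k A] (y : ι → A)
    (x : n → A) : ∃ θ : MvPolynomial n (MvPolynomial ι k) →+* A,
      θ = eval₂Hom (aeval (R := k) y).toRingHom x ∧ (∀ c, θ (C (C c)) = algebraMap k A c) ∧
      (∀ j, θ (C (X j)) = y j) ∧ ∀ l, θ (X l) = x l :=
  ⟨_, rfl, by simp, by simp, by simp⟩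

section CompleteIntersection

variable {k R : Type u} [Field k] [CommRing R] [Algebra k R] {N ε : ℕ}
  {gs : List (MvPolynomial (Fin N) k)} (π : MvPolynomial (Fin N) k →ₐ[k] R)

/-- Let `p` be the preimage of the minimal prime `q` and `ρ` the conormal rank at `p`. Étaleness
over affine `ε`-space gives `ρ + ε = N`. The number of equations is at most the height of `p` by
regularity; this height is at most `ρ`, since `p` is minimal over an ideal locally generated by `ρ`
elements; and `ρ` is at most the number of equations, which generate that ideal. -/
lemma length_add_eq_of_formallyEtale (hgs : IsWeaklyRegular (MvPolynomial (Fin N) k) gs)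
    (hπ : Function.Surjective π) (hker : RingHom.ker π = Ideal.ofList gs) (y : Fin ε → R)
    (q : Ideal R) [q.IsPrime] (hq : q ∈ minimalPrimes R)
    (het : ((algebraMap R (Localization.AtPrime q)).comp (aeval (R := k) y).toRingHom).FormallyEtale) :
    gs.length + ε = N := by
  let A := MvPolynomial (Fin N) k
  let p : Ideal A := q.comap π.toRingHom
  let B := Localization.AtPrime p
  let L := Localization.AtPrime q
  let f : B →+* L := Localization.localRingHom p q π.toRingHom rfl
  have hf : Function.Surjective f := RingHom.surjective_localRingHom_of_surjective _ hπ q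
  let : Algebra B L := f.toAlgebra
  have hfa (a : A) : algebraMap B L (algebraMap A B a) = algebraMap R L (π a) :=
    Localization.localRingHom_to_map _ _ _ _ _
  have : IsScalarTower k B L := .of_algebraMap_eq fun c ↦ by
    rw [IsScalarTower.algebraMap_apply k A B, hfa, AlgHom.map_algebraMap,
      ← IsScalarTower.algebraMap_apply]
  let K := MvPolynomial (Fin ε) k
  let : Algebra K L := ((algebraMap R L).comp (aeval (R := k) y).toRingHom).toAlgebra
  have hKL : Algebra.FormallyEtale K L := het
  have : IsScalarTower k K L := .of_algebraMap_eq fun c ↦ by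
    change _ = algebraMap R L (aeval y (algebraMap k K c))
    rw [AlgHom.map_algebraMap, ← IsScalarTower.algebraMap_apply]
  have : Algebra.FormallySmooth k L := .comp k K L
  have : Algebra.FormallyEtale A B := .of_isLocalization p.primeCompl
  have : Algebra.FormallySmooth k B := .comp k A B
  have eB := KaehlerDifferential.tensorKaehlerEquivOfFormallyEtale k A B
  have eL := KaehlerDifferential.tensorKaehlerEquivOfFormallyEtale k K L
  let bA := KaehlerDifferential.mvPolynomialBasis k (Fin N)
  let bK := KaehlerDifferential.mvPolynomialBasis k (Fin ε)
  have := Module.Free.of_basis bA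
  have := Module.Free.of_basis bK
  have := Module.Finite.of_basis bA
  have := Module.Finite.of_basis bK
  have := Module.Free.of_equiv eB
  have := Module.Free.of_equiv eL
  have := Module.Finite.equiv eB
  have := Module.Finite.equiv eL
  have hB : Module.finrank B Ω[B⁄k] = N := by
    rw [← eB.finrank_eq, Module.finrank_baseChange, Module.finrank_eq_card_basis bA, Fintype.card_fin]
  have hL : Module.finrank L Ω[L⁄k] = ε := by
    rw [← eL.finrank_eq, Module.finrank_baseChange, Module.finrank_eq_card_basis bK, Fintype.card_fin]
  obtain ⟨ρ, hρ, ⟨s, hs⟩, hle⟩ := exists_conormal_rank k B L hf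
  rw [hB, hL] at hρ
  have hkerB : RingHom.ker (algebraMap B L) = (Ideal.ofList gs).map (algebraMap A B) := by
    refine le_antisymm (fun b hb ↦ ?_) ?_
    · obtain ⟨a, t, rfl⟩ := IsLocalization.exists_mk'_eq p.primeCompl b
      have h1 : algebraMap B L (algebraMap A B a) = 0 := by
        rw [← IsLocalization.mk'_spec B a t, map_mul, RingHom.mem_ker.mp hb, zero_mul]
      rw [hfa, IsLocalization.map_eq_zero_iff q.primeCompl] at h1
      obtain ⟨⟨c, hc⟩, hca⟩ := h1
      obtain ⟨c, rfl⟩ := hπ c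
      have h2 : c * a ∈ Ideal.ofList gs := by
        rw [← hker, RingHom.mem_ker, map_mul]
        exact hca
      rw [IsLocalization.mk'_mem_map_algebraMap_iff p.primeCompl B]
      exact ⟨c, hc, h2⟩
    · rw [Ideal.map_le_iff_le_comap, ← hker]
      intro a ha
      change algebraMap B L _ = 0
      rw [hfa, RingHom.mem_ker.mp ha, map_zero]
  have hmin : p ∈ (Ideal.ofList gs).minimalPrimes := by
    have h1 : q ∈ (⊥ : Ideal R).minimalPrimes := hq
    have h2 : Ideal.ofList gs = (⊥ : Ideal R).comap π.toRingHom := hker.symm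
    rw [h2, Ideal.comap_minimalPrimes_eq_of_surjective (f := π.toRingHom) hπ]
    exact ⟨q, h1, rfl⟩
  have hgp : ∀ g ∈ gs, g ∈ p := fun g hg ↦ hmin.1.2 (Ideal.subset_span hg)
  have hlow := length_le_height_of_isWeaklyRegular hgs p hgp
  have hup : (IsLocalRing.maximalIdeal B).height ≤ ρ := by
    have h1 : IsLocalRing.maximalIdeal B ∈ (Ideal.span (Set.range s)).minimalPrimes := by
      rw [← hs, hkerB]
      refine ⟨⟨inferInstance, ?_⟩, ?_⟩
      · rw [← Localization.AtPrime.map_eq_maximalIdeal]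
        exact Ideal.map_mono hmin.1.2
      · rintro Q ⟨hQ, hQg⟩ hQm
        have h2 : Ideal.ofList gs ≤ Q.comap (algebraMap A B) := Ideal.map_le_iff_le_comap.mp hQg
        have h3 : Q.comap (algebraMap A B) ≤ p := by
          exact (Ideal.comap_mono hQm).trans (Localization.AtPrime.under_maximalIdeal (I := p)).le
        have h4 := hmin.2 ⟨Ideal.IsPrime.comap _, h2⟩ h3
        rw [← Localization.AtPrime.map_eq_maximalIdeal]
        exact Ideal.map_le_iff_le_comap.mpr h4
    refine (Ideal.height_le_card_of_mem_minimalPrimes_span (Set.finite_range s) h1).trans ?_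
    have : (Set.range s).ncard ≤ ρ := by
      rw [← Set.image_univ]
      refine (Set.ncard_image_le).trans ?_
      rw [Set.ncard_univ, Nat.card_fin]
    exact_mod_cast this
  have hh : (IsLocalRing.maximalIdeal B).height = p.height := by
    have h1 := IsLocalization.AtPrime.ringKrullDim_eq_height p B
    rw [← IsLocalRing.maximalIdeal_height_eq_ringKrullDim] at h1
    exact_mod_cast h1
  have h1 : gs.length ≤ ρ := by
    rw [hh] at hup
    exact_mod_cast hlow.trans hup
  have h2 : ρ ≤ gs.length := hle gs.length (fun i ↦ algebraMap A B (gs.get i)) <| by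
    rw [hkerB, Ideal.ofList, Ideal.map_span]
    congr 1
    ext b
    simp only [Set.mem_image, Set.mem_ofPred_eq, Set.mem_range]
    simp only [List.get_eq_getElem]
    constructor
    · rintro ⟨a, ha, rfl⟩
      obtain ⟨i, hi, rfl⟩ := List.mem_iff_getElem.mp ha
      exact ⟨⟨i, hi⟩, rfl⟩
    · rintro ⟨i, rfl⟩
      exact ⟨_, List.getElem_mem _, rfl⟩
  omega

/-- Graph construction: the variables are all the `t_l`, and the equations are the `g_i` together
with `y_j - ŷ_j(t)`, where `ŷ_j` lifts the coordinate `y_j`. The hypothesis `hN` says that their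
number is right. -/
lemma exists_squarePresentation (hN : gs.length + ε = N)
    (hπ : Function.Surjective π) (hker : RingHom.ker π = Ideal.ofList gs) (y : Fin ε → R) :
    ∃ P : SquarePresentation k R (Fin ε) (Fin N), P.y = y := by
  choose ŷ hŷ using fun j ↦ hπ (y j)
  let σ : Fin N ≃ Fin gs.length ⊕ Fin ε := (finCongr hN).symm.trans finSumFinEquiv.symm
  let K := MvPolynomial (Fin ε) k
  let F : Fin gs.length ⊕ Fin ε → MvPolynomial (Fin N) K :=
    Sum.elim (fun i ↦ MvPolynomial.map C (gs.get i)) fun j ↦ C (X j) - MvPolynomial.map C (ŷ j)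
  obtain ⟨θ, -, hθC, hθY, hθX⟩ := exists_evalHom (k := k) ŷ (X : Fin N → MvPolynomial (Fin N) k)
  obtain ⟨ev, hev', hevC, hevY, hevX⟩ := exists_evalHom (k := k) y fun l ↦ π (X l)
  have hev : ev = π.toRingHom.comp θ := by
    refine MvPolynomial.ringHom_ext' (MvPolynomial.ringHom_ext' ?_ ?_) ?_
    · ext c
      change ev (C (C c)) = π (θ (C (C c)))
      rw [hevC, hθC, AlgHom.map_algebraMap]
    · intro j
      change ev (C (X j)) = π (θ (C (X j)))
      rw [hevY, hθY, hŷ]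
    · intro l
      change ev (X l) = π (θ (X l))
      rw [hevX, hθX]
  have hθmap (a : MvPolynomial (Fin N) k) : θ (MvPolynomial.map C a) = a := by
    have : θ.comp (MvPolynomial.map C) = RingHom.id _ := by
      refine MvPolynomial.ringHom_ext' ?_ ?_
      · exact RingHom.ext fun c ↦ by simp [hθC]
      · intro l; simp [hθX]
    exact congr($this a)
  have hspan : Ideal.span (Set.range (F ∘ σ)) = Ideal.span (Set.range F) := by
    rw [σ.surjective.range_comp]
  refine ⟨⟨y, fun l ↦ π (X l), F ∘ σ, ?_, ?_⟩, rfl⟩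
  · intro r
    obtain ⟨a, rfl⟩ := hπ r
    refine ⟨MvPolynomial.map C a, ?_⟩
    rw [← hev', hev, RingHom.comp_apply, hθmap]
    rfl
  · rw [hspan, ← hev']
    refine le_antisymm (fun a ha ↦ ?_) ?_
    · have h1 : θ a ∈ Ideal.ofList gs := by
        rw [← hker]
        rw [RingHom.mem_ker, hev] at ha
        exact ha
      have h2 : MvPolynomial.map C (θ a) ∈ Ideal.span (Set.range F) := by
        have h3 : (Ideal.ofList gs).map (MvPolynomial.map C : MvPolynomial (Fin N) k →+*
            MvPolynomial (Fin N) K) ≤ Ideal.span (Set.range F) := by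
          rw [Ideal.ofList, Ideal.map_span, Ideal.span_le]
          rintro _ ⟨g, hg, rfl⟩
          obtain ⟨i, hi, rfl⟩ := List.mem_iff_getElem.mp hg
          exact Ideal.subset_span ⟨.inl ⟨i, hi⟩, rfl⟩
        exact h3 (Ideal.mem_map_of_mem _ h1)
      -- Modulo the equations `y_j` may be replaced by `ŷ_j`, so every polynomial is congruent to
      -- its image under `θ`, read with constant coefficients.
      have h4 : (Ideal.Quotient.mk (Ideal.span (Set.range F))).comp ((MvPolynomial.map C).comp θ) =
          Ideal.Quotient.mk _ := by
        refine MvPolynomial.ringHom_ext' (MvPolynomial.ringHom_ext' ?_ ?_) ?_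
        · exact RingHom.ext fun c ↦ by simp [hθC]
        · intro j
          simp only [RingHom.comp_apply, hθY]
          rw [eq_comm, Ideal.Quotient.eq]
          exact Ideal.subset_span ⟨.inr j, rfl⟩
        · intro l; simp [hθX]
      have h5 := congr($h4 a)
      rw [RingHom.comp_apply, RingHom.comp_apply, Ideal.Quotient.eq_zero_iff_mem.mpr h2] at h5
      exact Ideal.Quotient.eq_zero_iff_mem.mp h5.symm
    · rw [Ideal.span_le]
      rintro _ ⟨i | j, rfl⟩
      · change ev _ = 0
        rw [hev, RingHom.comp_apply]
        change π (θ (MvPolynomial.map C (gs.get i))) = 0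
        rw [hθmap, ← RingHom.mem_ker, hker]
        exact Ideal.subset_span (List.get_mem _ _)
      · change ev (C (X j) - MvPolynomial.map C (ŷ j)) = 0
        rw [hev, map_sub, RingHom.comp_apply, RingHom.comp_apply, hθmap]
        rw [hθY]
        exact sub_self _

/-- Zero divisors of a noetherian ring lie in associated primes, and by unmixedness these are
minimal. -/
lemma mem_nonZeroDivisors_of_notMem_minimalPrimes
    (hgs : IsWeaklyRegular (MvPolynomial (Fin N) k) gs)
    (hπ : Function.Surjective π) (hker : RingHom.ker π = Ideal.ofList gs) (d : R)
    (hd : ∀ q ∈ minimalPrimes R, d ∉ q) : d ∈ nonZeroDivisors R := by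
  have : IsNoetherianRing R := isNoetherianRing_of_surjective _ _ π.toRingHom hπ
  by_contra hn
  have h1 : d ∈ ⋃ p ∈ associatedPrimes R R, (p : Set R) := by
    rw [biUnion_associatedPrimes_eq_compl_nonZeroDivisors]
    exact hn
  simp only [Set.mem_iUnion] at h1
  obtain ⟨q, hq, hdq⟩ := h1
  obtain ⟨hq', c, hc⟩ := isAssociatedPrime_iff.mp hq
  obtain ⟨a, rfl⟩ := hπ c
  have hc' (s : R) : s * π a = 0 ↔ s ∈ q := by
    rw [hc, Submodule.mem_colon_singleton]
    simp
  let p := q.comap π.toRingHom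
  have hp := (isLocallyFullDepth_mvPolynomial k (Fin N)).mem_minimalPrimes_of_mem_associatedPrimes hgs
    p a fun s ↦ by
      rw [← hker, RingHom.mem_ker, map_mul, hc']
      rfl
  have h2 : Ideal.ofList gs = (⊥ : Ideal R).comap π.toRingHom := hker.symm
  rw [h2, Ideal.comap_minimalPrimes_eq_of_surjective (f := π.toRingHom) hπ] at hp
  obtain ⟨q', hq'', he⟩ := hp
  have : q' = q := Ideal.comap_injective_of_surjective π.toRingHom hπ he
  exact hd q (this ▸ hq'') hdq

end CompleteIntersection
end NewtonGroupoid

/-! ### Differentials and the Jacobian matrix -/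

namespace NewtonGroupoid

open MvPolynomial KaehlerDifferential
open scoped TensorProduct

section Jacobian

variable {K R : Type u} {n : Type} [CommRing K] [CommRing R] [Algebra K R] [Fintype n] [DecidableEq n]
  (x : n → R) (f : n → MvPolynomial n K)

lemma map_aeval_eq_sum_pderiv {Q O : Type u} [CommRing Q] [CommRing O] [Algebra K Q] [Algebra K O]
    [Algebra R O] [Algebra Q O] [IsScalarTower K R O] [IsScalarTower K Q O] (p : MvPolynomial n K) :
    D Q O (algebraMap R O (aeval x p)) =
      ∑ l, algebraMap R O (aeval x (pderiv l p)) • D Q O (algebraMap R O (x l)) := by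
  induction p using MvPolynomial.induction_on with
  | C a =>
    rw [aeval_C, ← IsScalarTower.algebraMap_apply, IsScalarTower.algebraMap_apply K Q O,
      Derivation.map_algebraMap]
    simp
  | add p q hp hq => simp only [map_add, hp, hq, add_smul, Finset.sum_add_distrib]
  | mul_X p m hp =>
    rw [map_mul, map_mul, Derivation.leibniz, hp]
    have (l : n) : algebraMap R O (aeval x (pderiv l (p * X m))) • D Q O (algebraMap R O (x l)) =
        algebraMap R O (x m) • algebraMap R O (aeval x (pderiv l p)) • D Q O (algebraMap R O (x l)) +
          if l = m then algebraMap R O (aeval x p) • D Q O (algebraMap R O (x m)) else 0 := by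
      rw [pderiv_mul, pderiv_X]
      by_cases h : l = m
      · subst h
        simp only [map_add, map_mul, aeval_X, Pi.single_eq_same, mul_one, add_smul, if_pos]
        rw [mul_comm, mul_smul]
      · simp only [map_mul, aeval_X, Pi.single_eq_of_ne (Ne.symm h), mul_zero, add_zero,
          if_neg h]
        rw [mul_comm, mul_smul]
    simp only [this, Finset.sum_add_distrib, aeval_X, Finset.smul_sum]
    rw [add_comm]
    simp

/-- The Jacobian matrix of a presentation `K[x] / (f) ≃ R`, over an `R`-algebra `O`. -/
noncomputable def jacobianOver (O : Type u) [CommRing O] [Algebra R O] : Matrix n n O :=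
  .of fun i l ↦ algebraMap R O (aeval x (pderiv l (f i)))

variable (O : Type u) [CommRing O] [Algebra R O] [Algebra K O] [IsScalarTower K R O]

/-- The map `Oⁿ ⟶ Ω[O⁄Q]` with values `dx`. -/
noncomputable def differentialsOver (Q : Type u) [CommRing Q] [Algebra Q O] :
    (n → O) →ₗ[O] Ω[O⁄Q] :=
  Fintype.linearCombination O fun l ↦ D Q O (algebraMap R O (x l))

variable (hsurj : Function.Surjective (aeval x : MvPolynomial n K →ₐ[K] R))
  (hker : RingHom.ker (aeval x : MvPolynomial n K →ₐ[K] R) = Ideal.span (Set.range f))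

omit [Fintype n] [DecidableEq n] in
include hker in
lemma aeval_relation_eq_zero (i : n) : aeval x (f i) = 0 := by
  rw [← RingHom.mem_ker, hker]
  exact Ideal.subset_span ⟨i, rfl⟩

include hsurj hker in
-- This derivation bounds the relations among the `dx_l` from above: sending a polynomial to the
-- class of its gradient kills the ideal of relations, because the gradients of the `f_i` span the
-- image that is divided out.
lemma exists_derivation_jacobian : ∃ δ : Derivation K R
    ((n → O) ⧸ LinearMap.range (Matrix.toLin' (jacobianOver x f O).transpose)),
      ∀ l, δ (x l) = Submodule.Quotient.mk (Pi.single l 1) := by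
  let N := LinearMap.range (Matrix.toLin' (jacobianOver x f O).transpose)
  let ev : MvPolynomial n K →ₐ[K] R := aeval x
  let D₀ : MvPolynomial n K →ₗ[K] (n → O) ⧸ N :=
    (N.mkQ.restrictScalars K).comp
      (LinearMap.pi fun l ↦ (Algebra.linearMap R O).restrictScalars K ∘ₗ ev.toLinearMap ∘ₗ
        (pderiv l).toLinearMap)
  have hD₀ (p) : D₀ p = Submodule.Quotient.mk fun l ↦ algebraMap R O (ev (pderiv l p)) := rfl
  have hsm (r : R) (v : n → O) : (Submodule.Quotient.mk fun l ↦ algebraMap R O r * v l) =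
      r • (Submodule.Quotient.mk v : (n → O) ⧸ N) := by
    rw [← Submodule.Quotient.mk_smul]
    congr 1
    ext l
    simp [Algebra.smul_def]
  have hmul (p q) : D₀ (p * q) = ev p • D₀ q + ev q • D₀ p := by
    rw [hD₀, hD₀, hD₀, ← hsm, ← hsm, ← Submodule.Quotient.mk_add]
    congr 1
    ext l
    simp only [Pi.add_apply, pderiv_mul, map_add, map_mul]
    ring
  have hkill (p) (hp : ev p = 0) : D₀ p = 0 := by
    have hp' : p ∈ Ideal.span (Set.range f) := hker ▸ hp
    induction hp' using Submodule.span_induction with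
    | mem p hp' =>
      obtain ⟨i, rfl⟩ := hp'
      rw [hD₀, Submodule.Quotient.mk_eq_zero]
      refine ⟨Pi.single i 1, ?_⟩
      rw [Matrix.toLin'_apply, Matrix.mulVec_single_one]
      rfl
    | zero => exact map_zero _
    | add p q hp' hq' hp'' hq'' =>
      have h1 : ev p = 0 := by
        rw [← RingHom.mem_ker]; exact hker ▸ hp'
      have h2 : ev q = 0 := by
        rw [← RingHom.mem_ker]; exact hker ▸ hq'
      rw [map_add, hp'' h1, hq'' h2, add_zero]
    | smul c p hp' hp'' =>
      have h1 : ev p = 0 := by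
        rw [← RingHom.mem_ker]; exact hker ▸ hp'
      rw [smul_eq_mul, hmul, hp'' h1, h1, smul_zero, zero_smul, add_zero]
  let s : R → MvPolynomial n K := Function.surjInv hsurj
  have hs (r) : ev (s r) = r := Function.surjInv_eq hsurj r
  have key (p) : D₀ (s (ev p)) = D₀ p := by
    rw [← sub_eq_zero, ← map_sub]
    exact hkill _ (by rw [map_sub, hs, sub_self])
  let δ₀ : R →ₗ[K] (n → O) ⧸ N :=
    { toFun := fun r ↦ D₀ (s r)
      map_add' := fun a b ↦ by
        obtain ⟨a, rfl⟩ := hsurj a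
        obtain ⟨b, rfl⟩ := hsurj b
        change D₀ (s (ev a + ev b)) = D₀ (s (ev a)) + D₀ (s (ev b))
        rw [← map_add, key, key, key, map_add]
      map_smul' := fun c a ↦ by
        obtain ⟨a, rfl⟩ := hsurj a
        change D₀ (s (c • ev a)) = c • D₀ (s (ev a))
        rw [← map_smul, key, key, map_smul] }
  refine ⟨Derivation.mk' δ₀ fun a b ↦ ?_, fun l ↦ ?_⟩
  · obtain ⟨a, rfl⟩ := hsurj a
    obtain ⟨b, rfl⟩ := hsurj b
    change D₀ (s (ev a * ev b)) = ev a • D₀ (s (ev b)) + ev b • D₀ (s (ev a))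
    rw [← map_mul, key, key, key, hmul]
  · change D₀ (s (x l)) = _
    have h1 : x l = ev (X l) := (aeval_X _ _).symm
    rw [h1, key, hD₀]
    congr 1
    ext m
    rw [pderiv_X]
    by_cases h : m = l
    · subst h; simp
    · simp [h]

include hsurj hker in
-- A formally étale `R → O` gives `Ω_{O/K} = O ⊗ Ω_{R/K}`, and an unramified `K → Q` makes `Ω_{O/K}
-- → Ω_{O/Q}` injective. So the usual Jacobian presentation over `K` also computes the differentials
-- relative to `Q`.
lemma exact_jacobian [Algebra.FormallyEtale R O] (Q : Type u) [CommRing Q] [Algebra K Q]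
    [Algebra Q O] [IsScalarTower K Q O] [Algebra.FormallyUnramified K Q] :
    Function.Exact (Matrix.toLin' (jacobianOver x f O).transpose) (differentialsOver x O Q) ∧
      Function.Surjective (differentialsOver x O Q) := by
  constructor
  · intro a
    constructor
    · intro ha
      obtain ⟨δ, hδ⟩ := exists_derivation_jacobian x f O hsurj hker
      let h : Ω[O⁄K] →ₗ[O] _ := (δ.liftKaehlerDifferential.liftBaseChange O).comp
        (tensorKaehlerEquivOfFormallyEtale K R O).symm.toLinearMap
      have hD (r : R) : h (D K O (algebraMap R O r)) = δ r := by
        change LinearMap.liftBaseChange O _ ((tensorKaehlerEquivOfFormallyEtale K R O).symm _) = _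
        rw [tensorKaehlerEquivOfFormallyEtale_symm_D_algebraMap, LinearMap.liftBaseChange_tmul,
          one_smul, Derivation.liftKaehlerDifferential_comp_D]
      -- A relation over `Q` already holds over `K`, since `Ω_{Q/K} = 0`.
      have h0 : ∑ l, a l • D K O (algebraMap R O (x l)) = 0 := by
        have hsub : Subsingleton (O ⊗[Q] Ω[Q⁄K]) := inferInstance
        have hinj : Function.Injective (KaehlerDifferential.map K Q O O) := by
          rw [injective_iff_map_eq_zero]
          intro z hz
          obtain ⟨w, rfl⟩ := (exact_mapBaseChange_map K Q O z).mp hz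
          rw [Subsingleton.elim w 0, map_zero]
        apply hinj
        rw [map_sum, map_zero]
        simp only [map_smul, map_D]
        exact ha
      have h1 := congr(h $h0)
      rw [map_zero, map_sum] at h1
      simp only [map_smul, hD, hδ, ← Submodule.Quotient.mk_smul] at h1
      have h2 : a = ∑ l, a l • Pi.single l (1 : O) := by
        ext l
        simp [Finset.sum_apply, Pi.single_apply]
      rw [Set.mem_range, ← LinearMap.mem_range, ← Submodule.Quotient.mk_eq_zero, h2, ← h1]
      exact map_sum (Submodule.mkQ _) _ _
    · rintro ⟨c, rfl⟩
      have hcol (i : n) : ∑ l, algebraMap R O (aeval x (pderiv l (f i))) •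
          D Q O (algebraMap R O (x l)) = 0 := by
        rw [← map_aeval_eq_sum_pderiv, aeval_relation_eq_zero x f hker, map_zero, map_zero]
      rw [Matrix.toLin'_apply, Matrix.mulVec_transpose]
      simp only [differentialsOver, Fintype.linearCombination_apply, Matrix.vecMul, dotProduct,
        Finset.sum_smul, jacobianOver, Matrix.of_apply]
      rw [Finset.sum_comm]
      simp only [mul_smul, ← Finset.smul_sum, hcol, smul_zero, Finset.sum_const_zero]
  · rw [← LinearMap.range_eq_top, eq_top_iff]
    have h1 (r : R) : D Q O (algebraMap R O r) ∈ LinearMap.range (differentialsOver x O Q) := by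
      obtain ⟨p, rfl⟩ := hsurj r
      rw [map_aeval_eq_sum_pderiv]
      exact ⟨fun l ↦ algebraMap R O (aeval x (pderiv l p)), by simp [differentialsOver,
        Fintype.linearCombination_apply]⟩
    have h2 (o : O) : D Q O o ∈ LinearMap.range (differentialsOver x O Q) := by
      have h3 : KaehlerDifferential.map K Q O O (D K O o) = D Q O o := map_D _ _ _ _ _
      rw [← h3]
      obtain ⟨z, hz⟩ := (tensorKaehlerEquivOfFormallyEtale K R O).surjective (D K O o)
      rw [← hz]
      clear hz
      induction z using TensorProduct.induction_on with
      | zero => simp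
      | add a b ha hb => rw [map_add, map_add]; exact add_mem ha hb
      | tmul c w =>
        rw [tensorKaehlerEquivOfFormallyEtale_apply, mapBaseChange_tmul, map_smul]
        refine Submodule.smul_mem _ _ ?_
        have hw : w ∈ Submodule.span R (Set.range (D K R)) := by
          rw [span_range_derivation]; trivial
        induction hw using Submodule.span_induction with
        | mem w hw =>
          obtain ⟨r, rfl⟩ := hw
          rw [map_D, map_D]
          exact h1 r
        | zero => simp
        | add a b _ _ ha hb => rw [map_add, map_add]; exact add_mem ha hb
        | smul r a _ ha =>
          rw [map_smul]
          have : KaehlerDifferential.map K Q O O (r • KaehlerDifferential.map K K R O a) =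
              algebraMap R O r • KaehlerDifferential.map K Q O O (KaehlerDifferential.map K K R O a) := by
            rw [← algebraMap_smul O r (KaehlerDifferential.map K K R O a), map_smul]
          rw [this]
          exact Submodule.smul_mem _ _ ha
    rw [← span_range_derivation, Submodule.span_le]
    rintro _ ⟨o, rfl⟩
    exact h2 o

include hsurj hker in
-- Without differentials the transposed Jacobian matrix is surjective, and a surjective square
-- matrix is invertible.
lemma isUnit_det_jacobianOver [Algebra.FormallyEtale R O] [Subsingleton Ω[O⁄K]] :
    IsUnit (jacobianOver x f O).det := by
  obtain ⟨hex, -⟩ := exact_jacobian x f O hsurj hker K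
  have hs : Function.Surjective (Matrix.toLin' (jacobianOver x f O).transpose) := fun a ↦
    (hex a).mp (Subsingleton.elim _ _)
  rw [← Matrix.det_transpose, ← Matrix.isUnit_iff_isUnit_det]
  exact Matrix.mulVec_surjective_iff_isUnit.mp hs

end Jacobian

/-! ### Independence of the divisor from the resolution -/

section DivisorEquation

/-- Schanuel's argument: `f ⊕ id` and `id ⊕ f'`, each followed by a shear, both have as image the
kernel of `(v, w) ↦ g v + g' w`. One inclusion of images is enough to factor the second map through
the first, and the shears have unit determinant. -/
lemma IsDivisorEquation.dvd {R M : Type*} [CommRing R] [AddCommGroup M] [Module R M] {d d' : R}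
    (h : IsDivisorEquation R M d) (h' : IsDivisorEquation R M d') : d ∣ d' := by
  obtain ⟨n, f, g, hf, hfg, hg, rfl⟩ := h
  obtain ⟨n', f', g', hf', hfg', hg', rfl⟩ := h'
  obtain ⟨a, ha⟩ := Module.projective_lifting_property g g' hg
  obtain ⟨b, hb⟩ := Module.projective_lifting_property g' g hg'
  replace ha (v) : g (a v) = g' v := congr($ha v)
  replace hb (v) : g' (b v) = g v := congr($hb v)
  let V := (Fin n → R) × (Fin n' → R)
  let e₁ : V ≃ₗ[R] V :=
    { toFun := fun v ↦ (v.1 - a v.2, v.2)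
      map_add' := fun v w ↦ Prod.ext (by simp [V, add_sub_add_comm]) rfl
      map_smul' := fun c v ↦ Prod.ext (by simp [V, smul_sub]) rfl
      invFun := fun v ↦ (v.1 + a v.2, v.2)
      left_inv := fun v ↦ Prod.ext (sub_add_cancel _ _) rfl
      right_inv := fun v ↦ Prod.ext (add_sub_cancel_right _ _) rfl }
  let e₂ : V ≃ₗ[R] V :=
    { toFun := fun v ↦ (v.1, v.2 - b v.1)
      map_add' := fun v w ↦ Prod.ext rfl (by simp [V, add_sub_add_comm])
      map_smul' := fun c v ↦ Prod.ext rfl (by simp [V, smul_sub])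
      invFun := fun v ↦ (v.1, v.2 + b v.1)
      left_inv := fun v ↦ Prod.ext rfl (sub_add_cancel _ _)
      right_inv := fun v ↦ Prod.ext rfl (add_sub_cancel_right _ _) }
  let F₁ : V →ₗ[R] V := e₁.toLinearMap ∘ₗ LinearMap.prodMap f LinearMap.id
  let F₂ : V →ₗ[R] V := e₂.toLinearMap ∘ₗ LinearMap.prodMap LinearMap.id f'
  have hF₁ (v : V) : F₁ v = (f v.1 - a v.2, v.2) := rfl
  have hF₂ (v : V) : F₂ v = (v.1, f' v.2 - b v.1) := rfl
  have hrange : LinearMap.range F₂ ≤ LinearMap.range F₁ := by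
    rintro _ ⟨⟨v, w⟩, rfl⟩
    rw [hF₂]
    have h1 : g (v + a (f' w - b v)) = 0 := by
      have h2 : g' (f' w) = 0 := hfg'.apply_apply_eq_zero w
      rw [map_add, ha, map_sub, hb, h2]
      abel
    obtain ⟨z, hz⟩ := (hfg _).mp h1
    refine ⟨(z, f' w - b v), ?_⟩
    rw [hF₁]
    simp [hz]
  obtain ⟨T, hT⟩ := Module.projective_lifting_property (F₁.rangeRestrict)
    (F₂.codRestrict (LinearMap.range F₁) fun v ↦ hrange ⟨v, rfl⟩) F₁.surjective_rangeRestrict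
  have hT' : F₁ ∘ₗ T = F₂ := by
    exact LinearMap.ext fun v ↦ congr(($hT v : V))
  have h1 : LinearMap.det F₂ = LinearMap.det F₁ * LinearMap.det T := by
    rw [← hT', LinearMap.det_comp]
  rw [LinearMap.det_comp, LinearMap.det_comp, LinearMap.det_prodMap, LinearMap.det_prodMap,
    LinearMap.det_id, LinearMap.det_id, one_mul, mul_one] at h1
  have h2 : IsUnit (LinearMap.det e₂.toLinearMap) := e₂.isUnit_det'
  obtain ⟨t, ht⟩ := h2.exists_left_inv
  refine ⟨t * LinearMap.det e₁.toLinearMap * LinearMap.det T, ?_⟩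
  calc LinearMap.det f' = t * (LinearMap.det e₂.toLinearMap * LinearMap.det f') := by
        rw [← mul_assoc, ht, one_mul]
    _ = _ := by rw [h1]; ring

end DivisorEquation
end NewtonGroupoid

/-! ### The Jacobian determinant, étaleness and the divisor of the differentials -/

namespace NewtonGroupoid

open MvPolynomial
open scoped nonZeroDivisors

lemma etale_away_of_algEquiv {K A R : Type u} [CommRing K] [CommRing A] [CommRing R] [Algebra K A]
    [Algebra K R] (e : A ≃ₐ[K] R) {δ : A} {d : R} (hδ : e δ = d)
    (h : Algebra.Etale K (Localization.Away δ)) (L : Type u) [CommRing L] [Algebra R L]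
    [IsLocalization.Away d L] [Algebra K L] [IsScalarTower K R L] : Algebra.Etale K L := by
  let : Algebra A L := ((algebraMap R L).comp e.toRingHom).toAlgebra
  have : IsLocalization.Away δ L := by
    have h2 := IsLocalization.isLocalization_of_base_ringEquiv (Submonoid.powers d) L
      e.symm.toRingEquiv
    have h3 : (Submonoid.powers d).map e.symm.toRingEquiv = Submonoid.powers δ := by
      rw [Submonoid.map_powers]
      congr 1
      rw [← hδ]
      exact e.symm_apply_apply δ
    rw [h3] at h2
    exact h2
  have : IsScalarTower K A L := .of_algebraMap_eq fun c ↦ by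
    change algebraMap K L c = algebraMap R L (e (algebraMap K _ c))
    rw [e.commutes, ← IsScalarTower.algebraMap_apply]
  exact Algebra.Etale.of_equiv ((IsLocalization.algEquiv (Submonoid.powers δ)
    (Localization.Away δ) L).restrictScalars K)

namespace SquarePresentation

variable {k R : Type u} {ι n : Type} [CommRing k] [CommRing R] [Algebra k R] [Fintype n]
  [DecidableEq n] (P : SquarePresentation k R ι n)

lemma etale_away (L : Type u) [CommRing L] [Algebra R L] [IsLocalization.Away P.det L] :
    ((algebraMap R L).comp P.coeffHom).Etale := by
  let K := MvPolynomial ι k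
  let I := Ideal.span (Set.range P.f)
  let δ := Ideal.Quotient.mk I (Matrix.of fun l m ↦ pderiv m (P.f l)).det
  have hét : Algebra.Etale K (Localization.Away δ) := etale_away_jacobian P.f
  let : Algebra K R := P.coeffHom.toAlgebra
  let : Algebra K L := ((algebraMap R L).comp P.coeffHom).toAlgebra
  have : IsScalarTower K R L := .of_algebraMap_eq fun _ ↦ rfl
  let e₀ : (MvPolynomial n K ⧸ I) ≃+* R :=
    (Ideal.quotEquivOfEq P.ker_eq.symm).trans (RingHom.quotientKerEquivOfSurjective P.surjective)
  have he₀ (p) : e₀ (Ideal.Quotient.mk I p) = P.evalHom p := rfl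
  let e : (MvPolynomial n K ⧸ I) ≃ₐ[K] R :=
    { e₀ with
      commutes' := fun c ↦ (he₀ (C c)).trans (eval₂_C _ _ _) }
  have hδ : e δ = P.det := (he₀ _).trans (RingHom.map_det P.evalHom _)
  exact etale_away_of_algEquiv e hδ hét L

omit [Fintype n] [DecidableEq n] in
lemma aeval_surjective_and_ker [Algebra (MvPolynomial ι k) R]
    (h : algebraMap (MvPolynomial ι k) R = P.coeffHom) :
    Function.Surjective (aeval P.x : MvPolynomial n (MvPolynomial ι k) →ₐ[_] R) ∧
      RingHom.ker (aeval P.x : MvPolynomial n (MvPolynomial ι k) →ₐ[MvPolynomial ι k] R) =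
        Ideal.span (Set.range P.f) ∧ ∀ p, aeval P.x p = P.evalHom p := by
  have h1 (p : MvPolynomial n (MvPolynomial ι k)) : aeval P.x p = P.evalHom p := by
    rw [aeval_def, h]
    rfl
  refine ⟨fun r ↦ ?_, ?_, h1⟩
  · obtain ⟨p, rfl⟩ := P.surjective r
    exact ⟨p, h1 p⟩
  · rw [← P.ker_eq]
    ext p
    rw [RingHom.mem_ker, RingHom.mem_ker]
    exact (h1 p).congr_left

lemma det_jacobianOver [Algebra (MvPolynomial ι k) R]
    (h : algebraMap (MvPolynomial ι k) R = P.coeffHom) (O : Type u) [CommRing O] [Algebra R O] :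
    (jacobianOver P.x P.f O).det = algebraMap R O P.det := by
  rw [det, RingHom.map_det]
  congr 1
  ext i l
  exact congrArg (algebraMap R O) ((P.aeval_surjective_and_ker h).2.2 _)

lemma isUnit_det_of_formallyUnramified {O : Type u} [CommRing O] (g : R →+* O)
    (hg : g.FormallyEtale) (h : (g.comp P.coeffHom).FormallyUnramified) : IsUnit (g P.det) := by
  let : Algebra (MvPolynomial ι k) R := P.coeffHom.toAlgebra
  let : Algebra R O := g.toAlgebra
  let : Algebra (MvPolynomial ι k) O := (g.comp P.coeffHom).toAlgebra
  have : IsScalarTower (MvPolynomial ι k) R O := .of_algebraMap_eq fun _ ↦ rfl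
  have : Algebra.FormallyEtale R O := hg
  have : Algebra.FormallyUnramified (MvPolynomial ι k) O := h
  obtain ⟨hs, hk, -⟩ := P.aeval_surjective_and_ker rfl
  have := isUnit_det_jacobianOver P.x P.f O hs hk
  rwa [P.det_jacobianOver rfl] at this

end SquarePresentation

/-- The Jacobian sequence is a resolution of the required kind as soon as its first map is
injective. The adjugate shows this, since the determinant is a nonzerodivisor. -/
lemma SquarePresentation.isDivisorEquation {k R : Type u} {ι : Type} {N : ℕ} [CommRing k]
    [CommRing R] [Algebra k R] (P : SquarePresentation k R ι (Fin N)) {O Q : Type u} [CommRing O]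
    [CommRing Q] (g : R →+* O) (hg : g.FormallyEtale) (s : MvPolynomial ι k →+* Q)
    (hs : s.FormallyUnramified) [Algebra Q O] (ht : (algebraMap Q O).comp s = g.comp P.coeffHom)
    (hd : g P.det ∈ O⁰) : IsDivisorEquation O (Ω[O⁄Q]) (g P.det) := by
  let : Algebra (MvPolynomial ι k) R := P.coeffHom.toAlgebra
  let : Algebra R O := g.toAlgebra
  let : Algebra (MvPolynomial ι k) O := (g.comp P.coeffHom).toAlgebra
  let : Algebra (MvPolynomial ι k) Q := s.toAlgebra
  have : IsScalarTower (MvPolynomial ι k) R O := .of_algebraMap_eq fun _ ↦ rfl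
  have : IsScalarTower (MvPolynomial ι k) Q O := .of_algebraMap_eq' ht.symm
  have : Algebra.FormallyEtale R O := hg
  have : Algebra.FormallyUnramified (MvPolynomial ι k) Q := hs
  obtain ⟨hsurj, hk, -⟩ := P.aeval_surjective_and_ker rfl
  obtain ⟨hex, hsurj'⟩ := exact_jacobian P.x P.f O hsurj hk Q
  have hdet : (jacobianOver P.x P.f O).transpose.det = g P.det := by
    rw [Matrix.det_transpose]
    exact P.det_jacobianOver rfl O
  refine ⟨N, _, _, ?_, hex, hsurj', ?_⟩
  · rw [injective_iff_map_eq_zero]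
    intro v hv
    rw [Matrix.toLin'_apply] at hv
    have h1 := congr((jacobianOver P.x P.f O).transpose.adjugate.mulVec $hv)
    rw [Matrix.mulVec_mulVec, Matrix.adjugate_mul, Matrix.smul_mulVec, Matrix.one_mulVec,
      Matrix.mulVec_zero, hdet] at h1
    ext i
    refine (mem_nonZeroDivisors_iff_right.mp hd) _ ?_
    rw [mul_comm]
    exact congr($h1 i)
  · rw [LinearMap.det_toLin', hdet]

end NewtonGroupoid

/-! ### Principal localizations of complete intersections -/

namespace NewtonGroupoid

section LocalizedPresentation

open Polynomial RingTheory.Sequence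

/-- If `(hX - 1) F` has coefficients in `I`, then the lowest coefficient of `F` is in `I`, and each
further one is congruent modulo `I` to `h` times its predecessor. -/
lemma isSMulRegular_C_mul_X_sub_one {B : Type*} [CommRing B] (I : Ideal B) (h : B) :
    IsSMulRegular (B[X] ⧸ (I.map C) • (⊤ : Submodule B[X] B[X])) (C h * X - 1) := by
  rw [isSMulRegular_iff_right_eq_zero_of_smul]
  intro m hm
  obtain ⟨F, rfl⟩ := Submodule.Quotient.mk_surjective _ m
  rw [← Submodule.Quotient.mk_smul, Submodule.Quotient.mk_eq_zero] at hm
  rw [Submodule.Quotient.mk_eq_zero]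
  rw [smul_eq_mul, Ideal.mul_top] at hm ⊢
  rw [Ideal.mem_map_C_iff] at hm ⊢
  intro n
  induction n with
  | zero =>
    have := hm 0
    simp only [smul_eq_mul, sub_mul, mul_assoc, one_mul, coeff_sub, coeff_C_mul,
      coeff_X_mul_zero, mul_zero, zero_sub, neg_mem_iff] at this
    exact this
  | succ n ih =>
    have := hm (n + 1)
    simp only [smul_eq_mul, sub_mul, mul_assoc, one_mul, coeff_sub, coeff_C_mul,
      coeff_X_mul] at this
    simpa using sub_mem (I.mul_mem_left h ih) this

lemma isWeaklyRegular_map_C_append {B : Type*} [CommRing B] {gs : List B}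
    (hgs : IsWeaklyRegular B gs) (h : B) :
    IsWeaklyRegular B[X] (gs.map C ++ [C h * X - 1]) := by
  rw [isWeaklyRegular_append_iff, isWeaklyRegular_singleton_iff]
  refine ⟨hgs.of_flat (S := B[X]), ?_⟩
  have : Ideal.ofList (gs.map C) = (Ideal.ofList gs).map (C : B →+* B[X]) :=
    (Ideal.map_ofList _ _).symm
  rw [this]
  exact isSMulRegular_C_mul_X_sub_one _ h

/-- Rabinowitsch's trick: inverting `h` costs one variable and the one equation `hX - 1`. -/
lemma exists_polynomial_presentation {B R₀ R : Type*} [CommRing B] [CommRing R₀] [CommRing R]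
    (π : B →+* R₀) (hπ : Function.Surjective π) (h : B) [Algebra R₀ R]
    [IsLocalization.Away (π h) R] :
    ∃ π' : B[X] →+* R, Function.Surjective π' ∧ π'.comp C = (algebraMap R₀ R).comp π ∧
      RingHom.ker π' = (RingHom.ker π).map C ⊔ Ideal.span {C h * X - 1} := by
  let e : AdjoinRoot (C (π h) * X - 1) ≃ₐ[R₀] R :=
    (Localization.awayEquivAdjoin (π h)).symm.trans
      (IsLocalization.algEquiv (Submonoid.powers (π h)) _ _)
  refine ⟨((e : AdjoinRoot (C (π h) * X - 1) →+* R).comp (AdjoinRoot.mk _)).comp (mapRingHom π),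
    ?_, ?_, ?_⟩
  · exact (e.surjective.comp AdjoinRoot.mk_surjective).comp (map_surjective π hπ)
  · ext b
    simp only [RingHom.comp_apply, coe_mapRingHom, map_C]
    exact e.commutes (π b)
  · have h1 : RingHom.ker (((e : AdjoinRoot (C (π h) * X - 1) →+* R).comp
        (AdjoinRoot.mk (C (π h) * X - 1))).comp (mapRingHom π)) =
        Ideal.comap (mapRingHom π) (Ideal.span {C (π h) * X - 1}) := by
      ext F
      rw [RingHom.mem_ker, Ideal.mem_comap, RingHom.comp_apply, RingHom.comp_apply]
      rw [Ideal.mem_span_singleton, ← AdjoinRoot.mk_eq_zero]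
      exact e.map_eq_zero_iff
    have h2 : Ideal.span {C (π h) * X - 1} = Ideal.map (mapRingHom π)
        (Ideal.span {C h * X - 1}) := by
      rw [Ideal.map_span, Set.image_singleton]
      simp
    rw [h1, h2, Ideal.comap_map_of_surjective _ (map_surjective π hπ), sup_comm]
    congr 1
    rw [← ker_mapRingHom]
    rfl

lemma isWeaklyRegular_map_ringEquiv {A B : Type*} [CommRing A] [CommRing B] (e : A ≃+* B)
    {gs : List A} (hgs : IsWeaklyRegular A gs) : IsWeaklyRegular B (gs.map e) := by
  refine (AddEquiv.isWeaklyRegular_congr (e := e.toAddEquiv)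
    (List.forall₂_map_right_iff.mpr <| List.forall₂_same.mpr fun r _ x ↦ ?_)).mp hgs
  simp

lemma comap_ofList_ringEquiv {A B : Type*} [CommRing A] [CommRing B] (e : A ≃+* B)
    (gs : List B) : (Ideal.ofList gs).comap (e : A →+* B) = Ideal.ofList (gs.map e.symm) := by
  have := (Ideal.map_ofList (e.symm : B →+* A) gs)
  refine Eq.trans ?_ this
  exact (Ideal.map_symm e).symm

lemma exists_equiv_polynomial (k : Type*) [Field k] (n : ℕ) :
    ∃ e : MvPolynomial (Fin (n + 1)) k ≃+* (MvPolynomial (Fin n) k)[X],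
      (e : MvPolynomial (Fin (n + 1)) k →+* (MvPolynomial (Fin n) k)[X]).comp MvPolynomial.C =
        (C : MvPolynomial (Fin n) k →+* _).comp MvPolynomial.C :=
  ⟨(MvPolynomial.finSuccEquiv k n).toRingEquiv,
    RingHom.ext fun c ↦ (MvPolynomial.finSuccEquiv k n).commutes c⟩

/-- A principal localization of a global complete intersection is one. -/
lemma exists_localized_presentation {k R₀ R : Type*} [Field k] [CommRing R₀] [CommRing R]
    {n : ℕ} {gs : List (MvPolynomial (Fin n) k)}
    (hgs : IsWeaklyRegular (MvPolynomial (Fin n) k) gs)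
    (π : MvPolynomial (Fin n) k →+* R₀) (hπ : Function.Surjective π)
    (hker : RingHom.ker π = Ideal.ofList gs) (h : R₀) [Algebra R₀ R] [IsLocalization.Away h R] :
    ∃ (gs' : List (MvPolynomial (Fin (n + 1)) k)) (π' : MvPolynomial (Fin (n + 1)) k →+* R),
      IsWeaklyRegular (MvPolynomial (Fin (n + 1)) k) gs' ∧ Function.Surjective π' ∧
      RingHom.ker π' = Ideal.ofList gs' ∧
      π'.comp MvPolynomial.C = (algebraMap R₀ R).comp (π.comp MvPolynomial.C) := by
  obtain ⟨h, rfl⟩ := hπ h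
  obtain ⟨π', h1, h2, h3⟩ := exists_polynomial_presentation (R := R) π hπ h
  obtain ⟨e, he⟩ := exists_equiv_polynomial k n
  have h4 : (RingHom.ker π).map C ⊔ Ideal.span {C h * X - 1} =
      Ideal.ofList (gs.map C ++ [C h * X - 1]) := by
    rw [Ideal.ofList_append, Ideal.ofList_singleton, ← Ideal.map_ofList, hker]
  refine ⟨(gs.map C ++ [C h * X - 1]).map e.symm, π'.comp (e : _ →+* _),
    isWeaklyRegular_map_ringEquiv e.symm (isWeaklyRegular_map_C_append hgs h),
    h1.comp e.surjective, ?_, ?_⟩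
  · rw [← RingHom.comap_ker, h3, h4, comap_ofList_ringEquiv]
  · rw [← RingHom.comp_assoc, ← h2, RingHom.comp_assoc, he, RingHom.comp_assoc]

end LocalizedPresentation

end NewtonGroupoid

/-! ### Generic points, the étale locus and affine complete intersection neighbourhoods -/

namespace NewtonGroupoid

/-- There are finitely many other minimal primes, and off their closures every point is a
specialization of `x`. The dense open meets this neighbourhood of `x`, and opens are stable under
generization. -/
lemma mem_of_mem_minimalPrimes_of_dense {R : Type*} [CommRing R] [IsNoetherianRing R]
    {O : Set (PrimeSpectrum R)} (hO : IsOpen O) (hd : Dense O) (x : PrimeSpectrum R)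
    (hx : x.asIdeal ∈ minimalPrimes R) : x ∈ O := by
  have hfin : (minimalPrimes R \ {x.asIdeal}).Finite :=
    (minimalPrimes.finite_of_isNoetherianRing R).subset Set.sdiff_subset
  have hcl : IsClosed (⋃ p ∈ minimalPrimes R \ {x.asIdeal},
      PrimeSpectrum.zeroLocus (p : Set R)) :=
    hfin.isClosed_biUnion fun p _ ↦ PrimeSpectrum.isClosed_zeroLocus _
  have hxm : x ∈ (⋃ p ∈ minimalPrimes R \ {x.asIdeal},
      PrimeSpectrum.zeroLocus (p : Set R))ᶜ := by
    simp only [Set.mem_compl_iff, Set.mem_iUnion, not_exists]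
    intro p hp hxp
    exact hp.2 (le_antisymm hxp (hx.2 ⟨hp.1.1.1, bot_le⟩ hxp))
  obtain ⟨y, hy, hyO⟩ := hd.inter_open_nonempty _ hcl.isOpen_compl ⟨x, hxm⟩
  obtain ⟨p, hp, hpy⟩ := Ideal.exists_minimalPrimes_le (I := (⊥ : Ideal R)) (J := y.asIdeal) bot_le
  have hpx : p = x.asIdeal := by
    by_contra h
    exact hy (Set.mem_biUnion (show p ∈ minimalPrimes R \ {x.asIdeal} from ⟨hp, h⟩) hpy)
  have : x ⤳ y := (PrimeSpectrum.le_iff_specializes x y).mp (hpx ▸ hpy : x.asIdeal ≤ y.asIdeal)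
  exact this.mem_open hO hyO

lemma formallyEtale_atPrime {K R L : Type u} [CommRing K] [CommRing R] [CommRing L] (c : K →+* R)
    [Algebra R L] (f : R) [IsLocalization.Away f L] (h : ((algebraMap R L).comp c).Etale)
    (q : Ideal R) [q.IsPrime] (hf : f ∉ q) :
    ((algebraMap R (Localization.AtPrime q)).comp c).FormallyEtale := by
  let ψ : L →+* Localization.AtPrime q := IsLocalization.Away.lift f
    (g := algebraMap R (Localization.AtPrime q))
    (IsLocalization.map_units _ (⟨f, hf⟩ : q.primeCompl))
  have hψ : ψ.comp (algebraMap R L) = algebraMap R (Localization.AtPrime q) :=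
    IsLocalization.Away.lift_comp ..
  have hψ' : ψ.FormallyEtale := by
    algebraize [ψ]
    have : IsScalarTower R L (Localization.AtPrime q) := .of_algebraMap_eq' hψ.symm
    have : Algebra.FormallyEtale R L := .of_isLocalization (.powers f)
    have : Algebra.FormallyEtale R (Localization.AtPrime q) := .of_isLocalization q.primeCompl
    exact Algebra.FormallyEtale.of_restrictScalars (R := R)
  rw [← hψ, RingHom.comp_assoc]
  exact RingHom.FormallyEtale.comp h.formallyEtale hψ'

section EtaleLocus

variable {X Y : Scheme.{u}} (φ : X ⟶ Y)

instance isZariskiLocalAtSource_etale : IsZariskiLocalAtSource @Etale.{u} :=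
  HasRingHomProperty.instIsZariskiLocalAtSource (P := @Etale.{u})

lemma etale_etaleLocus_ι_comp : Etale ((etaleLocus φ).ι ≫ φ) := by
  refine IsZariskiLocalAtSource.of_iSup_eq_top (P := @Etale.{u})
    (fun V : {V : X.Opens | Etale (V.ι ≫ φ)} ↦ (etaleLocus φ).ι ⁻¹ᵁ V.1) ?_ ?_
  · rw [eq_top_iff]
    intro x _
    obtain ⟨V, hV, hx⟩ := TopologicalSpace.Opens.mem_sSup.mp x.2
    exact TopologicalSpace.Opens.mem_iSup.mpr ⟨⟨V, hV⟩, hx⟩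
  · intro V
    have hV : Etale (V.1.ι ≫ φ) := V.2
    let i := ((etaleLocus φ).ι ⁻¹ᵁ V.1).ι ≫ (etaleLocus φ).ι
    have hi : Set.range i ⊆ Set.range V.1.ι := by
      rintro _ ⟨x, rfl⟩
      rw [Scheme.Opens.range_ι]
      exact x.2
    have : ((etaleLocus φ).ι ⁻¹ᵁ V.1).ι ≫ (etaleLocus φ).ι ≫ φ =
        IsOpenImmersion.lift V.1.ι i hi ≫ V.1.ι ≫ φ := by
      rw [IsOpenImmersion.lift_fac_assoc, Category.assoc]
    rw [this]
    have : IsOpenImmersion i := inferInstance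
    have : IsOpenImmersion (IsOpenImmersion.lift V.1.ι i hi ≫ V.1.ι) := by
      rw [IsOpenImmersion.lift_fac]; exact this
    have : IsOpenImmersion (IsOpenImmersion.lift V.1.ι i hi) := IsOpenImmersion.of_comp _ V.1.ι
    infer_instance

lemma le_etaleLocus_iff {V : X.Opens} : V ≤ etaleLocus φ ↔ Etale (V.ι ≫ φ) := by
  refine ⟨fun h ↦ ?_, fun h ↦ le_sSup h⟩
  have := etale_etaleLocus_ι_comp φ
  rw [← X.homOfLE_ι h, Category.assoc]
  infer_instance

lemma le_etaleLocus_iff_appLE {V : X.Opens} (hV : IsAffineOpen V) {O : Y.Opens}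
    (hO : IsAffineOpen O) (e : V ≤ φ ⁻¹ᵁ O) :
    V ≤ etaleLocus φ ↔ (φ.appLE O V e).hom.Etale := by
  rw [le_etaleLocus_iff]
  have h1 : Spec.map (φ.appLE O V e) ≫ hO.fromSpec = hV.isoSpec.inv ≫ V.ι ≫ φ := by
    rw [IsAffineOpen.SpecMap_appLE_fromSpec φ hO hV e, IsAffineOpen.fromSpec, Category.assoc]
  rw [← HasRingHomProperty.Spec_iff (P := @Etale)]
  constructor
  · intro h
    have : Etale (Spec.map (φ.appLE O V e) ≫ hO.fromSpec) := by rw [h1]; infer_instance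
    exact Etale.of_comp _ hO.fromSpec
  · intro h
    have : Etale (hV.isoSpec.inv ≫ V.ι ≫ φ) := by rw [← h1]; infer_instance
    have h2 : V.ι ≫ φ = hV.isoSpec.hom ≫ hV.isoSpec.inv ≫ V.ι ≫ φ := by simp
    rw [h2]
    infer_instance

end EtaleLocus

section Charts

/-- The given neighbourhoods are arbitrary opens and need not lie in `O`. They are shrunk to a
principal open subset, on which Rabinowitsch's trick restores the presentation. -/
lemma exists_lci_chart {k : Type u} [Field k] {X : Scheme.{u}} (p : X ⟶ Spec (.of k))
    (hX : IsLocallyCompleteIntersection p) (x : X) (O : X.Opens) (hx : x ∈ O) :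
    ∃ (V : X.Opens) (hV : IsAffineOpen V), x ∈ V ∧ V ≤ O ∧ ∃ (N : ℕ) (gs : List (MvPolynomial (Fin N) k))
      (π : MvPolynomial (Fin N) k →+* Γ(X, V)),
      RingTheory.Sequence.IsWeaklyRegular (MvPolynomial (Fin N) k) gs ∧ Function.Surjective π ∧
      RingHom.ker π = Ideal.ofList gs ∧
      hV.fromSpec ≫ p = Spec.map (CommRingCat.ofHom (π.comp MvPolynomial.C)) := by
  obtain ⟨V', hxV', n, gs, hgs, e, he⟩ := hX x
  let R₀ := MvPolynomial (Fin n) k ⧸ Ideal.ofList gs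
  let j : Spec (.of R₀) ⟶ X := e.inv ≫ V'.ι
  have hj : j ≫ p = Spec.map (CommRingCat.ofHom (algebraMap k R₀)) := by
    rw [Category.assoc, ← he, Iso.inv_hom_id_assoc]
  obtain ⟨x₀, hx₀⟩ : ∃ x₀, j x₀ = x :=
    ⟨e.hom ⟨x, hxV'⟩, congr($(e.hom_inv_id_assoc V'.ι) ⟨x, hxV'⟩)⟩
  obtain ⟨_, ⟨h, rfl⟩, hx₁, hle⟩ :=
    PrimeSpectrum.isTopologicalBasis_basic_opens.exists_subset_of_mem_open
      (show x₀ ∈ (j ⁻¹ᵁ O : Set (Spec (.of R₀))) by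
        change j x₀ ∈ O
        rwa [hx₀]) (j ⁻¹ᵁ O).isOpen
  let R := Localization.Away h
  let l : Spec (.of R) ⟶ Spec (.of R₀) := Spec.map (CommRingCat.ofHom (algebraMap R₀ R))
  have hopen : IsOpenImmersion l := IsOpenImmersion.of_isLocalization h
  have hrange : Set.range l = (PrimeSpectrum.basicOpen h : Set (PrimeSpectrum R₀)) :=
    PrimeSpectrum.localization_away_comap_range R h
  let j' : Spec (.of R) ⟶ X := l ≫ j
  have hj' : j' ≫ p = Spec.map (CommRingCat.ofHom ((algebraMap R₀ R).comp (algebraMap k R₀))) := by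
    rw [Category.assoc, hj, ← Spec.map_comp, ← CommRingCat.ofHom_comp]
  obtain ⟨V, hV, hVj⟩ : ∃ (V : X.Opens) (_ : IsAffineOpen V), V = j'.opensRange :=
    ⟨_, isAffineOpen_opensRange j', rfl⟩
  have hr : Set.range hV.fromSpec = Set.range j' := by
    rw [IsAffineOpen.range_fromSpec, hVj]; rfl
  obtain ⟨i, hi⟩ : ∃ i : Spec Γ(X, V) ≅ Spec (.of R), i.hom ≫ j' = hV.fromSpec :=
    ⟨IsOpenImmersion.isoOfRangeEq hV.fromSpec j' hr,
      IsOpenImmersion.isoOfRangeEq_hom_fac hV.fromSpec j' hr⟩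
  obtain ⟨θ, hθ⟩ := Spec.map_surjective i.hom
  have hθb : Function.Bijective θ.hom := by
    rw [← isIso_SpecMap_iff, hθ]
    infer_instance
  obtain ⟨gs', π', h1, h2, h3, h4⟩ := exists_localized_presentation (R := R) hgs.1
    (Ideal.Quotient.mk (Ideal.ofList gs)) Ideal.Quotient.mk_surjective Ideal.mk_ker h
  refine ⟨V, hV, ?_, ?_, n + 1, gs', θ.hom.comp π', h1, hθb.2.comp h2, ?_, ?_⟩
  · rw [hVj]
    obtain ⟨y, hy⟩ : x₀ ∈ Set.range l := hrange ▸ hx₁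
    exact ⟨y, by rw [← hx₀, ← hy]; rfl⟩
  · rw [hVj]
    rintro _ ⟨y, rfl⟩
    have : l y ∈ (PrimeSpectrum.basicOpen h : Set (PrimeSpectrum R₀)) := hrange ▸ ⟨y, rfl⟩
    exact hle this
  · rw [← h3]
    ext a
    simp [RingHom.mem_ker, hθb.1.eq_iff' (map_zero θ.hom)]
  · rw [← hi, Category.assoc, hj', ← hθ, ← Spec.map_comp]
    congr 1
    refine CommRingCat.hom_ext ?_
    simp only [CommRingCat.hom_comp, CommRingCat.hom_ofHom]
    rw [RingHom.comp_assoc, h4]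
    rfl

end Charts

end NewtonGroupoid

/-! ### Existence of charts -/

namespace NewtonGroupoid

/-- An affine open of `X` with a square presentation over étale coordinates of an affine open of
the smooth scheme `Y`. -/
structure Chart {k : Type u} [Field k] {X Y : Scheme.{u}} (φ : X ⟶ Y) (q : Y ⟶ Spec (.of k)) where
  V : X.Opens
  hV : IsAffineOpen V
  O : Y.Opens
  hO : IsAffineOpen O
  le : V ≤ φ ⁻¹ᵁ O
  [algebra : Algebra k Γ(X, V)]
  fromSpec_comp : hV.fromSpec ≫ φ ≫ q = Spec.map (CommRingCat.ofHom (algebraMap k Γ(X, V)))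
  N : ℕ
  ε : ℕ
  P : SquarePresentation k Γ(X, V) (Fin ε) (Fin N)
  s : MvPolynomial (Fin ε) k →+* Γ(Y, O)
  s_etale : s.Etale
  appLE_comp_s : (φ.appLE O V le).hom.comp s = P.coeffHom
  det_mem : P.det ∈ nonZeroDivisors Γ(X, V)
  basicOpen_det : X.basicOpen P.det = etaleLocus φ ⊓ V

attribute [instance] Chart.algebra

lemma formallyUnramified_of_formallyEtale {R S : Type*} [CommRing R] [CommRing S] {f : R →+* S}
    (h : f.FormallyEtale) : f.FormallyUnramified := by
  algebraize [f]
  exact (inferInstance : Algebra.FormallyUnramified R S)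

lemma exists_etale_coordinates {k : Type u} [Field k] {Y : Scheme.{u}} (q : Y ⟶ Spec (.of k))
    [Smooth q] (y : Y) :
    ∃ (O : Y.Opens) (hO : IsAffineOpen O), y ∈ O ∧ ∃ (ε : ℕ)
      (s : MvPolynomial (Fin ε) k →+* Γ(Y, O)), s.Etale ∧
      hO.fromSpec ≫ q = Spec.map (CommRingCat.ofHom (s.comp MvPolynomial.C)) := by
  obtain ⟨U, hU, O, hO, hy, e, h⟩ := Smooth.exists_isStandardSmooth q y
  obtain rfl : U = ⊤ := by
    rw [eq_top_iff]
    intro z _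
    have : z = q y := Subsingleton.elim (α := PrimeSpectrum k) _ _
    rw [this]
    exact e hy
  obtain ⟨ε, g, hgC, hg⟩ := h.exists_etale_mvPolynomial
  let ρ := Scheme.ΓSpecIso (.of k)
  have hρ : Function.Bijective ρ.inv.hom := ConcreteCategory.bijective_of_isIso ρ.inv
  refine ⟨O, hO, hy, ε, g.comp (MvPolynomial.map ρ.inv.hom), ?_, ?_⟩
  · refine RingHom.Etale.stableUnderComposition _ _ (RingHom.Etale.of_bijective ?_) hg
    exact ⟨MvPolynomial.map_injective _ hρ.1, MvPolynomial.map_surjective _ hρ.2⟩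
  · have h1 : (g.comp (MvPolynomial.map ρ.inv.hom)).comp MvPolynomial.C =
        (ρ.inv ≫ q.appLE ⊤ O e).hom := by
      rw [CommRingCat.hom_comp, ← hgC]
      ext c
      simp
    rw [h1, CommRingCat.ofHom_hom, Spec.map_comp,
      ← IsAffineOpen.SpecMap_appLE_fromSpec q hU hO e]
    congr 1
    rw [IsAffineOpen.fromSpec_top, Scheme.isoSpec_Spec_inv]

section

variable {X : Scheme.{u}}

lemma exists_mem_basicOpen_le {V : X.Opens} (hV : IsAffineOpen V) (U : X.Opens)
    (z : PrimeSpectrum Γ(X, V)) (hz : hV.fromSpec z ∈ U) :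
    ∃ f : Γ(X, V), f ∉ z.asIdeal ∧ X.basicOpen f ≤ U := by
  have hzV : hV.fromSpec z ∈ V := by
    rw [← SetLike.mem_coe, ← hV.range_fromSpec]
    exact ⟨z, rfl⟩
  obtain ⟨f, hf, hzf⟩ := hV.exists_basicOpen_le (V := U) ⟨_, hz⟩ hzV
  refine ⟨f, ?_, hf⟩
  have : z ∈ hV.fromSpec ⁻¹ᵁ X.basicOpen f := hzf
  rwa [hV.fromSpec_preimage_basicOpen] at this

lemma exists_fromSpec_eq {V : X.Opens} (hV : IsAffineOpen V) {x : X} (hx : x ∈ V) :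
    ∃ z : PrimeSpectrum Γ(X, V), hV.fromSpec z = x := by
  rw [← SetLike.mem_coe, ← hV.range_fromSpec] at hx
  exact hx

lemma fromSpec_mem_basicOpen_iff {V : X.Opens} (hV : IsAffineOpen V) (f : Γ(X, V))
    (z : PrimeSpectrum Γ(X, V)) : hV.fromSpec z ∈ X.basicOpen f ↔ f ∉ z.asIdeal := by
  change z ∈ hV.fromSpec ⁻¹ᵁ X.basicOpen f ↔ _
  rw [hV.fromSpec_preimage_basicOpen]
  rfl

variable {Y : Scheme.{u}} (φ : X ⟶ Y)

lemma formallyEtale_of_mem_etaleLocus {V : X.Opens} (hV : IsAffineOpen V) {O : Y.Opens}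
    (hO : IsAffineOpen O) (le : V ≤ φ ⁻¹ᵁ O) {K : Type u} [CommRing K] (s : K →+* Γ(Y, O))
    (hs : s.Etale) (z : PrimeSpectrum Γ(X, V)) (hz : hV.fromSpec z ∈ etaleLocus φ) :
    ((algebraMap Γ(X, V) (Localization.AtPrime z.asIdeal)).comp
      ((φ.appLE O V le).hom.comp s)).FormallyEtale := by
  obtain ⟨f, hf, hfU⟩ := exists_mem_basicOpen_le hV _ z hz
  have hle : X.basicOpen f ≤ φ ⁻¹ᵁ O := (X.basicOpen_le f).trans le
  rw [le_etaleLocus_iff_appLE φ (hV.basicOpen f) hO hle] at hfU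
  let alg : Algebra Γ(X, V) Γ(X, X.basicOpen f) :=
    (X.presheaf.map (homOfLE (X.basicOpen_le f)).op).hom.toAlgebra
  have hloc : IsLocalization.Away f Γ(X, X.basicOpen f) :=
    hV.isLocalization_of_eq_basicOpen f (homOfLE (X.basicOpen_le f)) rfl
  refine formallyEtale_atPrime _ (L := Γ(X, X.basicOpen f)) f ?_ _ hf
  have : (algebraMap Γ(X, V) Γ(X, X.basicOpen f)).comp ((φ.appLE O V le).hom.comp s) =
      (φ.appLE O _ hle).hom.comp s := by
    rw [← RingHom.comp_assoc, ← φ.appLE_map le (homOfLE (X.basicOpen_le f)).op]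
    rfl
  rw [this]
  exact RingHom.Etale.stableUnderComposition _ _ hs hfU

end

section

variable {k : Type u} [Field k] {X Y : Scheme.{u}} (φ : X ⟶ Y) (q : Y ⟶ Spec (.of k))

/-- As `s` is étale, being étale over `Y` is the same as being étale over affine space, and this is
governed by the Jacobian determinant: étale where it is invertible, and conversely invertible at
each point of the étale locus. -/
lemma basicOpen_det_eq {V : X.Opens} (hV : IsAffineOpen V) {O : Y.Opens}
    (hO : IsAffineOpen O) (le : V ≤ φ ⁻¹ᵁ O) [Algebra k Γ(X, V)] {N ε : ℕ}
    (P : SquarePresentation k Γ(X, V) (Fin ε) (Fin N)) (s : MvPolynomial (Fin ε) k →+* Γ(Y, O))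
    (hs : s.Etale) (h : (φ.appLE O V le).hom.comp s = P.coeffHom) :
    X.basicOpen P.det = etaleLocus φ ⊓ V := by
  apply le_antisymm
  · refine le_inf ?_ (X.basicOpen_le _)
    have hle : X.basicOpen P.det ≤ φ ⁻¹ᵁ O := (X.basicOpen_le _).trans le
    rw [le_etaleLocus_iff_appLE φ (hV.basicOpen _) hO hle]
    let alg : Algebra Γ(X, V) Γ(X, X.basicOpen P.det) :=
      (X.presheaf.map (homOfLE (X.basicOpen_le P.det)).op).hom.toAlgebra
    have hloc : IsLocalization.Away P.det Γ(X, X.basicOpen P.det) :=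
      hV.isLocalization_of_eq_basicOpen P.det (homOfLE (X.basicOpen_le P.det)) rfl
    have h1 := P.etale_away Γ(X, X.basicOpen P.det)
    have h2 : (algebraMap Γ(X, V) Γ(X, X.basicOpen P.det)).comp P.coeffHom =
        (φ.appLE O _ hle).hom.comp s := by
      rw [← h, ← RingHom.comp_assoc, ← φ.appLE_map le (homOfLE (X.basicOpen_le P.det)).op]
      rfl
    rw [h2] at h1
    generalize (φ.appLE O (X.basicOpen P.det) hle).hom = ψ at h1
    algebraize [s, ψ, ψ.comp s]
    exact Algebra.Etale.of_restrictScalars (MvPolynomial (Fin ε) k) _ _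
  · rintro x ⟨hxU, hxV⟩
    obtain ⟨z, rfl⟩ := exists_fromSpec_eq hV hxV
    have h1 := formallyEtale_of_mem_etaleLocus φ hV hO le s hs z hxU
    rw [h] at h1
    have h2 : (algebraMap Γ(X, V) (Localization.AtPrime z.asIdeal)).FormallyEtale := by
      rw [RingHom.formallyEtale_algebraMap]
      exact .of_isLocalization z.asIdeal.primeCompl
    have h3 := P.isUnit_det_of_formallyUnramified _ h2
      (formallyUnramified_of_formallyEtale h1)
    rw [fromSpec_mem_basicOpen_iff]
    exact fun h4 ↦ (IsLocalization.AtPrime.isUnit_to_map_iff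
      (Localization.AtPrime z.asIdeal) z.asIdeal P.det).mp h3 h4

/-- Density of `U` is used twice. At one generic point it yields the number of equations; at all of
them it shows that the determinant avoids every minimal prime and hence is a nonzerodivisor. -/
lemma exists_chart [LocallyOfFiniteType (φ ≫ q)] [Smooth q]
    (hX : IsLocallyCompleteIntersection (φ ≫ q)) (hU : Dense (etaleLocus φ : Set X)) (x : X) :
    ∃ c : Chart φ q, x ∈ c.V := by
  have : IsLocallyNoetherian X := LocallyOfFiniteType.isLocallyNoetherian (φ ≫ q)
  obtain ⟨O, hO, hxO, ε, s, hs, hsq⟩ := exists_etale_coordinates q (φ x)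
  obtain ⟨V, hV, hxV, le, N, gs, π, hgs, hπ, hker, hp⟩ :=
    exists_lci_chart (φ ≫ q) hX x (φ ⁻¹ᵁ O) hxO
  have hnoeth : IsNoetherianRing Γ(X, V) := IsLocallyNoetherian.component_noetherian ⟨V, hV⟩
  let alg : Algebra k Γ(X, V) := (π.comp MvPolynomial.C).toAlgebra
  let πₐ : MvPolynomial (Fin N) k →ₐ[k] Γ(X, V) := { π with commutes' := fun c ↦ rfl }
  let y : Fin ε → Γ(X, V) := fun j ↦ φ.appLE O V le (s (.X j))
  have hsC : ((φ.appLE O V le).hom.comp s).comp MvPolynomial.C = algebraMap k Γ(X, V) := by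
    have : Spec.map (CommRingCat.ofHom (((φ.appLE O V le).hom.comp s).comp MvPolynomial.C)) =
        Spec.map (CommRingCat.ofHom (π.comp MvPolynomial.C)) := by
      rw [← hp, ← IsAffineOpen.SpecMap_appLE_fromSpec_assoc φ hO hV le, hsq, ← Spec.map_comp]
      rfl
    exact congrArg CommRingCat.Hom.hom (Spec.map_injective this)
  have hcoeff : (φ.appLE O V le).hom.comp s = (MvPolynomial.aeval (R := k) y).toRingHom := by
    apply MvPolynomial.ringHom_ext
    · intro c
      exact (congr($hsC c)).trans (MvPolynomial.aeval_C y c).symm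
    · intro j
      exact (MvPolynomial.aeval_X y j).symm
  have hmin (z : PrimeSpectrum Γ(X, V)) (hz : z.asIdeal ∈ minimalPrimes Γ(X, V)) :
      hV.fromSpec z ∈ etaleLocus φ :=
    mem_of_mem_minimalPrimes_of_dense (hV.fromSpec ⁻¹ᵁ etaleLocus φ).isOpen
      (hU.preimage hV.fromSpec.isOpenEmbedding.isOpenMap) z hz
  -- The point `x` shows that `V` is nonempty, so that a minimal prime exists.
  obtain ⟨z₀, -⟩ := exists_fromSpec_eq hV hxV
  obtain ⟨p, hp', -⟩ := Ideal.exists_minimalPrimes_le (I := (⊥ : Ideal Γ(X, V)))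
    (J := z₀.asIdeal) bot_le
  have hpp : p.IsPrime := hp'.1.1
  have hcount : gs.length + ε = N := by
    refine length_add_eq_of_formallyEtale πₐ hgs hπ hker y p hp' ?_
    rw [← hcoeff]
    exact formallyEtale_of_mem_etaleLocus φ hV hO le s hs ⟨p, hpp⟩ (hmin ⟨p, hpp⟩ hp')
  obtain ⟨P, hP⟩ := exists_squarePresentation πₐ hcount hπ hker y
  have hPc : (φ.appLE O V le).hom.comp s = P.coeffHom := by
    rw [hcoeff, SquarePresentation.coeffHom, hP]
  have hb := basicOpen_det_eq φ hV hO le P s hs hPc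
  refine ⟨⟨V, hV, O, hO, le, hp, N, ε, P, s, hs, hPc, ?_, hb⟩, hxV⟩
  refine mem_nonZeroDivisors_of_notMem_minimalPrimes πₐ hgs hπ hker _ fun p hp ↦ ?_
  have hpp : p.IsPrime := hp.1.1
  refine (fromSpec_mem_basicOpen_iff hV P.det ⟨p, hpp⟩).mp ?_
  rw [hb]
  refine ⟨hmin ⟨p, hpp⟩ hp, ?_⟩
  rw [← hV.range_fromSpec]
  exact ⟨_, rfl⟩

end

end NewtonGroupoid

/-! ### Ideal sheaves from ideals of the stalks; the ideal of the different -/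

namespace NewtonGroupoid

section IdealsFromStalks

variable {X : Scheme.{u}}

/-- The sections over `V` all of whose germs lie in prescribed ideals of the local rings. -/
noncomputable def stalkwiseIdeal (K : ∀ x : X, Ideal (X.presheaf.stalk x)) (V : X.Opens) :
    Ideal Γ(X, V) :=
  ⨅ x : V, (K x.1).comap (X.presheaf.germ V x.1 x.2).hom

variable {K : ∀ x : X, Ideal (X.presheaf.stalk x)}

lemma mem_stalkwiseIdeal_iff {V : X.Opens} {s : Γ(X, V)} :
    s ∈ stalkwiseIdeal K V ↔ ∀ x (hx : x ∈ V), X.presheaf.germ V x hx s ∈ K x := by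
  simp only [stalkwiseIdeal, Submodule.mem_iInf, Subtype.forall, Ideal.mem_comap]

lemma germ_map_apply {V' V : X.Opens} (h : V' ≤ V) {x : X} (hx : x ∈ V') (s : Γ(X, V)) :
    X.presheaf.germ V' x hx (X.presheaf.map (homOfLE h).op s) = X.presheaf.germ V x (h hx) s :=
  X.presheaf.germ_res_apply (homOfLE h) x hx s

lemma map_mem_stalkwiseIdeal {V' V : X.Opens} (h : V' ≤ V) {s : Γ(X, V)}
    (hs : s ∈ stalkwiseIdeal K V) :
    X.presheaf.map (homOfLE h).op s ∈ stalkwiseIdeal K V' := by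
  rw [mem_stalkwiseIdeal_iff] at hs ⊢
  intro x hx
  rw [germ_map_apply]
  exact hs x (h hx)

/-- `d` is an equation of the prescribed ideals of the local rings at the points of `V`. -/
def IsStalkwiseEquation (K : ∀ x : X, Ideal (X.presheaf.stalk x)) (V : X.Opens) (d : Γ(X, V)) :
    Prop :=
  ∀ x (hx : x ∈ V), K x = Ideal.span {X.presheaf.germ V x hx d}

lemma IsStalkwiseEquation.map {V' V : X.Opens} (h : V' ≤ V) {d : Γ(X, V)}
    (hd : IsStalkwiseEquation K V d) :
    IsStalkwiseEquation K V' (X.presheaf.map (homOfLE h).op d) := by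
  intro x hx
  rw [germ_map_apply, hd x (h hx)]

lemma IsStalkwiseEquation.stalkwiseIdeal_eq {V : X.Opens} (hV : IsAffineOpen V) {d : Γ(X, V)}
    (hd : IsStalkwiseEquation K V d) : stalkwiseIdeal K V = Ideal.span {d} := by
  ext s
  rw [mem_stalkwiseIdeal_iff, hV.mem_ideal_iff]
  refine forall₂_congr fun x hx ↦ ?_
  rw [hd x hx, Ideal.map_span, Set.image_singleton]

lemma exists_pow_mul_mem_map {A B : Type*} [CommRing A] [CommRing B] [Algebra A B] (f : A)
    [IsLocalization.Away f B] (I : Ideal A) (s : A)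
    (hs : algebraMap A B s ∈ I.map (algebraMap A B)) : ∃ n : ℕ, f ^ n * s ∈ I := by
  obtain ⟨⟨⟨c, hc⟩, ⟨_, l, rfl⟩⟩, h⟩ :=
    (IsLocalization.mem_map_algebraMap_iff (.powers f) B).mp hs
  rw [← map_mul, IsLocalization.eq_iff_exists (.powers f) B] at h
  obtain ⟨⟨_, m, rfl⟩, h⟩ := h
  refine ⟨m + l, ?_⟩
  have : f ^ (m + l) * s = f ^ m * c := by
    rw [← h]
    simp only
    ring
  rw [this]
  exact I.mul_mem_left _ hc

lemma exists_basicOpen_equation (hK : ∀ x : X, ∃ (V : X.Opens) (d : Γ(X, V)), x ∈ V ∧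
    IsStalkwiseEquation K V d) {U : X.Opens} (hU : IsAffineOpen U) :
    ∃ (S : Finset Γ(X, U)) (e : ∀ g : Γ(X, U), Γ(X, X.basicOpen g)),
      Ideal.span (S : Set Γ(X, U)) = ⊤ ∧ ∀ g ∈ S, IsStalkwiseEquation K (X.basicOpen g) (e g) := by
  classical
  let G : Set Γ(X, U) := {g | ∃ e : Γ(X, X.basicOpen g), IsStalkwiseEquation K (X.basicOpen g) e}
  have hG : Ideal.span G = ⊤ := by
    rw [← hU.self_le_iSup_basicOpen_iff]
    intro x hx
    obtain ⟨V, d, hxV, hd⟩ := hK x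
    obtain ⟨g, hg, hxg⟩ := hU.exists_basicOpen_le (V := V) ⟨x, hxV⟩ hx
    exact TopologicalSpace.Opens.mem_iSup.mpr ⟨⟨g, _, hd.map hg⟩, hxg⟩
  obtain ⟨S, hSG, hS⟩ := (Ideal.span_eq_top_iff_finite G).mp hG
  exact ⟨S, fun g ↦ if h : g ∈ G then h.choose else 0, hS, fun g hg ↦ by
    have h : g ∈ G := hSG hg
    simp only [h, dif_pos]
    exact h.choose_spec⟩

/-- Cover `U` by finitely many principal opens on which the ideals have an equation. On each the
claim is the clearing of denominators in a principal ideal; take the largest exponent. -/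
lemma exists_pow_mul_mem_stalkwiseIdeal (hK : ∀ x : X, ∃ (V : X.Opens) (d : Γ(X, V)), x ∈ V ∧
    IsStalkwiseEquation K V d) {U : X.Opens} (hU : IsAffineOpen U) (f t : Γ(X, U))
    (ht : X.presheaf.map (homOfLE (X.basicOpen_le f)).op t ∈ stalkwiseIdeal K (X.basicOpen f)) :
    ∃ n : ℕ, f ^ n * t ∈ stalkwiseIdeal K U := by
  obtain ⟨S, e, hS, he⟩ := exists_basicOpen_equation hK hU
  have step (g : Γ(X, U)) (hg : g ∈ S) : ∃ n : ℕ,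
      X.presheaf.map (homOfLE (X.basicOpen_le g)).op (f ^ n * t) ∈
        stalkwiseIdeal K (X.basicOpen g) := by
    let ρ : Γ(X, U) →+* Γ(X, X.basicOpen g) :=
      (X.presheaf.map (homOfLE (X.basicOpen_le g)).op).hom
    have hle : X.basicOpen (ρ f) ≤ X.basicOpen f :=
      (X.basicOpen_res f (homOfLE (X.basicOpen_le g)).op).trans_le inf_le_right
    let alg : Algebra Γ(X, X.basicOpen g) Γ(X, X.basicOpen (ρ f)) :=
      (X.presheaf.map (homOfLE (X.basicOpen_le (ρ f))).op).hom.toAlgebra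
    have hloc : IsLocalization.Away (ρ f) Γ(X, X.basicOpen (ρ f)) :=
      (hU.basicOpen g).isLocalization_of_eq_basicOpen (ρ f)
        (homOfLE (X.basicOpen_le (ρ f))) rfl
    have h1 : algebraMap Γ(X, X.basicOpen g) Γ(X, X.basicOpen (ρ f)) (ρ t) ∈
        Ideal.map (algebraMap Γ(X, X.basicOpen g) Γ(X, X.basicOpen (ρ f)))
          (Ideal.span {e g}) := by
      rw [Ideal.map_span, Set.image_singleton]
      change _ ∈ Ideal.span {X.presheaf.map (homOfLE (X.basicOpen_le (ρ f))).op (e g)}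
      rw [← ((he g hg).map (X.basicOpen_le (ρ f))).stalkwiseIdeal_eq
        ((hU.basicOpen g).basicOpen (ρ f)), mem_stalkwiseIdeal_iff]
      intro x hx
      rw [mem_stalkwiseIdeal_iff] at ht
      have := ht x (hle hx)
      rw [germ_map_apply] at this
      have h2 : X.presheaf.germ (X.basicOpen (ρ f)) x hx
          (algebraMap Γ(X, X.basicOpen g) Γ(X, X.basicOpen (ρ f)) (ρ t)) =
          X.presheaf.germ U x (X.basicOpen_le f (hle hx)) t :=
        (germ_map_apply (X.basicOpen_le (ρ f)) hx (ρ t)).trans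
          (germ_map_apply (X.basicOpen_le g) _ t)
      rwa [h2]
    obtain ⟨n, hn⟩ := exists_pow_mul_mem_map (ρ f) _ (ρ t) h1
    refine ⟨n, ?_⟩
    rw [(he g hg).stalkwiseIdeal_eq (hU.basicOpen g), map_mul, map_pow]
    exact hn
  choose! n hn using step
  refine ⟨S.sup n, ?_⟩
  rw [mem_stalkwiseIdeal_iff]
  intro x hx
  have hx' := (hU.self_le_iSup_basicOpen_iff.mpr hS) hx
  obtain ⟨⟨g, hg⟩, hxg⟩ := TopologicalSpace.Opens.mem_iSup.mp hx'
  obtain ⟨m, hm⟩ := Nat.exists_eq_add_of_le (Finset.le_sup (f := n) hg)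
  have h1 := mem_stalkwiseIdeal_iff.mp (hn g hg) x hxg
  rw [germ_map_apply] at h1
  rw [hm, add_comm, pow_add, mul_assoc, map_mul]
  exact Ideal.mul_mem_left _ _ h1

/-- Locally principal ideals of the local rings define an ideal sheaf. -/
noncomputable def stalkwiseIdealSheaf (hK : ∀ x : X, ∃ (V : X.Opens) (d : Γ(X, V)), x ∈ V ∧
    IsStalkwiseEquation K V d) : X.IdealSheafData where
  ideal U := stalkwiseIdeal K U.1
  map_ideal_basicOpen U f := by
    apply le_antisymm
    · exact Ideal.map_le_iff_le_comap.mpr fun s hs ↦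
        map_mem_stalkwiseIdeal (X.basicOpen_le f) hs
    · intro s hs
      let alg : Algebra Γ(X, U.1) Γ(X, X.basicOpen f) :=
        (X.presheaf.map (homOfLE (X.basicOpen_le f)).op).hom.toAlgebra
      have hloc : IsLocalization.Away f Γ(X, X.basicOpen f) :=
        IsAffineOpen.isLocalization_of_eq_basicOpen U.2 f (homOfLE (X.basicOpen_le f)) rfl
      obtain ⟨n, t, ht⟩ := IsLocalization.Away.surj f (S := Γ(X, X.basicOpen f)) s
      obtain ⟨m, hm⟩ := exists_pow_mul_mem_stalkwiseIdeal hK U.2 f t (by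
        change algebraMap Γ(X, U.1) Γ(X, X.basicOpen f) t ∈ _
        rw [← ht]
        exact Ideal.mul_mem_right _ _ hs)
      have h1 := Ideal.mem_map_of_mem (algebraMap Γ(X, U.1) Γ(X, X.basicOpen f)) hm
      rw [map_mul, ← ht, map_pow, mul_comm s, ← mul_assoc, ← pow_add] at h1
      have hu : IsUnit (algebraMap Γ(X, U.1) Γ(X, X.basicOpen f) f ^ (m + n)) :=
        (IsLocalization.Away.algebraMap_isUnit f).pow _
      exact (Ideal.unit_mul_mem_iff_mem _ hu).mp h1

/-- `ofIdeals` in general shrinks a family of ideals. Here the family is already an ideal sheaf, so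
nothing is lost. -/
lemma ideal_ofIdeals_stalkwiseIdeal (hK : ∀ x : X, ∃ (V : X.Opens) (d : Γ(X, V)), x ∈ V ∧
    IsStalkwiseEquation K V d) {V : X.Opens} (hV : IsAffineOpen V) {d : Γ(X, V)}
    (hd : IsStalkwiseEquation K V d) :
    (Scheme.IdealSheafData.ofIdeals fun U : X.affineOpens ↦ stalkwiseIdeal K U.1).ideal ⟨V, hV⟩ =
      Ideal.span {d} := by
  rw [← hd.stalkwiseIdeal_eq hV]
  exact congrFun (congrArg Scheme.IdealSheafData.ideal
    (Scheme.IdealSheafData.ofIdeals_ideal (stalkwiseIdealSheaf hK))) ⟨V, hV⟩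

end IdealsFromStalks

section Different

variable {k : Type u} [Field k] {X Y : Scheme.{u}} {φ : X ⟶ Y} {q : Y ⟶ Spec (.of k)}

lemma formallyEtale_germ {X : Scheme.{u}} {V : X.Opens} (hV : IsAffineOpen V) {x : X}
    (hx : x ∈ V) : (X.presheaf.germ V x hx).hom.FormallyEtale := by
  let alg : Algebra Γ(X, V) (X.presheaf.stalk x) := (X.presheaf.germ V x hx).hom.toAlgebra
  have : IsLocalization.AtPrime (X.presheaf.stalk x) (hV.primeIdealOf ⟨x, hx⟩).asIdeal :=
    hV.isLocalization_stalk ⟨x, hx⟩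
  have h : Algebra.FormallyEtale Γ(X, V) (X.presheaf.stalk x) :=
    .of_isLocalization (hV.primeIdealOf ⟨x, hx⟩).asIdeal.primeCompl
  exact h

lemma germ_mem_nonZeroDivisors {X : Scheme.{u}} {V : X.Opens} (hV : IsAffineOpen V) {x : X}
    (hx : x ∈ V) {d : Γ(X, V)} (hd : d ∈ nonZeroDivisors Γ(X, V)) :
    X.presheaf.germ V x hx d ∈ nonZeroDivisors (X.presheaf.stalk x) := by
  let alg : Algebra Γ(X, V) (X.presheaf.stalk x) := (X.presheaf.germ V x hx).hom.toAlgebra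
  have : IsLocalization.AtPrime (X.presheaf.stalk x) (hV.primeIdealOf ⟨x, hx⟩).asIdeal :=
    hV.isLocalization_stalk ⟨x, hx⟩
  exact IsLocalization.map_nonZeroDivisors_le
    (hV.primeIdealOf ⟨x, hx⟩).asIdeal.primeCompl (X.presheaf.stalk x) ⟨d, hd, rfl⟩

/-- The determinant is one equation of the divisor at each point, and it divides all others by
`IsDivisorEquation.dvd`. -/
lemma Chart.isStalkwiseEquation (c : Chart φ q) :
    IsStalkwiseEquation (differentStalk φ) c.V c.P.det := by
  intro x hx
  have hO : φ x ∈ c.O := c.le hx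
  let alg := (φ.stalkMap x).hom.toAlgebra
  have h1 : IsDivisorEquation (X.presheaf.stalk x)
      (Ω[X.presheaf.stalk x⁄Y.presheaf.stalk (φ x)]) (X.presheaf.germ c.V x hx c.P.det) := by
    refine c.P.isDivisorEquation (X.presheaf.germ c.V x hx).hom (formallyEtale_germ c.hV hx)
      ((Y.presheaf.germ c.O (φ x) hO).hom.comp c.s) ?_ ?_ (germ_mem_nonZeroDivisors c.hV hx c.det_mem)
    · exact formallyUnramified_of_formallyEtale
        (RingHom.FormallyEtale.comp c.s_etale.formallyEtale (formallyEtale_germ c.hO hO))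
    · rw [← c.appLE_comp_s, ← RingHom.comp_assoc, ← RingHom.comp_assoc]
      congr 1
      have h2 := φ.germ_stalkMap c.O x hO
      have h3 : φ.appLE c.O c.V c.le ≫ X.presheaf.germ c.V x hx =
          φ.app c.O ≫ X.presheaf.germ (φ ⁻¹ᵁ c.O) x hO := by
        rw [Scheme.Hom.appLE, Category.assoc]
        congr 1
        exact X.presheaf.germ_res' _ _ _
      exact congrArg CommRingCat.Hom.hom (h2.trans h3.symm)
  apply le_antisymm
  · refine Ideal.span_le.mpr fun d hd ↦ ?_
    rw [SetLike.mem_coe, Ideal.mem_span_singleton]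
    exact h1.dvd hd
  · rw [Ideal.span_singleton_le_iff_mem]
    exact Ideal.subset_span h1

lemma Chart.different_ideal (hc : ∀ x : X, ∃ c : Chart φ q, x ∈ c.V) (c : Chart φ q) :
    (different φ).ideal ⟨c.V, c.hV⟩ = Ideal.span {c.P.det} :=
  ideal_ofIdeals_stalkwiseIdeal (fun x ↦ by
    obtain ⟨c, hx⟩ := hc x
    exact ⟨c.V, c.P.det, hx, c.isStalkwiseEquation⟩) c.hV c.isStalkwiseEquation

end Different

end NewtonGroupoid

/-! ### Kernels and inverse images of ideal sheaves, by points with values in affine schemes -/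

namespace NewtonGroupoid

section SpecPoints

variable {X Z : Scheme.{u}} {V : X.Opens} (hV : IsAffineOpen V)

lemma le_preimage_of_fac {E : CommRingCat.{u}} {g : Spec E ⟶ X} {π : Γ(X, V) ⟶ E}
    (h : g = Spec.map π ≫ hV.fromSpec) : ⊤ ≤ g ⁻¹ᵁ V := by
  intro x _
  subst h
  change hV.fromSpec (Spec.map π x) ∈ V
  rw [← SetLike.mem_coe, ← hV.range_fromSpec]
  exact ⟨_, rfl⟩

lemma eq_SpecMap_appLE_fromSpec {E : CommRingCat.{u}} (g : Spec E ⟶ X) (e : ⊤ ≤ g ⁻¹ᵁ V) :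
    g = Spec.map (g.appLE V ⊤ e ≫ (Scheme.ΓSpecIso E).hom) ≫ hV.fromSpec := by
  rw [Spec.map_comp, Category.assoc,
    IsAffineOpen.SpecMap_appLE_fromSpec g hV (isAffineOpen_top _) e,
    IsAffineOpen.fromSpec_top, Scheme.isoSpec_Spec_inv, ← Spec.map_comp_assoc]
  simp

lemma appLE_eq_of_fac {E : CommRingCat.{u}} {g : Spec E ⟶ X} {π : Γ(X, V) ⟶ E}
    (h : g = Spec.map π ≫ hV.fromSpec) (e : ⊤ ≤ g ⁻¹ᵁ V) :
    g.appLE V ⊤ e ≫ (Scheme.ΓSpecIso E).hom = π := by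
  apply Spec.map_injective
  rw [← cancel_mono hV.fromSpec, ← eq_SpecMap_appLE_fromSpec hV g e, h]

lemma apply_eq_zero_of_fac {E : CommRingCat.{u}} {i : Z ⟶ X} {π : Γ(X, V) ⟶ E}
    (l : Spec E ⟶ Z) (h : l ≫ i = Spec.map π ≫ hV.fromSpec) {x : Γ(X, V)}
    (hx : i.app V x = 0) : π x = 0 := by
  have e := le_preimage_of_fac hV h
  have h1 := appLE_eq_of_fac hV h e
  have h2 : (l ≫ i).appLE V ⊤ e = i.app V ≫ l.appLE (i ⁻¹ᵁ V) ⊤ e := by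
    rw [Scheme.Hom.comp_appLE]
  rw [← h1, h2, CommRingCat.comp_apply, CommRingCat.comp_apply, hx, map_zero, map_zero]

/-- One inclusion is the vanishing of `J` on `Z`; for the other, a function vanishing on `Z`
vanishes on `Spec` of the quotient by `J`, which maps to `Z`. In this way ideals are found from the
functor of points alone. -/
lemma ker_ideal_eq {i : Z ⟶ X} [QuasiCompact i] (J : Ideal Γ(X, V))
    (hJ : ∀ x ∈ J, i.app V x = 0) (l : Spec (.of (Γ(X, V) ⧸ J)) ⟶ Z)
    (hl : l ≫ i = Spec.map (CommRingCat.ofHom (Ideal.Quotient.mk J)) ≫ hV.fromSpec) :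
    i.ker.ideal ⟨V, hV⟩ = J := by
  rw [Scheme.Hom.ker_apply]
  refine le_antisymm (fun x hx ↦ ?_) hJ
  exact Ideal.Quotient.eq_zero_iff_mem.mp (apply_eq_zero_of_fac hV l hl hx)

end SpecPoints

section Comap

variable {X Y : Scheme.{u}}

lemma appLE_eq_zero_of_comp {Z : Scheme.{u}} {f : X ⟶ Y} {i : Z ⟶ X} {O : X.Opens} {V : Y.Opens}
    (e : O ≤ f ⁻¹ᵁ V) (x : Γ(Y, V)) (h : (i ≫ f).app V x = 0) : i.app O (f.appLE V O e x) = 0 := by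
  have e' : i ⁻¹ᵁ O ≤ (i ≫ f) ⁻¹ᵁ V := i.preimage_mono e
  have h1 : f.appLE V O e ≫ i.app O = (i ≫ f).appLE V (i ⁻¹ᵁ O) e' := by
    rw [Scheme.Hom.app_eq_appLE, Scheme.Hom.appLE_comp_appLE]
  have h2 : i.app O (f.appLE V O e x) = (i ≫ f).appLE V (i ⁻¹ᵁ O) e' x := congr($h1 x)
  rw [h2, Scheme.Hom.appLE, CommRingCat.comp_apply, h, map_zero]

lemma exists_lift_subscheme (I : Y.IdealSheafData) {V : Y.Opens} (hV : IsAffineOpen V)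
    {E : CommRingCat.{u}} (π : Γ(Y, V) ⟶ E) (hπ : ∀ x ∈ I.ideal ⟨V, hV⟩, π x = 0) :
    ∃ l : Spec E ⟶ I.subscheme, l ≫ I.subschemeι = Spec.map π ≫ hV.fromSpec := by
  have hV' : IsAffineOpen (I.subschemeι ⁻¹ᵁ V) := hV.preimage I.subschemeι
  have hs := I.subschemeι_app_surjective ⟨V, hV⟩
  have hk := I.ker_subschemeι_app ⟨V, hV⟩
  let ψ : Γ(I.subscheme, I.subschemeι ⁻¹ᵁ V) →+* E :=
    RingHom.liftOfSurjective (I.subschemeι.app V).hom hs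
      ⟨π.hom, fun x hx ↦ hπ x (hk ▸ hx)⟩
  have hψ : I.subschemeι.app V ≫ CommRingCat.ofHom ψ = π := by
    refine CommRingCat.hom_ext (RingHom.ext fun x ↦ ?_)
    exact RingHom.liftOfRightInverse_comp_apply (I.subschemeι.app V).hom _
      (Function.rightInverse_surjInv hs) ⟨π.hom, fun x hx ↦ hπ x (hk ▸ hx)⟩ x
  refine ⟨Spec.map (CommRingCat.ofHom ψ) ≫ hV'.fromSpec, ?_⟩
  rw [Category.assoc, ← IsAffineOpen.SpecMap_appLE_fromSpec I.subschemeι hV hV' le_rfl,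
    ← Spec.map_comp_assoc, ← Scheme.Hom.app_eq_appLE]
  exact congrArg (fun t ↦ Spec.map t ≫ hV.fromSpec) hψ

/-- `comap` is the kernel of a base change of the closed subscheme, so the universal property of the
fibre product supplies the map required by `ker_ideal_eq`. -/
lemma comap_ideal (I : Y.IdealSheafData) (f : X ⟶ Y) {O : X.Opens} {V : Y.Opens}
    (hO : IsAffineOpen O) (hV : IsAffineOpen V) (e : O ≤ f ⁻¹ᵁ V) :
    (I.comap f).ideal ⟨O, hO⟩ = (I.ideal ⟨V, hV⟩).map (f.appLE V O e).hom := by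
  let J := (I.ideal ⟨V, hV⟩).map (f.appLE V O e).hom
  have hE : ∀ x ∈ I.ideal ⟨V, hV⟩,
      (f.appLE V O e ≫ CommRingCat.ofHom (Ideal.Quotient.mk J)) x = 0 := fun x hx ↦
    Ideal.Quotient.eq_zero_iff_mem.mpr (Ideal.mem_map_of_mem _ hx)
  obtain ⟨l, hl⟩ := exists_lift_subscheme I hV _ hE
  let m : Spec (.of (Γ(X, O) ⧸ J)) ⟶ X :=
    Spec.map (CommRingCat.ofHom (Ideal.Quotient.mk J)) ≫ hO.fromSpec
  have hm : m ≫ f = l ≫ I.subschemeι := by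
    rw [hl, Category.assoc, ← IsAffineOpen.SpecMap_appLE_fromSpec f hV hO e, Spec.map_comp_assoc]
  refine ker_ideal_eq (i := pullback.fst f I.subschemeι) hO J ?_ (pullback.lift m l hm)
    (pullback.lift_fst _ _ _)
  intro x hx
  have hx' : J ≤ RingHom.ker ((pullback.fst f I.subschemeι).app O).hom := by
    refine Ideal.map_le_iff_le_comap.mpr fun x hx ↦ ?_
    refine appLE_eq_zero_of_comp e x ?_
    rw [pullback.condition]
    have : I.subschemeι.app V x = 0 := by
      rw [← I.ker_subschemeι_app ⟨V, hV⟩] at hx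
      exact hx
    have h1 : (pullback.snd f I.subschemeι ≫ I.subschemeι).app V x =
        (pullback.snd f I.subschemeι).app _ (I.subschemeι.app V x) := by
      rw [Scheme.Hom.comp_app]
      rfl
    exact h1.trans ((congrArg _ this).trans (map_zero _))
  exact hx' hx

end Comap

end NewtonGroupoid

/-! ### The open `V × V` and the ideals of the diagonal and of the fibre product over `Y` -/

namespace NewtonGroupoid

section Square

variable {k : Type u} [Field k] {X : Scheme.{u}} (p : X ⟶ Spec (.of k)) (V : X.Opens)

/-- The open `V × V` of `X × X`. -/
noncomputable def squareOpen : (pullback p p).Opens :=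
  pullback.fst p p ⁻¹ᵁ V ⊓ pullback.snd p p ⁻¹ᵁ V

lemma squareOpen_le_fst : squareOpen p V ≤ pullback.fst p p ⁻¹ᵁ V := inf_le_left

lemma squareOpen_le_snd : squareOpen p V ≤ pullback.snd p p ⁻¹ᵁ V := inf_le_right

variable {V}

lemma isAffineOpen_squareOpen (hV : IsAffineOpen V) : IsAffineOpen (squareOpen p V) := by
  let m : pullback (hV.fromSpec ≫ p) (hV.fromSpec ≫ p) ⟶ pullback p p :=
    pullback.map _ _ _ _ hV.fromSpec hV.fromSpec (𝟙 _) (by simp) (by simp)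
  have : squareOpen p V = m.opensRange := by
    apply TopologicalSpace.Opens.ext
    have := Scheme.Pullback.range_map (f := hV.fromSpec ≫ p) (g := hV.fromSpec ≫ p) p p hV.fromSpec
      hV.fromSpec (𝟙 _) (by simp) (by simp)
    rw [hV.range_fromSpec] at this
    exact this.symm
  rw [this]
  exact isAffineOpen_opensRange m

/-- The pullback of functions along the first projection. -/
noncomputable def leftHom (V : X.Opens) : Γ(X, V) ⟶ Γ(pullback p p, squareOpen p V) :=
  (pullback.fst p p).appLE V (squareOpen p V) (squareOpen_le_fst p V)

/-- The pullback of functions along the second projection. -/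
noncomputable def rightHom (V : X.Opens) : Γ(X, V) ⟶ Γ(pullback p p, squareOpen p V) :=
  (pullback.snd p p).appLE V (squareOpen p V) (squareOpen_le_snd p V)

variable (hV : IsAffineOpen V)

lemma SpecMap_leftHom_fromSpec : Spec.map (leftHom p V) ≫ hV.fromSpec =
    (isAffineOpen_squareOpen p hV).fromSpec ≫ pullback.fst p p :=
  IsAffineOpen.SpecMap_appLE_fromSpec _ hV (isAffineOpen_squareOpen p hV) (squareOpen_le_fst p V)

lemma SpecMap_leftHom_fromSpec_assoc {Z : Scheme.{u}} (g : X ⟶ Z) :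
    Spec.map (leftHom p V) ≫ hV.fromSpec ≫ g =
      (isAffineOpen_squareOpen p hV).fromSpec ≫ pullback.fst p p ≫ g := by
  rw [← Category.assoc, SpecMap_leftHom_fromSpec, Category.assoc]

lemma SpecMap_rightHom_fromSpec : Spec.map (rightHom p V) ≫ hV.fromSpec =
    (isAffineOpen_squareOpen p hV).fromSpec ≫ pullback.snd p p :=
  IsAffineOpen.SpecMap_appLE_fromSpec _ hV (isAffineOpen_squareOpen p hV) (squareOpen_le_snd p V)

lemma SpecMap_rightHom_fromSpec_assoc {Z : Scheme.{u}} (g : X ⟶ Z) :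
    Spec.map (rightHom p V) ≫ hV.fromSpec ≫ g =
      (isAffineOpen_squareOpen p hV).fromSpec ≫ pullback.snd p p ≫ g := by
  rw [← Category.assoc, SpecMap_rightHom_fromSpec, Category.assoc]

lemma leftHom_comp_algebraMap [Algebra k Γ(X, V)]
    (hp : hV.fromSpec ≫ p = Spec.map (CommRingCat.ofHom (algebraMap k Γ(X, V)))) :
    CommRingCat.ofHom (algebraMap k Γ(X, V)) ≫ leftHom p V =
      CommRingCat.ofHom (algebraMap k Γ(X, V)) ≫ rightHom p V := by
  apply Spec.map_injective
  rw [Spec.map_comp, Spec.map_comp, ← hp, SpecMap_leftHom_fromSpec_assoc,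
    SpecMap_rightHom_fromSpec_assoc, pullback.condition]

lemma squareOpen_hom_ext (hV : IsAffineOpen V) {E : CommRingCat.{u}} {F G : Γ(pullback p p, squareOpen p V) ⟶ E}
    (h₁ : leftHom p V ≫ F = leftHom p V ≫ G) (h₂ : rightHom p V ≫ F = rightHom p V ≫ G) :
    F = G := by
  have hVV := isAffineOpen_squareOpen p hV
  apply Spec.map_injective
  rw [← cancel_mono hVV.fromSpec]
  apply pullback.hom_ext
  · simp only [Category.assoc]
    rw [← SpecMap_leftHom_fromSpec p hV, ← Spec.map_comp_assoc,
      ← Spec.map_comp_assoc]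
    exact congrArg (fun t ↦ Spec.map t ≫ hV.fromSpec) h₁
  · simp only [Category.assoc]
    rw [← SpecMap_rightHom_fromSpec p hV, ← Spec.map_comp_assoc,
      ← Spec.map_comp_assoc]
    exact congrArg (fun t ↦ Spec.map t ≫ hV.fromSpec) h₂

/-- With `squareOpen_hom_ext`, this is the universal property of `Γ(V) ⊗_k Γ(V)`. The functions on
`V × V` are used only through it. -/
lemma exists_squareOpen_hom [Algebra k Γ(X, V)]
    (hp : hV.fromSpec ≫ p = Spec.map (CommRingCat.ofHom (algebraMap k Γ(X, V))))
    {E : CommRingCat.{u}} (α β : Γ(X, V) ⟶ E)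
    (h : CommRingCat.ofHom (algebraMap k Γ(X, V)) ≫ α =
      CommRingCat.ofHom (algebraMap k Γ(X, V)) ≫ β) :
    ∃ F : Γ(pullback p p, squareOpen p V) ⟶ E, leftHom p V ≫ F = α ∧ rightHom p V ≫ F = β := by
  have hVV := isAffineOpen_squareOpen p hV
  let g : Spec E ⟶ pullback p p := pullback.lift (Spec.map α ≫ hV.fromSpec)
    (Spec.map β ≫ hV.fromSpec) (by
      rw [Category.assoc, Category.assoc, hp, ← Spec.map_comp, ← Spec.map_comp, h])
  have h₁ : g ≫ pullback.fst p p = Spec.map α ≫ hV.fromSpec := pullback.lift_fst _ _ _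
  have h₂ : g ≫ pullback.snd p p = Spec.map β ≫ hV.fromSpec := pullback.lift_snd _ _ _
  have e₁ := le_preimage_of_fac hV h₁
  have e₂ := le_preimage_of_fac hV h₂
  have e : ⊤ ≤ g ⁻¹ᵁ squareOpen p V := fun x hx ↦ ⟨e₁ hx, e₂ hx⟩
  refine ⟨g.appLE _ ⊤ e ≫ (Scheme.ΓSpecIso E).hom, ?_, ?_⟩
  · rw [leftHom, Scheme.Hom.appLE_comp_appLE_assoc]
    exact appLE_eq_of_fac hV h₁ _
  · rw [rightHom, Scheme.Hom.appLE_comp_appLE_assoc]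
    exact appLE_eq_of_fac hV h₂ _

/-- The ideal generated by the differences `s ⊗ 1 - 1 ⊗ s`, with `s` in the image of `σ`. -/
noncomputable def differenceIdeal {R : CommRingCat.{u}} (σ : R ⟶ Γ(X, V)) :
    Ideal Γ(pullback p p, squareOpen p V) :=
  Ideal.span (Set.range fun s ↦ (σ ≫ leftHom p V) s - (σ ≫ rightHom p V) s)

lemma comp_mk_differenceIdeal {R : CommRingCat.{u}} (σ : R ⟶ Γ(X, V)) :
    σ ≫ leftHom p V ≫ CommRingCat.ofHom (Ideal.Quotient.mk (differenceIdeal p σ)) =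
      σ ≫ rightHom p V ≫ CommRingCat.ofHom (Ideal.Quotient.mk (differenceIdeal p σ)) := by
  refine CommRingCat.hom_ext (RingHom.ext fun s ↦ ?_)
  exact Ideal.Quotient.eq.mpr (Ideal.subset_span ⟨s, rfl⟩)

lemma SpecMap_comp_fst (hV : IsAffineOpen V) {E : CommRingCat.{u}}
    (F : Γ(pullback p p, squareOpen p V) ⟶ E) :
    Spec.map F ≫ (isAffineOpen_squareOpen p hV).fromSpec ≫ pullback.fst p p =
      Spec.map (leftHom p V ≫ F) ≫ hV.fromSpec := by
  rw [← SpecMap_leftHom_fromSpec p hV, ← Spec.map_comp_assoc]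

lemma SpecMap_comp_snd (hV : IsAffineOpen V) {E : CommRingCat.{u}}
    (F : Γ(pullback p p, squareOpen p V) ⟶ E) :
    Spec.map F ≫ (isAffineOpen_squareOpen p hV).fromSpec ≫ pullback.snd p p =
      Spec.map (rightHom p V ≫ F) ≫ hV.fromSpec := by
  rw [← SpecMap_rightHom_fromSpec p hV, ← Spec.map_comp_assoc]

lemma app_differenceIdeal_eq_zero {R : CommRingCat.{u}} (σ : R ⟶ Γ(X, V)) {Z : Scheme.{u}}
    (i : Z ⟶ pullback p p)
    (h : σ ≫ leftHom p V ≫ i.app (squareOpen p V) = σ ≫ rightHom p V ≫ i.app (squareOpen p V))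
    (x) (hx : x ∈ differenceIdeal p σ) : i.app (squareOpen p V) x = 0 := by
  have : differenceIdeal p σ ≤ RingHom.ker (i.app (squareOpen p V)).hom := by
    refine Ideal.span_le.mpr ?_
    rintro _ ⟨s, rfl⟩
    have h1 := congr($h s)
    rw [SetLike.mem_coe, RingHom.mem_ker, map_sub, sub_eq_zero]
    exact h1
  exact this hx

lemma diagonal_ker_ideal [IsSeparated p] (hV : IsAffineOpen V) :
    (pullback.diagonal p).ker.ideal ⟨squareOpen p V, isAffineOpen_squareOpen p hV⟩ =
      differenceIdeal p (𝟙 Γ(X, V)) := by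
  have hVV := isAffineOpen_squareOpen p hV
  let J := differenceIdeal p (𝟙 Γ(X, V))
  let π := CommRingCat.ofHom (Ideal.Quotient.mk J)
  refine ker_ideal_eq hVV J (app_differenceIdeal_eq_zero p _ _ ?_)
    (Spec.map (leftHom p V ≫ π) ≫ hV.fromSpec) ?_
  · have h1 (s : Γ(X, V)) : (leftHom p V ≫ (pullback.diagonal p).app (squareOpen p V)) s =
        (rightHom p V ≫ (pullback.diagonal p).app (squareOpen p V)) s := by
      rw [leftHom, rightHom, Scheme.Hom.app_eq_appLE, Scheme.Hom.appLE_comp_appLE,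
        Scheme.Hom.appLE_comp_appLE]
      congr 3
      rw [pullback.diagonal_fst, pullback.diagonal_snd]
    refine CommRingCat.hom_ext (RingHom.ext fun s ↦ h1 s)
  · apply pullback.hom_ext
    · simp only [Category.assoc]
      rw [pullback.diagonal_fst, Category.comp_id]
      exact (SpecMap_comp_fst p hV π).symm
    · simp only [Category.assoc]
      rw [pullback.diagonal_snd, Category.comp_id]
      have h1 : leftHom p V ≫ π = rightHom p V ≫ π := comp_mk_differenceIdeal p (𝟙 Γ(X, V))
      rw [h1]
      exact (SpecMap_comp_snd p hV π).symm

end Square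

section

variable {k : Type u} [Field k] {X Y : Scheme.{u}} (φ : X ⟶ Y) (q : Y ⟶ Spec (.of k))

lemma mapDesc_fst : pullback.mapDesc φ φ q ≫ pullback.fst (φ ≫ q) (φ ≫ q) = pullback.fst φ φ :=
  (pullback.lift_fst _ _ _).trans (Category.comp_id _)

lemma mapDesc_snd : pullback.mapDesc φ φ q ≫ pullback.snd (φ ≫ q) (φ ≫ q) = pullback.snd φ φ :=
  (pullback.lift_snd _ _ _).trans (Category.comp_id _)

lemma exists_lift_mapDesc {V : X.Opens} (hV : IsAffineOpen V) {O : Y.Opens}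
    (hO : IsAffineOpen O) (le : V ≤ φ ⁻¹ᵁ O) {E : CommRingCat.{u}}
    (π : Γ(pullback (φ ≫ q) (φ ≫ q), squareOpen (φ ≫ q) V) ⟶ E)
    (hπ : φ.appLE O V le ≫ leftHom (φ ≫ q) V ≫ π = φ.appLE O V le ≫ rightHom (φ ≫ q) V ≫ π) :
    ∃ l : Spec E ⟶ pullback φ φ, l ≫ pullback.mapDesc φ φ q =
      Spec.map π ≫ (isAffineOpen_squareOpen (φ ≫ q) hV).fromSpec := by
  have h : (Spec.map (leftHom (φ ≫ q) V ≫ π) ≫ hV.fromSpec) ≫ φ =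
      (Spec.map (rightHom (φ ≫ q) V ≫ π) ≫ hV.fromSpec) ≫ φ := by
    rw [Category.assoc, Category.assoc, ← IsAffineOpen.SpecMap_appLE_fromSpec φ hO hV le,
      ← Spec.map_comp_assoc, ← Spec.map_comp_assoc, hπ]
  refine ⟨pullback.lift _ _ h, ?_⟩
  apply pullback.hom_ext
  · rw [Category.assoc, mapDesc_fst, pullback.lift_fst, Category.assoc,
      SpecMap_comp_fst (φ ≫ q) hV π]
  · rw [Category.assoc, mapDesc_snd, pullback.lift_snd, Category.assoc,
      SpecMap_comp_snd (φ ≫ q) hV π]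

/-- Two points of `V` with the same image in the affine `O` are two ring maps that agree on the
functions coming from `O`. -/
lemma mapDesc_ker_ideal [IsSeparated q] {V : X.Opens} (hV : IsAffineOpen V) {O : Y.Opens}
    (hO : IsAffineOpen O) (le : V ≤ φ ⁻¹ᵁ O) :
    (pullback.mapDesc φ φ q).ker.ideal
        ⟨squareOpen (φ ≫ q) V, isAffineOpen_squareOpen (φ ≫ q) hV⟩ =
      differenceIdeal (φ ≫ q) (φ.appLE O V le) := by
  obtain ⟨l, hl⟩ := exists_lift_mapDesc φ q hV hO le
    (CommRingCat.ofHom (Ideal.Quotient.mk (differenceIdeal (φ ≫ q) (φ.appLE O V le))))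
    (comp_mk_differenceIdeal (φ ≫ q) (φ.appLE O V le))
  refine ker_ideal_eq (isAffineOpen_squareOpen (φ ≫ q) hV) _
    (app_differenceIdeal_eq_zero (φ ≫ q) _ _ ?_) l hl
  rw [leftHom, rightHom, Scheme.Hom.app_eq_appLE]
  simp only [Scheme.Hom.appLE_comp_appLE]
  congr 1
  rw [mapDesc_fst, mapDesc_snd, pullback.condition]

end

end NewtonGroupoid

/-! ### Affine pieces of the relative spectrum -/

namespace NewtonGroupoid

section RelativeGluing

variable {S : Scheme.{u}} {𝒰 : S.OpenCover} [Category 𝒰.I₀] [𝒰.LocallyDirected]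
  (d : 𝒰.RelativeGluingData) [Small.{u} 𝒰.I₀] [Quiver.IsThin 𝒰.I₀]

lemma cover_f_toBase (i : 𝒰.I₀) : d.cover.f i ≫ d.toBase = d.natTrans.app i ≫ 𝒰.f i :=
  d.ι_toBase i

instance (i : 𝒰.I₀) : IsOpenImmersion (d.cover.f i) := d.cover.map_prop i

lemma toBase_preimage_opensRange (i : 𝒰.I₀) :
    d.toBase ⁻¹ᵁ (𝒰.f i).opensRange = (d.cover.f i).opensRange :=
  d.toBase_preimage_eq_opensRange_ι i

lemma functor_map_cover_f {i j : 𝒰.I₀} (h : i ⟶ j) :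
    d.functor.map h ≫ d.cover.f j = d.cover.f i :=
  colimit.w d.functor h

end RelativeGluing

lemma exists_sections_of_fac {T Z : Scheme.{u}} {V : T.Opens} (hV : IsAffineOpen V)
    {E : CommRingCat.{u}} (j : Spec E ⟶ Z) [IsOpenImmersion j] (t : Z ⟶ T) (π : Γ(T, V) ⟶ E)
    (hj : j ≫ t = Spec.map π ≫ hV.fromSpec) (h : t ⁻¹ᵁ V = j.opensRange) :
    ∃ σ : E ⟶ Γ(Z, t ⁻¹ᵁ V), π ≫ σ = t.app V := by
  have e : ⊤ ≤ j ⁻¹ᵁ (t ⁻¹ᵁ V) := by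
    rw [h, Scheme.Hom.preimage_opensRange]
  have hiso : IsIso (j.app (t ⁻¹ᵁ V)) := j.isIso_app _ h.le
  have hiso' : IsIso (j.appLE (t ⁻¹ᵁ V) ⊤ e) := by
    have : IsIso (homOfLE e) := ⟨homOfLE le_top, rfl, rfl⟩
    rw [Scheme.Hom.appLE]
    infer_instance
  have h2 : t.app V ≫ j.appLE (t ⁻¹ᵁ V) ⊤ e ≫ (Scheme.ΓSpecIso E).hom = π := by
    have e' : ⊤ ≤ (j ≫ t) ⁻¹ᵁ V := e
    rw [← appLE_eq_of_fac hV hj e', Scheme.Hom.comp_appLE, Category.assoc]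
  refine ⟨(Scheme.ΓSpecIso E).inv ≫ inv (j.appLE (t ⁻¹ᵁ V) ⊤ e), ?_⟩
  rw [← h2]
  simp

namespace QCohSubalgebra

variable {T : Scheme.{u}} {W : T.Opens} (A : QCohSubalgebra W)

/-- The structure map `𝒪_T(V) ⟶ 𝒜(V)`. -/
noncomputable def algebraHom (V : T.affineOpens) : Γ(T, V.1) →+* A.carrier V :=
  (res W V.1).codRestrict (A.carrier V) fun a ↦ A.res_mem V a

/-- The restriction `𝒜(V) ⟶ 𝒜(V')`. -/
noncomputable def restrictHom {V' V : T.affineOpens} (h : V'.1 ≤ V.1) :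
    A.carrier V →+* A.carrier V' :=
  ((resW W h).comp (A.carrier V).subtype).codRestrict (A.carrier V')
    fun s ↦ A.resW_mem h s.1 s.2

lemma algebraHom_surjective_of_le {V : T.affineOpens} (h : V.1 ≤ W) (s : A.carrier V) :
    ∃ a, A.algebraHom V a = s := by
  have hb : W ⊓ V.1 = V.1 := inf_eq_right.mpr h
  have : IsIso (homOfLE (inf_le_right : W ⊓ V.1 ≤ V.1)) := ⟨homOfLE hb.ge, rfl, rfl⟩
  obtain ⟨a, ha⟩ := (ConcreteCategory.bijective_of_isIso
    (T.presheaf.map (homOfLE (inf_le_right : W ⊓ V.1 ≤ V.1)).op)).2 s.1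
  exact ⟨a, Subtype.ext ha⟩

lemma algebraHom_bijective_of_le {V : T.affineOpens} (h : V.1 ≤ W) :
    Function.Bijective (A.algebraHom V) := by
  refine ⟨fun a b hab ↦ ?_, A.algebraHom_surjective_of_le h⟩
  have hb : W ⊓ V.1 = V.1 := inf_eq_right.mpr h
  have : IsIso (homOfLE (inf_le_right : W ⊓ V.1 ≤ V.1)) := ⟨homOfLE hb.ge, rfl, rfl⟩
  exact (ConcreteCategory.bijective_of_isIso
    (T.presheaf.map (homOfLE (inf_le_right : W ⊓ V.1 ≤ V.1)).op)).1 (congrArg Subtype.val hab)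

variable [IsLocallyNoetherian T]

/-- The open immersion of `Spec 𝒜(V)` into the relative spectrum. -/
noncomputable def ι (V : T.affineOpens) : Spec (.of (A.carrier V)) ⟶ A.spec :=
  (Scheme.AffineZariskiSite.relativeGluingData A.coequifibered).cover.f ⟨V.1, V.2⟩

instance (V : T.affineOpens) : IsOpenImmersion (A.ι V) :=
  (Scheme.AffineZariskiSite.relativeGluingData A.coequifibered).cover.map_prop ⟨V.1, V.2⟩

lemma ι_specHom {V : T.Opens} (hV : IsAffineOpen V) :
    A.ι ⟨V, hV⟩ ≫ A.specHom =
      Spec.map (CommRingCat.ofHom (A.algebraHom ⟨V, hV⟩)) ≫ hV.fromSpec := by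
  refine (cover_f_toBase (Scheme.AffineZariskiSite.relativeGluingData A.coequifibered)
    ⟨V, hV⟩).trans ?_
  refine (Category.assoc _ _ _).trans ?_
  rfl

lemma ι_specHom_assoc {V : T.Opens} (hV : IsAffineOpen V) {Z : Scheme.{u}} (g : T ⟶ Z) :
    A.ι ⟨V, hV⟩ ≫ A.specHom ≫ g =
      Spec.map (CommRingCat.ofHom (A.algebraHom ⟨V, hV⟩)) ≫ hV.fromSpec ≫ g := by
  rw [← Category.assoc, A.ι_specHom hV, Category.assoc]

lemma specHom_preimage {V : T.Opens} (hV : IsAffineOpen V) :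
    A.specHom ⁻¹ᵁ V = (A.ι ⟨V, hV⟩).opensRange := by
  refine Eq.trans ?_ (toBase_preimage_opensRange
    (Scheme.AffineZariskiSite.relativeGluingData A.coequifibered) ⟨V, hV⟩)
  refine congrArg (A.specHom ⁻¹ᵁ ·) ?_
  exact (Scheme.Opens.opensRange_ι V).symm

lemma SpecMap_restrictHom_ι {V : T.Opens} (hV : IsAffineOpen V) (f : Γ(T, V)) :
    Spec.map (CommRingCat.ofHom (A.restrictHom (V' := ⟨T.basicOpen f, hV.basicOpen f⟩)
      (V := ⟨V, hV⟩) (T.basicOpen_le f))) ≫ A.ι ⟨V, hV⟩ = A.ι ⟨T.basicOpen f, hV.basicOpen f⟩ :=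
  functor_map_cover_f (Scheme.AffineZariskiSite.relativeGluingData A.coequifibered)
    (i := ⟨T.basicOpen f, hV.basicOpen f⟩) (j := ⟨V, hV⟩)
    (homOfLE (Scheme.AffineZariskiSite.basicOpen_le ⟨V, hV⟩ f))

/-- Sections of `𝒜` are functions on the relative spectrum. -/
lemma exists_sections {V : T.Opens} (hV : IsAffineOpen V) :
    ∃ σ : A.carrier ⟨V, hV⟩ →+* Γ(A.spec, A.specHom ⁻¹ᵁ V),
      ∀ a, σ (A.algebraHom ⟨V, hV⟩ a) = A.specHom.app V a := by
  obtain ⟨σ, hσ⟩ := exists_sections_of_fac hV (A.ι ⟨V, hV⟩) A.specHom _ (A.ι_specHom hV)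
    (A.specHom_preimage hV)
  exact ⟨σ.hom, fun a ↦ congr($hσ a)⟩

end QCohSubalgebra

end NewtonGroupoid

/-! ### Schematic density and maps to a relative spectrum -/

namespace NewtonGroupoid

section SchematicDensity

variable {Z : Scheme.{u}}

/-- The open `D` is schematically dense in `Z`. -/
def SchDense (D : Z.Opens) : Prop :=
  ∀ (O : Z.Opens), IsAffineOpen O → ∀ s : Γ(Z, O),
    (∀ z (hz : z ∈ O), z ∈ D → Z.presheaf.germ O z hz s = 0) → s = 0

lemma SchDense.res_injective {D : Z.Opens} (hD : SchDense D) {O : Z.Opens} (hO : IsAffineOpen O) :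
    Function.Injective (res D O) := by
  rw [injective_iff_map_eq_zero]
  intro s hs
  refine hD O hO s fun z hz hzD ↦ ?_
  have h1 : Z.presheaf.germ (D ⊓ O) z ⟨hzD, hz⟩ (res D O s) = Z.presheaf.germ O z hz s :=
    germ_map_apply (inf_le_right : D ⊓ O ≤ O) ⟨hzD, hz⟩ s
  rw [← h1, hs, map_zero]

lemma exists_affine_mem_le {O : Z.Opens} {z : Z} (hz : z ∈ O) :
    ∃ O' : Z.Opens, IsAffineOpen O' ∧ z ∈ O' ∧ O' ≤ O := by
  obtain ⟨O', h1, h2, h3⟩ := exists_isAffineOpen_mem_and_subset hz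
  exact ⟨O', h1, h2, h3⟩

end SchematicDensity

lemma hom_ext_of_local {Z S : Scheme.{u}} {f g : Z ⟶ S}
    (h : ∀ z : Z, ∃ (O : Z.Opens) (hO : IsAffineOpen O), z ∈ O ∧
      hO.fromSpec ≫ f = hO.fromSpec ≫ g) : f = g := by
  choose O hO hz hfg using h
  have hc : TopologicalSpace.IsOpenCover O := by
    rw [TopologicalSpace.IsOpenCover, eq_top_iff]
    exact fun z _ ↦ TopologicalSpace.Opens.mem_iSup.mpr ⟨z, hz z⟩
  refine (Z.openCoverOfIsOpenCover O hc).hom_ext _ _ fun z ↦ ?_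
  change (O z).ι ≫ f = (O z).ι ≫ g
  rw [← (hO z).isoSpec_hom_fromSpec, Category.assoc, Category.assoc, hfg z]

lemma exists_ringHom_of_mem_range {A B C : Type*} [CommRing A] [CommRing B] [CommRing C]
    (i : B →+* C) (hi : Function.Injective i) (θ : A →+* C) (h : ∀ a, θ a ∈ i.range) :
    ∃ F : A →+* B, i.comp F = θ := by
  let e : B ≃+* i.range := RingEquiv.ofBijective i.rangeRestrict
    ⟨fun x y hxy ↦ hi (congrArg Subtype.val hxy), i.rangeRestrict_surjective⟩
  refine ⟨(e.symm : i.range →+* B).comp (θ.codRestrict i.range h), RingHom.ext fun a ↦ ?_⟩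
  exact congrArg Subtype.val (e.apply_symm_apply ⟨θ a, h a⟩)

namespace QCohSubalgebra

variable {T : Scheme.{u}} {W : T.Opens} (A : QCohSubalgebra W) [IsLocallyNoetherian T]

lemma exists_fac_ι {V : T.Opens} (hV : IsAffineOpen V) {E : CommRingCat.{u}}
    (g : Spec E ⟶ A.spec) (h : ∀ x, A.specHom (g x) ∈ V) :
    ∃ F : CommRingCat.of (A.carrier ⟨V, hV⟩) ⟶ E, g = Spec.map F ≫ A.ι ⟨V, hV⟩ := by
  have hr : Set.range g ⊆ Set.range (A.ι ⟨V, hV⟩) := by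
    rintro _ ⟨x, rfl⟩
    have : g x ∈ A.specHom ⁻¹ᵁ V := h x
    rw [A.specHom_preimage hV] at this
    exact this
  obtain ⟨F, hF⟩ := Spec.map_surjective (IsOpenImmersion.lift (A.ι ⟨V, hV⟩) g hr)
  exact ⟨F, by rw [hF, IsOpenImmersion.lift_fac]⟩

lemma algebraHom_comp_eq {V : T.Opens} (hV : IsAffineOpen V) {E : CommRingCat.{u}}
    {F G : CommRingCat.of (A.carrier ⟨V, hV⟩) ⟶ E}
    (h : (Spec.map F ≫ A.ι ⟨V, hV⟩) ≫ A.specHom = (Spec.map G ≫ A.ι ⟨V, hV⟩) ≫ A.specHom) :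
    CommRingCat.ofHom (A.algebraHom ⟨V, hV⟩) ≫ F =
      CommRingCat.ofHom (A.algebraHom ⟨V, hV⟩) ≫ G := by
  rw [Category.assoc, Category.assoc, A.ι_specHom hV, ← Spec.map_comp_assoc,
    ← Spec.map_comp_assoc, cancel_mono] at h
  exact Spec.map_injective h

lemma SpecMap_ι_eq_of_le {V : T.Opens} (hV : IsAffineOpen V) (hVW : V ≤ W) {E : CommRingCat.{u}}
    {F G : CommRingCat.of (A.carrier ⟨V, hV⟩) ⟶ E}
    (h : (Spec.map F ≫ A.ι ⟨V, hV⟩) ≫ A.specHom = (Spec.map G ≫ A.ι ⟨V, hV⟩) ≫ A.specHom) :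
    F = G := by
  refine CommRingCat.hom_ext (RingHom.ext fun s ↦ ?_)
  obtain ⟨a, rfl⟩ := A.algebraHom_surjective_of_le (V := ⟨V, hV⟩) hVW s
  exact congr($(A.algebraHom_comp_eq hV h) a)

/-- Over `W` the algebra is the structure sheaf, so there the two maps agree; schematic density of
the preimage of `W` carries the equality of functions over to `Z`. -/
lemma spec_hom_ext {Z : Scheme.{u}} {f g : Z ⟶ A.spec} (h : f ≫ A.specHom = g ≫ A.specHom)
    (hd : SchDense ((f ≫ A.specHom) ⁻¹ᵁ W)) : f = g := by
  refine hom_ext_of_local fun z ↦ ?_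
  obtain ⟨V, hV, hzV, -⟩ := exists_affine_mem_le (z := (f ≫ A.specHom) z) (O := ⊤) trivial
  obtain ⟨O, hO, hzO, hOV⟩ := exists_affine_mem_le (O := (f ≫ A.specHom) ⁻¹ᵁ V) hzV
  refine ⟨O, hO, hzO, ?_⟩
  have hfV {O' : Z.Opens} (hO' : IsAffineOpen O') {V' : T.Opens}
      (le : O' ≤ (f ≫ A.specHom) ⁻¹ᵁ V') (x) : A.specHom ((hO'.fromSpec ≫ f) x) ∈ V' := by
    refine le (x := hO'.fromSpec x) ?_
    rw [← SetLike.mem_coe, ← hO'.range_fromSpec]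
    exact ⟨x, rfl⟩
  have hgV {O' : Z.Opens} (hO' : IsAffineOpen O') {V' : T.Opens}
      (le : O' ≤ (f ≫ A.specHom) ⁻¹ᵁ V') (x) : A.specHom ((hO'.fromSpec ≫ g) x) ∈ V' := by
    rw [h] at le
    refine le (x := hO'.fromSpec x) ?_
    rw [← SetLike.mem_coe, ← hO'.range_fromSpec]
    exact ⟨x, rfl⟩
  obtain ⟨F, hF⟩ := A.exists_fac_ι hV (hO.fromSpec ≫ f) (hfV hO hOV)
  obtain ⟨G, hG⟩ := A.exists_fac_ι hV (hO.fromSpec ≫ g) (hgV hO hOV)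
  rw [hF, hG]
  have hFG : F = G := by
    refine CommRingCat.hom_ext (RingHom.ext fun s ↦ sub_eq_zero.mp (hd O hO _ fun y hy hyW ↦ ?_))
    obtain ⟨b, hbW, hyb⟩ := hV.exists_basicOpen_le (V := W) ⟨(f ≫ A.specHom) y, hyW⟩ (hOV hy)
    obtain ⟨O', hO', hyO', hO'le⟩ := exists_affine_mem_le
      (O := O ⊓ (f ≫ A.specHom) ⁻¹ᵁ T.basicOpen b) ⟨hy, hyb⟩
    have le₁ : O' ≤ O := hO'le.trans inf_le_left
    have le₂ : O' ≤ (f ≫ A.specHom) ⁻¹ᵁ T.basicOpen b := hO'le.trans inf_le_right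
    obtain ⟨F', hF'⟩ := A.exists_fac_ι (hV.basicOpen b) (hO'.fromSpec ≫ f) (hfV hO' le₂)
    obtain ⟨G', hG'⟩ := A.exists_fac_ι (hV.basicOpen b) (hO'.fromSpec ≫ g) (hgV hO' le₂)
    have e : F' = G' := by
      refine A.SpecMap_ι_eq_of_le (hV.basicOpen b) hbW ?_
      rw [← hF', ← hG', Category.assoc, Category.assoc, h]
    let ρ := Z.presheaf.map (homOfLE le₁).op
    let τ := CommRingCat.ofHom (A.restrictHom (V' := ⟨T.basicOpen b, hV.basicOpen b⟩)
      (V := ⟨V, hV⟩) (T.basicOpen_le b))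
    have hρ : Spec.map ρ ≫ hO.fromSpec = hO'.fromSpec := hO.map_fromSpec hO' (homOfLE le₁).op
    have h1 : F ≫ ρ = τ ≫ F' := by
      apply Spec.map_injective
      rw [← cancel_mono (A.ι ⟨V, hV⟩), Spec.map_comp, Spec.map_comp, Category.assoc,
        Category.assoc, A.SpecMap_restrictHom_ι hV b, ← hF, ← hF', reassoc_of% hρ]
    have h2 : G ≫ ρ = τ ≫ G' := by
      apply Spec.map_injective
      rw [← cancel_mono (A.ι ⟨V, hV⟩), Spec.map_comp, Spec.map_comp, Category.assoc,
        Category.assoc, A.SpecMap_restrictHom_ι hV b, ← hG, ← hG', reassoc_of% hρ]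
    have h3 : ρ (F s) = ρ (G s) := congr($(h1.trans ((congrArg (τ ≫ ·) e).trans h2.symm)) s)
    have h4 := germ_map_apply le₁ hyO' (F s)
    have h5 := germ_map_apply le₁ hyO' (G s)
    rw [map_sub, sub_eq_zero]
    exact h4.symm.trans ((congrArg _ h3).trans h5)
  rw [hFG]

/-- Elements of `𝒜(V)` pull back to functions on a dense open part of `O`. If these extend to `O`,
the extension is unique by density, and so gives a ring homomorphism. -/
lemma exists_local_lift {Z : Scheme.{u}} (z : Z ⟶ T) (hd : SchDense (z ⁻¹ᵁ W)) {V : T.Opens}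
    (hV : IsAffineOpen V) {O : Z.Opens} (hO : IsAffineOpen O) (e : O ≤ z ⁻¹ᵁ V)
    (e' : z ⁻¹ᵁ W ⊓ O ≤ z ⁻¹ᵁ (W ⊓ V))
    (h : ∀ s ∈ A.carrier ⟨V, hV⟩,
      z.appLE (W ⊓ V) (z ⁻¹ᵁ W ⊓ O) e' s ∈ (res (z ⁻¹ᵁ W) O).range) :
    ∃ l : O.toScheme ⟶ A.spec, l ≫ A.specHom = O.ι ≫ z := by
  have hinj := hd.res_injective hO
  obtain ⟨F, hF⟩ := exists_ringHom_of_mem_range (res (z ⁻¹ᵁ W) O) hinj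
    ((z.appLE (W ⊓ V) (z ⁻¹ᵁ W ⊓ O) e').hom.comp (A.carrier ⟨V, hV⟩).subtype)
    fun s ↦ h s.1 s.2
  have hFa : CommRingCat.ofHom (A.algebraHom ⟨V, hV⟩) ≫ CommRingCat.ofHom F = z.appLE V O e := by
    refine CommRingCat.hom_ext (RingHom.ext fun a ↦ hinj ?_)
    refine (congr($hF (A.algebraHom ⟨V, hV⟩ a))).trans ?_
    have h1 : T.presheaf.map (homOfLE (inf_le_right : W ⊓ V ≤ V)).op ≫
        z.appLE (W ⊓ V) (z ⁻¹ᵁ W ⊓ O) e' = z.appLE V O e ≫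
          Z.presheaf.map (homOfLE (inf_le_right : z ⁻¹ᵁ W ⊓ O ≤ O)).op := by
      rw [Scheme.Hom.map_appLE, Scheme.Hom.appLE_map]
    exact congr($h1 a)
  refine ⟨hO.isoSpec.hom ≫ Spec.map (CommRingCat.ofHom F) ≫ A.ι ⟨V, hV⟩, ?_⟩
  rw [Category.assoc, Category.assoc, A.ι_specHom hV, ← Spec.map_comp_assoc, hFa,
    IsAffineOpen.SpecMap_appLE_fromSpec z hV hO e, ← Category.assoc, hO.isoSpec_hom_fromSpec]

/-- Local lifts agree on overlaps by `spec_hom_ext` and therefore glue. Density is assumed for every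
open immersion into `Z` because it is applied to the overlaps, which are fibre products. -/
lemma exists_lift {Z : Scheme.{u}} (z : Z ⟶ T)
    (hd : ∀ (P : Scheme.{u}) (j : P ⟶ Z) [IsOpenImmersion j], SchDense ((j ≫ z) ⁻¹ᵁ W))
    (h : ∀ x : Z, ∃ (V : T.Opens) (hV : IsAffineOpen V) (O : Z.Opens) (_ : IsAffineOpen O)
      (_ : O ≤ z ⁻¹ᵁ V) (e' : z ⁻¹ᵁ W ⊓ O ≤ z ⁻¹ᵁ (W ⊓ V)), x ∈ O ∧ ∀ s ∈ A.carrier ⟨V, hV⟩,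
      z.appLE (W ⊓ V) (z ⁻¹ᵁ W ⊓ O) e' s ∈ (res (z ⁻¹ᵁ W) O).range) :
    ∃ l : Z ⟶ A.spec, l ≫ A.specHom = z := by
  have hdz : SchDense (z ⁻¹ᵁ W) := by
    have := hd Z (𝟙 Z)
    rwa [Category.id_comp] at this
  have hl (x : Z) : ∃ (O : Z.Opens) (l : O.toScheme ⟶ A.spec), x ∈ O ∧
      l ≫ A.specHom = O.ι ≫ z := by
    obtain ⟨V, hV, O, hO, e, e', hx, hs⟩ := h x
    obtain ⟨l, hl⟩ := A.exists_local_lift z hdz hV hO e e' hs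
    exact ⟨O, l, hx, hl⟩
  choose O l hx hl using hl
  have hc : TopologicalSpace.IsOpenCover O := by
    rw [TopologicalSpace.IsOpenCover, eq_top_iff]
    exact fun z _ ↦ TopologicalSpace.Opens.mem_iSup.mpr ⟨z, hx z⟩
  have hcompat (x y : Z) : pullback.fst (O x).ι (O y).ι ≫ l x =
      pullback.snd (O x).ι (O y).ι ≫ l y := by
    have e1 : (pullback.fst (O x).ι (O y).ι ≫ l x) ≫ A.specHom =
        (pullback.fst (O x).ι (O y).ι ≫ (O x).ι) ≫ z := by
      rw [Category.assoc, hl, Category.assoc]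
    have e2 : (pullback.snd (O x).ι (O y).ι ≫ l y) ≫ A.specHom =
        (pullback.fst (O x).ι (O y).ι ≫ (O x).ι) ≫ z := by
      rw [Category.assoc, hl, pullback.condition, Category.assoc]
    refine A.spec_hom_ext (e1.trans e2.symm) ?_
    have := hd _ (pullback.fst (O x).ι (O y).ι ≫ (O x).ι)
    rw [← e1] at this
    exact this
  let 𝒰 := Z.openCoverOfIsOpenCover O hc
  refine ⟨Scheme.Cover.glueMorphisms 𝒰 l fun x y ↦ hcompat x y, ?_⟩
  refine 𝒰.hom_ext _ _ fun x ↦ ?_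
  have h₁ : 𝒰.f x ≫ Scheme.Cover.glueMorphisms 𝒰 l (fun x y ↦ hcompat x y) = l x :=
    Scheme.Cover.ι_glueMorphisms 𝒰 l _ x
  exact (Category.assoc _ _ _).symm.trans ((congrArg (· ≫ A.specHom) h₁).trans (hl x))

end QCohSubalgebra

end NewtonGroupoid

/-! ### Closeness of two points, an equivalence relation -/

namespace NewtonGroupoid

/-- The congruences between two ring homomorphisms `α`, `β` that define a point of the `r`-th
Newton groupoid over a chart. -/
structure Close {S R B : Type*} [CommRing S] [CommRing R] [CommRing B] (r : ℕ) (d : R)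
    (σ : S →+* R) (α β : R →+* B) : Prop where
  dvd : α d ∣ β d
  dvd' : β d ∣ α d
  sub (s : R) : α d ^ (r - 1) ∣ α s - β s
  sub_comp (s : S) : α d ^ r ∣ α (σ s) - β (σ s)

namespace Close

variable {S R B C : Type*} [CommRing S] [CommRing R] [CommRing B] [CommRing C] {r : ℕ} {d : R}
  {σ : S →+* R} {α β γ : R →+* B}

lemma refl (α : R →+* B) : Close r d σ α α :=
  ⟨dvd_rfl, dvd_rfl, fun s ↦ by simp, fun s ↦ by simp⟩

lemma symm (h : Close r d σ α β) : Close r d σ β α :=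
  ⟨h.dvd', h.dvd, fun s ↦ (pow_dvd_pow_of_dvd h.dvd' _).trans (dvd_sub_comm.mp (h.sub s)),
    fun s ↦ (pow_dvd_pow_of_dvd h.dvd' _).trans (dvd_sub_comm.mp (h.sub_comp s))⟩

/-- Divisibility of `β d` by `α d` turns congruences modulo powers of `β d` into congruences modulo
powers of `α d`. -/
lemma trans (h : Close r d σ α β) (h' : Close r d σ β γ) : Close r d σ α γ := by
  refine ⟨h.dvd.trans h'.dvd, h'.dvd'.trans h.dvd', fun s ↦ ?_, fun s ↦ ?_⟩
  · rw [← sub_add_sub_cancel _ (β s)]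
    exact dvd_add (h.sub s) ((pow_dvd_pow_of_dvd h.dvd _).trans (h'.sub s))
  · rw [← sub_add_sub_cancel _ (β (σ s))]
    exact dvd_add (h.sub_comp s) ((pow_dvd_pow_of_dvd h.dvd _).trans (h'.sub_comp s))

lemma comp (h : Close r d σ α β) (f : B →+* C) : Close r d σ (f.comp α) (f.comp β) := by
  refine ⟨map_dvd f h.dvd, map_dvd f h.dvd', fun s ↦ ?_, fun s ↦ ?_⟩
  · have := map_dvd f (h.sub s)
    rwa [map_pow, map_sub] at this
  · have := map_dvd f (h.sub_comp s)
    rwa [map_pow, map_sub] at this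

end Close

variable {k : Type u} [Field k] {X Y : Scheme.{u}} (φ : X ⟶ Y) (q : Y ⟶ Spec (.of k))

/-- The conditions on two points `a`, `b` of `X` with values in a scheme under which the pair
`(a, b)` is, generically, a point of the `r`-th Newton groupoid. -/
def Good (r : ℕ) {Z : Scheme.{u}} (a b : Z ⟶ X) : Prop :=
  ∀ z : Z, (a z ∈ etaleLocus φ ∧ b z ∈ etaleLocus φ) ∨ (a z = b z ∧
    ∀ c : Chart φ q, a z ∈ c.V → ∃ (O : Z.Opens) (ha : O ≤ a ⁻¹ᵁ c.V) (hb : O ≤ b ⁻¹ᵁ c.V),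
      z ∈ O ∧ Close r c.P.det (φ.appLE c.O c.V c.le).hom (a.appLE c.V O ha).hom
        (b.appLE c.V O hb).hom)

namespace Good

variable {φ q} {r : ℕ} {Z Z' : Scheme.{u}} {a b c : Z ⟶ X}

lemma refl (a : Z ⟶ X) : Good φ q r a a := fun _ ↦
  .inr ⟨rfl, fun c hc ↦ ⟨a ⁻¹ᵁ c.V, le_rfl, le_rfl, hc, .refl _⟩⟩

lemma symm (h : Good φ q r a b) : Good φ q r b a := fun z ↦ by
  rcases h z with h | ⟨h₁, h₂⟩
  · exact .inl h.symm
  · refine .inr ⟨h₁.symm, fun c hc ↦ ?_⟩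
    obtain ⟨O, ha, hb, hz, h⟩ := h₂ c (h₁ ▸ hc)
    exact ⟨O, hb, ha, hz, h.symm⟩

lemma close_res {c : Chart φ q} {O O' : Z.Opens} {ha : O ≤ a ⁻¹ᵁ c.V} {hb : O ≤ b ⁻¹ᵁ c.V}
    (h : Close r c.P.det (φ.appLE c.O c.V c.le).hom (a.appLE c.V O ha).hom
      (b.appLE c.V O hb).hom) (le : O' ≤ O) :
    Close r c.P.det (φ.appLE c.O c.V c.le).hom (a.appLE c.V O' (le.trans ha)).hom
      (b.appLE c.V O' (le.trans hb)).hom := by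
  have h' := h.comp (Z.presheaf.map (homOfLE le).op).hom
  rwa [← CommRingCat.hom_comp, ← CommRingCat.hom_comp, Scheme.Hom.appLE_map,
    Scheme.Hom.appLE_map] at h'

/-- Closeness is demanded in every chart around the common image point, so both conditions can be
read in the same chart. If one pair lies in `U`, the coincidence of points in the other puts all
three in `U`. -/
lemma trans (h : Good φ q r a b) (h' : Good φ q r b c) : Good φ q r a c := fun z ↦ by
  rcases h z with h | ⟨h₁, h₂⟩ <;> rcases h' z with h' | ⟨h'₁, h'₂⟩
  · exact .inl ⟨h.1, h'.2⟩
  · exact .inl ⟨h.1, h'₁ ▸ h.2⟩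
  · exact .inl ⟨h₁ ▸ h'.1, h'.2⟩
  · refine .inr ⟨h₁.trans h'₁, fun c hc ↦ ?_⟩
    obtain ⟨O, ha, hb, hz, h⟩ := h₂ c hc
    obtain ⟨O', ha', hb', hz', h'⟩ := h'₂ c (h₁ ▸ hc)
    exact ⟨O ⊓ O', inf_le_left.trans ha, inf_le_right.trans hb', ⟨hz, hz'⟩,
      (close_res h inf_le_left).trans (close_res h' inf_le_right)⟩

lemma precomp (h : Good φ q r a b) (f : Z' ⟶ Z) : Good φ q r (f ≫ a) (f ≫ b) := fun z ↦ by
  rcases h (f z) with h | ⟨h₁, h₂⟩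
  · exact .inl h
  · refine .inr ⟨h₁, fun c hc ↦ ?_⟩
    obtain ⟨O, ha, hb, hz, h⟩ := h₂ c hc
    refine ⟨f ⁻¹ᵁ O, fun y hy ↦ ha (x := f y) hy, fun y hy ↦ hb (x := f y) hy, hz, ?_⟩
    have h' := h.comp (f.appLE O (f ⁻¹ᵁ O) le_rfl).hom
    rwa [← CommRingCat.hom_comp, ← CommRingCat.hom_comp, Scheme.Hom.appLE_comp_appLE,
      Scheme.Hom.appLE_comp_appLE] at h'

lemma preimage_eq (h : Good φ q r a b) : a ⁻¹ᵁ etaleLocus φ = b ⁻¹ᵁ etaleLocus φ := by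
  ext z
  change a z ∈ etaleLocus φ ↔ b z ∈ etaleLocus φ
  rcases h z with h | ⟨h, -⟩
  · exact iff_of_true h.1 h.2
  · rw [h]

end Good

end NewtonGroupoid

/-! ### The universal property of `Γ_r` -/

namespace NewtonGroupoid

lemma mem_twist_iff_of_span {T : Scheme.{u}} {W : T.Opens} {I D : T.IdealSheafData} {m : ℕ}
    {V : T.affineOpens} {d : Γ(T, V.1)} (hd : (D ^ m).ideal V = Ideal.span {d})
    (s : Γ(T, W ⊓ V.1)) :
    s ∈ twist W I D m V ↔ ∃ i ∈ I.ideal V, res W V.1 d * s = res W V.1 i := by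
  rw [mem_twist_iff, hd, Ideal.span_singleton_le_iff_mem]
  rfl

variable {k : Type u} [Field k] {X Y : Scheme.{u}} {φ : X ⟶ Y} {q : Y ⟶ Spec (.of k)}

lemma Chart.isUnit_appLE_det (c : Chart φ q) {Z : Scheme.{u}} {f : Z ⟶ X} {O : Z.Opens}
    (e : O ≤ f ⁻¹ᵁ c.V) (h : O ≤ f ⁻¹ᵁ etaleLocus φ) : IsUnit (f.appLE c.V O e c.P.det) := by
  have e' : O ≤ f ⁻¹ᵁ X.basicOpen c.P.det := by
    rw [c.basicOpen_det]
    exact le_inf h e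
  rw [← Scheme.Hom.map_appLE f e' (homOfLE (X.basicOpen_le c.P.det)).op]
  exact (RingedSpace.isUnit_res_basicOpen _ c.P.det).map (f.appLE _ O e').hom

section

variable {T : Scheme.{u}} {pr : T ⟶ X}

lemma Chart.comap_different_pow_ideal (hc : ∀ x : X, ∃ c : Chart φ q, x ∈ c.V) (c : Chart φ q)
    {V : T.Opens} (hV : IsAffineOpen V) (e : V ≤ pr ⁻¹ᵁ c.V) (m : ℕ) :
    (((different φ).comap pr) ^ m).ideal ⟨V, hV⟩ = Ideal.span {pr.appLE c.V V e c.P.det ^ m} := by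
  rw [Scheme.IdealSheafData.ideal_pow]
  change ((different φ).comap pr).ideal ⟨V, hV⟩ ^ m = _
  rw [comap_ideal _ pr hV c.hV e, c.different_ideal hc, Ideal.map_span, Set.image_singleton,
    Ideal.span_singleton_pow]

/-- The equation of the divisor is invertible on `W`, so `i / d ^ m` is a function there. It is a
section of the twist, hence a function on the relative spectrum. -/
lemma Chart.pow_dvd_specHom_app (hc : ∀ x : X, ∃ c : Chart φ q, x ∈ c.V) (c : Chart φ q)
    {V : T.Opens} (hV : IsAffineOpen V) (e : V ≤ pr ⁻¹ᵁ c.V) [IsLocallyNoetherian T] {W : T.Opens} (A : QCohSubalgebra W)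
    (hW : W ≤ pr ⁻¹ᵁ etaleLocus φ) (I : T.IdealSheafData) (m : ℕ)
    (hA : twist W I ((different φ).comap pr) m ⟨V, hV⟩ ⊆ A.carrier ⟨V, hV⟩) (i : Γ(T, V))
    (hi : i ∈ I.ideal ⟨V, hV⟩) :
    A.specHom.app V (pr.appLE c.V V e c.P.det) ^ m ∣ A.specHom.app V i := by
  obtain ⟨σ, hσ⟩ := A.exists_sections hV
  have hu : IsUnit (res W V (pr.appLE c.V V e c.P.det)) := by
    have h1 := c.isUnit_appLE_det (f := pr) (O := W ⊓ V) (inf_le_right.trans e)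
      (inf_le_left.trans hW)
    rw [← Scheme.Hom.appLE_map pr e (homOfLE (inf_le_right : W ⊓ V ≤ V)).op] at h1
    exact h1
  obtain ⟨v, hv⟩ := hu.exists_right_inv
  have hy : v ^ m * res W V i ∈ A.carrier ⟨V, hV⟩ := by
    refine hA ((mem_twist_iff_of_span (c.comap_different_pow_ideal hc hV e m) _).mpr ⟨i, hi, ?_⟩)
    change res W V _ * _ = res W V _
    rw [map_pow, ← mul_assoc, ← mul_pow, hv, one_pow, one_mul]
  have h2 : A.algebraHom ⟨V, hV⟩ (pr.appLE c.V V e c.P.det) ^ m * ⟨_, hy⟩ =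
      A.algebraHom ⟨V, hV⟩ i := by
    refine Subtype.ext ?_
    change res W V _ ^ m * (v ^ m * res W V i) = res W V _
    rw [← mul_assoc, ← mul_pow, hv, one_pow, one_mul]
  have h3 := congrArg σ h2
  rw [map_mul, map_pow, hσ, hσ] at h3
  exact ⟨_, h3.symm⟩

/-- On the relative spectrum each `i ∈ I` is a multiple of `d ^ m` with `m` positive, so it vanishes
where `d` does. -/
lemma mem_support_of_notMem_etaleLocus (hc : ∀ x : X, ∃ c : Chart φ q, x ∈ c.V)
    [IsLocallyNoetherian T] {W : T.Opens} (A : QCohSubalgebra W)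
    (hW : W ≤ pr ⁻¹ᵁ etaleLocus φ) (I : T.IdealSheafData) (m : ℕ)
    (hA : ∀ V, twist W I ((different φ).comap pr) m V ⊆ A.carrier V) (hm : m ≠ 0) (γ : A.spec)
    (hγ : pr (A.specHom γ) ∉ etaleLocus φ) : A.specHom γ ∈ I.support := by
  obtain ⟨c, hcγ⟩ := hc (pr (A.specHom γ))
  obtain ⟨V, hV, hγV, e⟩ := exists_affine_mem_le (O := pr ⁻¹ᵁ c.V) hcγ
  rw [Scheme.IdealSheafData.mem_support_iff_of_mem (U := ⟨V, hV⟩) hγV, Scheme.mem_zeroLocus_iff]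
  intro i hi hγi
  apply hγ
  have h1 : γ ∈ A.spec.basicOpen (A.specHom.app V i) := by
    rw [← Scheme.preimage_basicOpen]
    exact hγi
  obtain ⟨y, hy⟩ := c.pow_dvd_specHom_app hc hV e A hW I m (hA _) i hi
  rw [hy, Scheme.basicOpen_mul, Scheme.basicOpen_pow _ _ (Nat.pos_of_ne_zero hm)] at h1
  have h2 := h1.1
  rw [← Scheme.preimage_basicOpen] at h2
  have h3 : A.specHom γ ∈ T.basicOpen (pr.appLE c.V V e c.P.det) := h2
  have h4 : T.basicOpen (pr.appLE c.V V e c.P.det) = V ⊓ pr ⁻¹ᵁ X.basicOpen c.P.det :=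
    Scheme.basicOpen_appLE _ _ _ e c.P.det
  rw [h4, c.basicOpen_det] at h3
  exact h3.2.1

end

section

variable [IsLocallyNoetherian (pullback (φ ≫ q) (φ ≫ q))]

variable (φ q) in
/-- The open subscheme `U × U` of `X × X`. -/
noncomputable abbrev squareLocus : (pullback (φ ≫ q) (φ ≫ q)).Opens :=
  pullback.fst (φ ≫ q) (φ ≫ q) ⁻¹ᵁ etaleLocus φ ⊓ pullback.snd (φ ≫ q) (φ ≫ q) ⁻¹ᵁ etaleLocus φ

lemma twist_subset_newtonAlgebra (r : ℕ) (V : (pullback (φ ≫ q) (φ ≫ q)).affineOpens) :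
    twist (squareLocus φ q) (pullback.diagonal (φ ≫ q)).ker
        ((different φ).comap (pullback.fst (φ ≫ q) (φ ≫ q))) (r - 1) V ⊆
        (newtonAlgebra φ q r).carrier V ∧
      twist (squareLocus φ q) (pullback.mapDesc φ φ q).ker
        ((different φ).comap (pullback.fst (φ ≫ q) (φ ≫ q))) r V ⊆
        (newtonAlgebra φ q r).carrier V ∧
      twist (squareLocus φ q) (pullback.diagonal (φ ≫ q)).ker
        ((different φ).comap (pullback.snd (φ ≫ q) (φ ≫ q))) (r - 1) V ⊆
        (newtonAlgebra φ q r).carrier V :=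
  ⟨fun _ hs ↦ Subring.subset_closure (.inr (.inl (.inl (.inl hs)))),
    fun _ hs ↦ Subring.subset_closure (.inr (.inl (.inl (.inr hs)))),
    fun _ hs ↦ Subring.subset_closure (.inr (.inl (.inr hs)))⟩

lemma mem_squareLocus_or_mem_range_diagonal [IsSeparated (φ ≫ q)]
    (hc : ∀ x : X, ∃ c : Chart φ q, x ∈ c.V) {r : ℕ} (hr : 2 ≤ r) (γ : newtonScheme φ q r) :
    newtonHom φ q r γ ∈ squareLocus φ q ∨
      newtonHom φ q r γ ∈ Set.range (pullback.diagonal (φ ≫ q)) := by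
  have hγ : newtonHom φ q r γ ∈ squareLocus φ q ∨
      newtonHom φ q r γ ∈ (pullback.diagonal (φ ≫ q)).ker.support := by
    by_cases h₁ : newtonP₁ φ q r γ ∈ etaleLocus φ
    · by_cases h₂ : newtonP₂ φ q r γ ∈ etaleLocus φ
      · exact .inl ⟨h₁, h₂⟩
      · exact .inr (mem_support_of_notMem_etaleLocus (pr := pullback.snd (φ ≫ q) (φ ≫ q)) hc
          (newtonAlgebra φ q r) inf_le_right _ (r - 1)
          (fun V ↦ (twist_subset_newtonAlgebra r V).2.2) (by omega) γ h₂)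
    · exact .inr (mem_support_of_notMem_etaleLocus (pr := pullback.fst (φ ≫ q) (φ ≫ q)) hc
          (newtonAlgebra φ q r) inf_le_left _ (r - 1)
          (fun V ↦ (twist_subset_newtonAlgebra r V).1) (by omega) γ h₁)
  refine hγ.imp_right fun hγ ↦ ?_
  have h1 := Scheme.Hom.support_ker (pullback.diagonal (φ ≫ q))
  rw [(pullback.diagonal (φ ≫ q)).isClosedEmbedding.isClosed_range.closure_eq] at h1
  rw [← h1]
  exact hγ

/-- Points outside `U × U` lie over the diagonal, and around them the twists translate into the
divisibilities of `Close`. -/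
lemma good_newton [IsSeparated (φ ≫ q)] [IsSeparated q]
    (hc : ∀ x : X, ∃ c : Chart φ q, x ∈ c.V) {r : ℕ} (hr : 2 ≤ r) :
    Good φ q r (newtonP₁ φ q r) (newtonP₂ φ q r) := by
  intro γ
  rcases mem_squareLocus_or_mem_range_diagonal hc hr γ with hγ | ⟨x, hx⟩
  · exact .inl hγ
  have e₁ : newtonP₁ φ q r γ = x := by
    rw [newtonP₁, Scheme.Hom.comp_apply, ← hx, ← Scheme.Hom.comp_apply, pullback.diagonal_fst]
    rfl
  have e₂ : newtonP₂ φ q r γ = x := by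
    rw [newtonP₂, Scheme.Hom.comp_apply, ← hx, ← Scheme.Hom.comp_apply, pullback.diagonal_snd]
    rfl
  refine .inr ⟨e₁.trans e₂.symm, fun c hcγ ↦ ?_⟩
  have hcγ' : newtonP₂ φ q r γ ∈ c.V := by rwa [e₂, ← e₁]
  have hV := isAffineOpen_squareOpen (φ ≫ q) c.hV
  have hl := squareOpen_le_fst (φ ≫ q) c.V
  have hr' := squareOpen_le_snd (φ ≫ q) c.V
  let t := newtonHom φ q r
  refine ⟨t ⁻¹ᵁ squareOpen (φ ≫ q) c.V, fun y hy ↦ hl (x := t y) hy,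
    fun y hy ↦ hr' (x := t y) hy, ⟨hcγ, hcγ'⟩, ?_⟩
  have hα : (newtonP₁ φ q r).appLE c.V (t ⁻¹ᵁ squareOpen (φ ≫ q) c.V)
      (fun y hy ↦ hl (x := t y) hy) = leftHom (φ ≫ q) c.V ≫ t.app _ := by
    rw [leftHom, Scheme.Hom.app_eq_appLE, Scheme.Hom.appLE_comp_appLE]
    rfl
  have hβ : (newtonP₂ φ q r).appLE c.V (t ⁻¹ᵁ squareOpen (φ ≫ q) c.V)
      (fun y hy ↦ hr' (x := t y) hy) = rightHom (φ ≫ q) c.V ≫ t.app _ := by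
    rw [rightHom, Scheme.Hom.app_eq_appLE, Scheme.Hom.appLE_comp_appLE]
    rfl
  rw [hα, hβ]
  have hmem (s : Γ(X, c.V)) : leftHom (φ ≫ q) c.V s - rightHom (φ ≫ q) c.V s ∈
      (pullback.diagonal (φ ≫ q)).ker.ideal ⟨_, hV⟩ := by
    rw [diagonal_ker_ideal (φ ≫ q) c.hV]
    exact Ideal.subset_span ⟨s, rfl⟩
  have hmem' (s : Γ(Y, c.O)) : leftHom (φ ≫ q) c.V (φ.appLE c.O c.V c.le s) -
      rightHom (φ ≫ q) c.V (φ.appLE c.O c.V c.le s) ∈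
      (pullback.mapDesc φ φ q).ker.ideal ⟨_, hV⟩ := by
    rw [mapDesc_ker_ideal φ q c.hV c.hO c.le]
    exact Ideal.subset_span ⟨s, rfl⟩
  have h₁ (s : Γ(X, c.V)) : t.app _ (leftHom (φ ≫ q) c.V c.P.det) ^ (r - 1) ∣
      t.app _ (leftHom (φ ≫ q) c.V s) - t.app _ (rightHom (φ ≫ q) c.V s) := by
    rw [← map_sub]
    exact c.pow_dvd_specHom_app hc hV hl (newtonAlgebra φ q r) inf_le_left _ (r - 1)
      (twist_subset_newtonAlgebra r _).1 _ (hmem s)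
  have h₂ (s : Γ(Y, c.O)) : t.app _ (leftHom (φ ≫ q) c.V c.P.det) ^ r ∣
      t.app _ (leftHom (φ ≫ q) c.V (φ.appLE c.O c.V c.le s)) -
        t.app _ (rightHom (φ ≫ q) c.V (φ.appLE c.O c.V c.le s)) := by
    rw [← map_sub]
    exact c.pow_dvd_specHom_app hc hV hl (newtonAlgebra φ q r) inf_le_left _ r
      (twist_subset_newtonAlgebra r _).2.1 _ (hmem' s)
  -- Mutual divisibility of the determinants: each divides the difference of the two, by the twists
  -- of the diagonal ideal along the two divisors, because `r - 1` is positive.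
  have h₃ : t.app _ (rightHom (φ ≫ q) c.V c.P.det) ^ (r - 1) ∣
      t.app _ (leftHom (φ ≫ q) c.V c.P.det) - t.app _ (rightHom (φ ≫ q) c.V c.P.det) := by
    rw [← map_sub]
    exact c.pow_dvd_specHom_app hc hV hr' (newtonAlgebra φ q r) inf_le_right _ (r - 1)
      (twist_subset_newtonAlgebra r _).2.2 _ (hmem _)
  have hr1 : r - 1 ≠ 0 := by omega
  exact ⟨(dvd_sub_right dvd_rfl).mp ((dvd_pow_self _ hr1).trans (h₁ c.P.det)),
    (dvd_sub_left dvd_rfl).mp ((dvd_pow_self _ hr1).trans h₃), h₁, h₂⟩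

end

lemma map_mem_range_of_dvd {M N B B' : Type*} [CommRing M] [CommRing N] [CommRing B]
    [CommRing B'] {f : M →+* N} {θ : M →+* B} {ρ : N →+* B'} {g : B →+* B'}
    (h : ∀ x, ρ (f x) = g (θ x)) {d i : M} {m : ℕ} (hi : θ d ^ m ∣ θ i) (hu : IsUnit (g (θ d)))
    {s : N} (hs : f (d ^ m) * s = f i) : ρ s ∈ g.range := by
  obtain ⟨y, hy⟩ := hi
  refine ⟨y, (hu.pow m).mul_left_cancel ?_⟩
  have h1 := congrArg ρ hs
  rw [map_mul, h, h, hy, map_mul, map_pow, map_pow] at h1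
  exact h1.symm

lemma appLE_res {Z T : Scheme.{u}} (z : Z ⟶ T) {W V : T.Opens} {O : Z.Opens} (e : O ≤ z ⁻¹ᵁ V)
    (e' : z ⁻¹ᵁ W ⊓ O ≤ z ⁻¹ᵁ (W ⊓ V)) (a : Γ(T, V)) :
    z.appLE (W ⊓ V) (z ⁻¹ᵁ W ⊓ O) e' (res W V a) = res (z ⁻¹ᵁ W) O (z.appLE V O e a) := by
  have h1 : T.presheaf.map (homOfLE (inf_le_right : W ⊓ V ≤ V)).op ≫
      z.appLE (W ⊓ V) (z ⁻¹ᵁ W ⊓ O) e' = z.appLE V O e ≫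
        Z.presheaf.map (homOfLE (inf_le_right : z ⁻¹ᵁ W ⊓ O ≤ O)).op := by
    rw [Scheme.Hom.map_appLE, Scheme.Hom.appLE_map]
  exact congr($h1 a)

lemma appLE_congr_hom {Z T : Scheme.{u}} {f g : Z ⟶ T} (h : f = g) {V : T.Opens} {O : Z.Opens}
    (e : O ≤ f ⁻¹ᵁ V) (e' : O ≤ g ⁻¹ᵁ V) : f.appLE V O e = g.appLE V O e' := by
  subst h
  rfl

lemma map_mem_range_of_close {S R M N B B' : Type*} [CommRing S] [CommRing R] [CommRing M]
    [CommRing N] [CommRing B] [CommRing B'] {f : M →+* N} {θ : M →+* B} {ρ : N →+* B'}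
    {g : B →+* B'} (h : ∀ x, ρ (f x) = g (θ x)) {d : M} {m : ℕ} {α β : R →+* M} (σ : S →+* R)
    (hd : ∀ s, θ d ^ m ∣ θ (α (σ s)) - θ (β (σ s))) (hu : IsUnit (g (θ d)))
    {s : N} (hs : ∃ i ∈ Ideal.span (Set.range fun s ↦ α (σ s) - β (σ s)),
      f (d ^ m) * s = f i) : ρ s ∈ g.range := by
  obtain ⟨i, hi, hs⟩ := hs
  refine map_mem_range_of_dvd h ?_ hu hs
  have : Ideal.span (Set.range fun s ↦ α (σ s) - β (σ s)) ≤
      (Ideal.span {θ d ^ m}).comap θ := by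
    refine Ideal.span_le.mpr ?_
    rintro _ ⟨s, rfl⟩
    rw [SetLike.mem_coe, Ideal.mem_comap, Ideal.mem_span_singleton, map_sub]
    exact hd s
  exact Ideal.mem_span_singleton.mp (this hi)

section

variable [IsLocallyNoetherian (pullback (φ ≫ q) (φ ≫ q))]

/-- It suffices to treat the generators. Closeness gives the divisibilities by powers of `d(a)`
directly, and those by powers of `d(b)` because `d(b)` divides `d(a)`. -/
lemma map_newtonAlgebra_mem_range [IsSeparated (φ ≫ q)] [IsSeparated q]
    (hc : ∀ x : X, ∃ c : Chart φ q, x ∈ c.V) {r : ℕ} (c : Chart φ q) {Z : Scheme.{u}}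
    (z : Z ⟶ pullback (φ ≫ q) (φ ≫ q)) {O : Z.Opens} (e : O ≤ z ⁻¹ᵁ squareOpen (φ ≫ q) c.V)
    (e' : z ⁻¹ᵁ squareLocus φ q ⊓ O ≤ z ⁻¹ᵁ (squareLocus φ q ⊓ squareOpen (φ ≫ q) c.V))
    (h : Close r c.P.det (φ.appLE c.O c.V c.le).hom (leftHom (φ ≫ q) c.V ≫ z.appLE _ O e).hom
      (rightHom (φ ≫ q) c.V ≫ z.appLE _ O e).hom)
    (s) (hs : s ∈ (newtonAlgebra φ q r).carrier ⟨_, isAffineOpen_squareOpen (φ ≫ q) c.hV⟩) :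
    z.appLE _ _ e' s ∈ (res (z ⁻¹ᵁ squareLocus φ q) O).range := by
  have hV := isAffineOpen_squareOpen (φ ≫ q) c.hV
  have hl := squareOpen_le_fst (φ ≫ q) c.V
  have hr' := squareOpen_le_snd (φ ≫ q) c.V
  rw [← Subring.mem_comap (f := (z.appLE _ _ e').hom)]
  have hu (f : pullback (φ ≫ q) (φ ≫ q) ⟶ X) (hf : squareOpen (φ ≫ q) c.V ≤ f ⁻¹ᵁ c.V)
      (hW : squareLocus φ q ≤ f ⁻¹ᵁ etaleLocus φ) :
      IsUnit (res (z ⁻¹ᵁ squareLocus φ q) O (z.appLE _ O e (f.appLE _ _ hf c.P.det))) := by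
    rw [← appLE_res z e e']
    have h1 := c.isUnit_appLE_det (f := f) (O := squareLocus φ q ⊓ squareOpen (φ ≫ q) c.V)
      (inf_le_right.trans hf) (inf_le_left.trans hW)
    rw [← Scheme.Hom.appLE_map f hf (homOfLE inf_le_right).op] at h1
    exact h1.map (z.appLE _ _ e').hom
  have hu₁ := hu _ hl inf_le_left
  have hu₂ := hu _ hr' inf_le_right
  have hI₁ := diagonal_ker_ideal (φ ≫ q) c.hV
  have hI₂ := mapDesc_ker_ideal φ q c.hV c.hO c.le
  have hr := appLE_res z e e'
  refine (Subring.closure_le (t := Subring.comap (z.appLE _ _ e').hom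
    (res (z ⁻¹ᵁ squareLocus φ q) O).range)).mpr ?_ hs
  rintro s (⟨a, rfl⟩ | ((hs | hs) | hs) | hs)
  · exact ⟨_, (hr a).symm⟩
  · rw [mem_twist_iff_of_span (c.comap_different_pow_ideal hc hV hl _), hI₁] at hs
    exact map_mem_range_of_close hr (RingHom.id _) h.sub hu₁ hs
  · rw [mem_twist_iff_of_span (c.comap_different_pow_ideal hc hV hl _), hI₂] at hs
    exact map_mem_range_of_close hr (φ.appLE c.O c.V c.le).hom h.sub_comp hu₁ hs
  · rw [mem_twist_iff_of_span (c.comap_different_pow_ideal hc hV hr' _), hI₁] at hs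
    exact map_mem_range_of_close hr (RingHom.id _)
      (fun s ↦ (pow_dvd_pow_of_dvd h.dvd' _).trans (h.sub s)) hu₂ hs
  · rw [mem_twist_iff_of_span (c.comap_different_pow_ideal hc hV hr' _), hI₂] at hs
    exact map_mem_range_of_close hr (φ.appLE c.O c.V c.le).hom
      (fun s ↦ (pow_dvd_pow_of_dvd h.dvd' _).trans (h.sub_comp s)) hu₂ hs

/-- Near a point of `U` there is nothing to extend, as the algebra is the structure sheaf over `U ×
U`; elsewhere closeness makes the sections of `𝒜_r` extend. For a good pair the preimages of `U`
under `a` and `b` coincide, so density is needed for `a` only. -/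
lemma exists_newton_lift [IsSeparated (φ ≫ q)] [IsSeparated q]
    (hc : ∀ x : X, ∃ c : Chart φ q, x ∈ c.V) {r : ℕ} {Z : Scheme.{u}} (a b : Z ⟶ X)
    (hab : a ≫ φ ≫ q = b ≫ φ ≫ q) (hg : Good φ q r a b)
    (hd : ∀ (P : Scheme.{u}) (j : P ⟶ Z) [IsOpenImmersion j],
      SchDense ((j ≫ a) ⁻¹ᵁ etaleLocus φ)) :
    ∃ l : Z ⟶ newtonScheme φ q r, l ≫ newtonP₁ φ q r = a ∧ l ≫ newtonP₂ φ q r = b := by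
  obtain ⟨z, hza, hzb⟩ : ∃ z : Z ⟶ pullback (φ ≫ q) (φ ≫ q), z ≫ pullback.fst _ _ = a ∧
      z ≫ pullback.snd _ _ = b := ⟨pullback.lift a b hab, pullback.lift_fst _ _ _,
      pullback.lift_snd _ _ _⟩
  have hzW : z ⁻¹ᵁ squareLocus φ q = a ⁻¹ᵁ etaleLocus φ := by
    have h1 : z ⁻¹ᵁ squareLocus φ q = a ⁻¹ᵁ etaleLocus φ ⊓ b ⁻¹ᵁ etaleLocus φ := by
      rw [← hza, ← hzb]
      rfl
    rw [h1, ← hg.preimage_eq, inf_idem]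
  have hlift : ∃ l : Z ⟶ (newtonAlgebra φ q r).spec, l ≫ (newtonAlgebra φ q r).specHom = z := by
    refine QCohSubalgebra.exists_lift _ z (fun P j hj ↦ ?_) fun x ↦ ?_
    · rw [Scheme.Hom.comp_preimage, hzW]
      exact hd P j
    · rcases hg x with h | ⟨h₁, h₂⟩
      · have hx : z x ∈ squareLocus φ q := by
          change x ∈ z ⁻¹ᵁ squareLocus φ q
          rw [hzW]
          exact h.1
        obtain ⟨V, hV, hxV, hVW⟩ := exists_affine_mem_le hx
        obtain ⟨O, hO, hxO, e⟩ := exists_affine_mem_le (O := z ⁻¹ᵁ V) hxV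
        have e' : z ⁻¹ᵁ squareLocus φ q ⊓ O ≤ z ⁻¹ᵁ (squareLocus φ q ⊓ V) :=
          inf_le_inf_left _ e
        refine ⟨V, hV, O, hO, e, e', hxO, fun s hs ↦ ?_⟩
        obtain ⟨y, hy⟩ := (newtonAlgebra φ q r).algebraHom_surjective_of_le (V := ⟨V, hV⟩) hVW
          ⟨s, hs⟩
        have hy' : res (squareLocus φ q) V y = s := congrArg Subtype.val hy
        rw [← hy']
        exact ⟨_, (appLE_res z e e' y).symm⟩
      · obtain ⟨c, hxc⟩ := hc (a x)
        obtain ⟨O', ha', hb', hxO', hcl'⟩ := h₂ c hxc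
        obtain ⟨O, hO, hxO, hOO'⟩ := exists_affine_mem_le hxO'
        have hcl := Good.close_res hcl' hOO'
        have e : O ≤ z ⁻¹ᵁ squareOpen (φ ≫ q) c.V := fun y hy ↦ by
          have h1 : a y ∈ c.V := ha' (hOO' hy)
          have h2 : b y ∈ c.V := hb' (hOO' hy)
          rw [← hza] at h1
          rw [← hzb] at h2
          exact ⟨h1, h2⟩
        have e' : z ⁻¹ᵁ squareLocus φ q ⊓ O ≤
            z ⁻¹ᵁ (squareLocus φ q ⊓ squareOpen (φ ≫ q) c.V) := inf_le_inf_left _ e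
        refine ⟨_, isAffineOpen_squareOpen (φ ≫ q) c.hV, O, hO, e, e', hxO,
          map_newtonAlgebra_mem_range hc c z e e' ?_⟩
        rw [leftHom, rightHom, Scheme.Hom.appLE_comp_appLE, Scheme.Hom.appLE_comp_appLE,
          appLE_congr_hom hza _ (hOO'.trans ha'), appLE_congr_hom hzb _ (hOO'.trans hb')]
        exact hcl
  obtain ⟨l, hl⟩ := hlift
  refine ⟨l, ?_, ?_⟩
  · rw [← hza, ← hl, Category.assoc]
    rfl
  · rw [← hzb, ← hl, Category.assoc]
    rfl

lemma newton_hom_ext {r : ℕ} {Z : Scheme.{u}} {f g : Z ⟶ newtonScheme φ q r}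
    (h₁ : f ≫ newtonP₁ φ q r = g ≫ newtonP₁ φ q r) (h₂ : f ≫ newtonP₂ φ q r = g ≫ newtonP₂ φ q r)
    (hg : Good φ q r (f ≫ newtonP₁ φ q r) (f ≫ newtonP₂ φ q r))
    (hd : SchDense ((f ≫ newtonP₁ φ q r) ⁻¹ᵁ etaleLocus φ)) : f = g := by
  refine QCohSubalgebra.spec_hom_ext (newtonAlgebra φ q r) ?_ ?_
  · apply pullback.hom_ext
    · exact (Category.assoc _ _ _).trans (h₁.trans (Category.assoc _ _ _).symm)
    · exact (Category.assoc _ _ _).trans (h₂.trans (Category.assoc _ _ _).symm)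
  · have h3 : (f ≫ (newtonAlgebra φ q r).specHom) ⁻¹ᵁ squareLocus φ q =
        (f ≫ newtonP₁ φ q r) ⁻¹ᵁ etaleLocus φ ⊓ (f ≫ newtonP₂ φ q r) ⁻¹ᵁ etaleLocus φ := rfl
    have h4 := congrArg SchDense (h3.trans (by rw [← hg.preimage_eq, inf_idem]))
    exact h4.mpr hd

end

end NewtonGroupoid

/-! ### Flatness of the first projection -/

namespace NewtonGroupoid

lemma flat_of_local {Z X : Scheme.{u}} (f : Z ⟶ X)
    (h : ∀ z : Z, ∃ (P : Scheme.{u}) (j : P ⟶ Z) (_ : IsOpenImmersion j),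
      z ∈ j.opensRange ∧ Flat (j ≫ f)) : Flat f := by
  choose P j hj hz hf using h
  have hc : TopologicalSpace.IsOpenCover fun z ↦ (j z).opensRange := by
    rw [TopologicalSpace.IsOpenCover, eq_top_iff]
    exact fun z _ ↦ TopologicalSpace.Opens.mem_iSup.mpr ⟨z, hz z⟩
  have := HasRingHomProperty.instIsZariskiLocalAtSource (P := @Flat.{u})
  have key (z : Z) : Flat ((j z).opensRange.ι ≫ f) := by
    rw [← (j z).isoOpensRange_inv_comp, Category.assoc]
    have := hf z
    infer_instance
  exact (IsZariskiLocalAtSource.iff_of_openCover (P := @Flat.{u})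
    (Z.openCoverOfIsOpenCover _ hc)).mpr fun z ↦ key z

lemma map_mem_nonZeroDivisors_of_flat {A B : Type*} [CommRing A] [CommRing B] {f : A →+* B}
    (hf : f.Flat) {d : A} (hd : d ∈ nonZeroDivisors A) : f d ∈ nonZeroDivisors B := by
  algebraize [f]
  have h1 : IsSMulRegular A d := fun x y hxy ↦ (mul_cancel_left_mem_nonZeroDivisors hd).mp hxy
  have h2 : IsSMulRegular B (algebraMap A B d) := h1.of_flat
  rw [mem_nonZeroDivisors_iff_right]
  intro x hx
  have h3 : algebraMap A B d • x = algebraMap A B d • (0 : B) := by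
    rw [smul_zero, smul_eq_mul, mul_comm]
    exact hx
  exact h2 h3

section

variable {k : Type u} [Field k] {X Y : Scheme.{u}} {φ : X ⟶ Y} {q : Y ⟶ Spec (.of k)}

lemma eq_zero_of_forall_germ_eq_zero {Z : Scheme.{u}} {O : Z.Opens} (s : Γ(Z, O))
    (h : ∀ z (hz : z ∈ O), Z.presheaf.germ O z hz s = 0) : s = 0 :=
  TopCat.Presheaf.section_ext Z.sheaf O s 0 fun z hz ↦ (h z hz).trans (map_zero _).symm

/-- In a chart `U` is the nonvanishing locus of a nonzerodivisor, which remains one under flat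
pullback. A function vanishing there is killed by a power of it. -/
lemma schDense_of_flat (hc : ∀ x : X, ∃ c : Chart φ q, x ∈ c.V) {Z : Scheme.{u}} (a : Z ⟶ X)
    [Flat a] : SchDense (a ⁻¹ᵁ etaleLocus φ) := by
  intro O hO s hs
  refine eq_zero_of_forall_germ_eq_zero s fun z hz ↦ ?_
  obtain ⟨c, hzc⟩ := hc (a z)
  obtain ⟨O', hO', hzO', hle⟩ := exists_affine_mem_le (O := O ⊓ a ⁻¹ᵁ c.V) ⟨hz, hzc⟩
  have h₁ : O' ≤ O := hle.trans inf_le_left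
  have h₂ : O' ≤ a ⁻¹ᵁ c.V := hle.trans inf_le_right
  have hd : a.appLE c.V O' h₂ c.P.det ∈ nonZeroDivisors Γ(Z, O') :=
    map_mem_nonZeroDivisors_of_flat (a.flat_appLE c.hV hO' h₂) c.det_mem
  have hb : Z.basicOpen (a.appLE c.V O' h₂ c.P.det) ≤ a ⁻¹ᵁ etaleLocus φ := by
    have h3 : Z.basicOpen (a.appLE c.V O' h₂ c.P.det) = O' ⊓ a ⁻¹ᵁ X.basicOpen c.P.det :=
      Scheme.basicOpen_appLE _ _ _ h₂ c.P.det
    rw [h3, c.basicOpen_det]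
    exact fun y hy ↦ hy.2.1
  generalize a.appLE c.V O' h₂ c.P.det = d at hd hb
  have h4 : Z.presheaf.map (homOfLE h₁).op s = 0 := by
    have h5 : Z.presheaf.map (homOfLE (Z.basicOpen_le d)).op (Z.presheaf.map (homOfLE h₁).op s) =
        0 := by
      refine eq_zero_of_forall_germ_eq_zero _ fun y hy ↦ ?_
      rw [germ_map_apply (Z.basicOpen_le d) hy, germ_map_apply h₁]
      exact hs y _ (hb hy)
    obtain ⟨n, hn⟩ := exists_of_map_eq hO'.isCompact hO'.isQuasiSeparated d rfl (Z.basicOpen_le d)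
      (Z.presheaf.map (homOfLE h₁).op s) 0 (h5.trans (map_zero _).symm)
    rw [mul_zero] at hn
    exact (mul_left_mem_nonZeroDivisors_eq_zero_iff (pow_mem hd n)).mp hn
  rw [← germ_map_apply h₁ hzO', h4, map_zero]

/-- The diagonal of the unramified `K → S` is open: some `t` in `S ⊗ S` annihilates all `x ⊗ 1 - 1 ⊗
x` and has product `1`. Here `h` lifts the image of `t` in `M / J`, where `α` and `β` agree on `K`.
-/
lemma exists_separating_element {K S R M : Type*} [CommRing K] [CommRing S] [CommRing R]
    [CommRing M] {s : K →+* S} (hs : s.Etale) (α β : S →+* M) (J : Ideal M)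
    (hJ : ∀ x, α (s x) - β (s x) ∈ J) (F : M →+* R) (hF : F.comp α = F.comp β)
    (hFJ : J ≤ RingHom.ker F) : ∃ h : M, (∀ x, h * (α x - β x) ∈ J) ∧ F h = 1 := by
  obtain ⟨π, hπ, hker⟩ : ∃ π : M →+* M ⧸ J, Function.Surjective π ∧ ∀ x, π x = 0 ↔ x ∈ J :=
    ⟨Ideal.Quotient.mk J, Ideal.Quotient.mk_surjective, fun x ↦ Ideal.Quotient.eq_zero_iff_mem⟩
  have hπs : (π.comp α).comp s = (π.comp β).comp s := RingHom.ext fun x ↦ by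
    refine sub_eq_zero.mp ?_
    rw [RingHom.comp_apply, RingHom.comp_apply, RingHom.comp_apply, RingHom.comp_apply,
      ← map_sub, hker]
    exact hJ x
  obtain ⟨F', hF'⟩ : ∃ F' : M ⧸ J →+* R, F'.comp π = F := by
    refine ⟨RingHom.liftOfRightInverse π _ (Function.rightInverse_surjInv hπ)
      ⟨F, fun x hx ↦ hFJ ((hker x).mp hx)⟩, RingHom.ext fun x ↦ ?_⟩
    exact RingHom.liftOfRightInverse_comp_apply π _ (Function.rightInverse_surjInv hπ)
      ⟨F, fun x hx ↦ hFJ ((hker x).mp hx)⟩ x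
  algebraize [s, (π.comp α).comp s]
  obtain ⟨t, ht, ht'⟩ := (Algebra.FormallyUnramified.iff_exists_tensorProduct (R := K) (S := S)).mp
    inferInstance
  let α' : S →ₐ[K] M ⧸ J := { π.comp α with commutes' := fun _ ↦ rfl }
  let β' : S →ₐ[K] M ⧸ J := { π.comp β with commutes' := fun x ↦ congr($hπs.symm x) }
  let Θ : TensorProduct K S S →ₐ[K] M ⧸ J := Algebra.TensorProduct.productMap α' β'
  obtain ⟨h, hh⟩ := hπ (Θ t)
  refine ⟨h, fun x ↦ ?_, ?_⟩
  · rw [← hker, map_mul, hh, map_sub]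
    have h1 := congrArg Θ (ht x)
    have h2 : Θ (1 ⊗ₜ x) = π (β x) := by
      simp [Θ, β']
    have h3 : Θ (x ⊗ₜ 1) = π (α x) := by
      simp [Θ, α']
    rw [map_mul, map_sub, h2, h3, map_zero] at h1
    linear_combination -h1
  · have h1 (t : TensorProduct K S S) :
        F' (Θ t) = F (α (Algebra.TensorProduct.lmul' K (S := S) t)) := by
      induction t with
      | zero => simp only [map_zero]
      | add x y hx hy => simp only [map_add, hx, hy]
      | tmul x y =>
        have h2 : Θ (x ⊗ₜ y) = π (α x) * π (β y) := rfl
        have h3 (x : M) : F' (π x) = F x := congr($hF' x)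
        have h4 : F (α y) = F (β y) := congr($hF y)
        rw [h2, Algebra.TensorProduct.lmul'_apply_tmul, map_mul, map_mul, map_mul, h3, h3, h4]
    rw [← hF', RingHom.comp_apply, hh, h1, ht', map_one, map_one]

/-- Equality of étale coordinates does not imply equality in `Y`, except near the diagonal. The
element `h` isolates such a neighbourhood. -/
lemma exists_basicOpen_diagonal [IsSeparated (φ ≫ q)] (c : Chart φ q) (x : X)
    (hx : x ∈ c.V) :
    ∃ h : Γ(pullback (φ ≫ q) (φ ≫ q), squareOpen (φ ≫ q) c.V),
      (∀ x, h * (leftHom (φ ≫ q) c.V (φ.appLE c.O c.V c.le x) -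
        rightHom (φ ≫ q) c.V (φ.appLE c.O c.V c.le x)) ∈ Ideal.span (Set.range fun j ↦
          leftHom (φ ≫ q) c.V (φ.appLE c.O c.V c.le (c.s (.X j))) -
            rightHom (φ ≫ q) c.V (φ.appLE c.O c.V c.le (c.s (.X j))))) ∧
      pullback.diagonal (φ ≫ q) x ∈ (pullback (φ ≫ q) (φ ≫ q)).basicOpen h := by
  let VV := squareOpen (φ ≫ q) c.V
  let F := ((pullback.diagonal (φ ≫ q)).app VV).hom
  have hF : leftHom (φ ≫ q) c.V ≫ (pullback.diagonal (φ ≫ q)).app VV =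
      rightHom (φ ≫ q) c.V ≫ (pullback.diagonal (φ ≫ q)).app VV := by
    rw [leftHom, rightHom, Scheme.Hom.app_eq_appLE, Scheme.Hom.appLE_comp_appLE,
      Scheme.Hom.appLE_comp_appLE]
    exact appLE_congr_hom ((pullback.diagonal_fst _).trans (pullback.diagonal_snd _).symm) _ _
  let α : Γ(Y, c.O) →+* Γ(pullback (φ ≫ q) (φ ≫ q), VV) :=
    (φ.appLE c.O c.V c.le ≫ leftHom (φ ≫ q) c.V).hom
  let β : Γ(Y, c.O) →+* Γ(pullback (φ ≫ q) (φ ≫ q), VV) :=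
    (φ.appLE c.O c.V c.le ≫ rightHom (φ ≫ q) c.V).hom
  have hFαβ : F.comp α = F.comp β :=
    congrArg CommRingCat.Hom.hom (congrArg (φ.appLE c.O c.V c.le ≫ ·) hF)
  let J : Ideal Γ(pullback (φ ≫ q) (φ ≫ q), VV) :=
    Ideal.span (Set.range fun j ↦ α (c.s (.X j)) - β (c.s (.X j)))
  have hJ (κ) : α (c.s κ) - β (c.s κ) ∈ J := by
    have hk : (leftHom (φ ≫ q) c.V).hom.comp (algebraMap k Γ(X, c.V)) =
        (rightHom (φ ≫ q) c.V).hom.comp (algebraMap k Γ(X, c.V)) :=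
      congrArg CommRingCat.Hom.hom (leftHom_comp_algebraMap (φ ≫ q) c.hV c.fromSpec_comp)
    have h1 : ((Ideal.Quotient.mk J).comp α).comp c.s =
        ((Ideal.Quotient.mk J).comp β).comp c.s := by
      refine MvPolynomial.ringHom_ext (fun κ ↦ ?_) fun j ↦
        Ideal.Quotient.eq.mpr (Ideal.subset_span ⟨j, rfl⟩)
      refine congrArg (Ideal.Quotient.mk J) ?_
      have h2 : φ.appLE c.O c.V c.le (c.s (.C κ)) = algebraMap k Γ(X, c.V) κ :=
        (congr($(c.appLE_comp_s) (.C κ))).trans (MvPolynomial.aeval_C _ _)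
      exact (congrArg (leftHom (φ ≫ q) c.V) h2).trans ((congr($hk κ)).trans
        (congrArg (rightHom (φ ≫ q) c.V) h2).symm)
    exact Ideal.Quotient.eq.mp congr($h1 κ)
  have hFJ : J ≤ RingHom.ker F := by
    refine Ideal.span_le.mpr ?_
    rintro _ ⟨j, rfl⟩
    rw [SetLike.mem_coe, RingHom.mem_ker, map_sub, sub_eq_zero]
    exact congr($hFαβ (c.s (.X j)))
  obtain ⟨h, hh, hF1⟩ := exists_separating_element c.s_etale α β J hJ F hFαβ hFJ
  refine ⟨h, hh, ?_⟩
  change x ∈ pullback.diagonal (φ ≫ q) ⁻¹ᵁ (pullback (φ ≫ q) (φ ≫ q)).basicOpen h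
  rw [Scheme.preimage_basicOpen]
  have h3 : (pullback.diagonal (φ ≫ q)).app VV h = 1 := hF1
  rw [h3, Scheme.basicOpen_one]
  have h4 : pullback.fst (φ ≫ q) (φ ≫ q) (pullback.diagonal (φ ≫ q) x) = x := by
    rw [← Scheme.Hom.comp_apply, pullback.diagonal_fst]
    rfl
  have h5 : pullback.snd (φ ≫ q) (φ ≫ q) (pullback.diagonal (φ ≫ q) x) = x := by
    rw [← Scheme.Hom.comp_apply, pullback.diagonal_snd]
    rfl
  have h6 : pullback.fst (φ ≫ q) (φ ≫ q) (pullback.diagonal (φ ≫ q) x) ∈ c.V := by rwa [h4]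
  have h7 : pullback.snd (φ ≫ q) (φ ≫ q) (pullback.diagonal (φ ≫ q) x) ∈ c.V := by rwa [h5]
  exact ⟨h6, h7⟩

section

variable [IsLocallyNoetherian (pullback (φ ≫ q) (φ ≫ q))]

lemma blowUpAlgebra_carrier_eq {T : Scheme.{u}} [IsLocallyNoetherian T] {W V : T.Opens}
    (hV : IsAffineOpen V) (I₁ I₂ D D' : T.IdealSheafData) (r : ℕ) {d d' : Γ(T, V)}
    (hD : ∀ m, (D ^ m).ideal ⟨V, hV⟩ = Ideal.span {d ^ m})
    (hD' : ∀ m, (D' ^ m).ideal ⟨V, hV⟩ = Ideal.span {d' ^ m}) [Algebra Γ(T, V) Γ(T, W ⊓ V)]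
    (halg : algebraMap Γ(T, V) Γ(T, W ⊓ V) = res W V) :
    (blowUpAlgebra W I₁ I₂ D D' r).carrier ⟨V, hV⟩ =
      Subring.closure (Set.range (algebraMap Γ(T, V) Γ(T, W ⊓ V)) ∪
        (twistSet Γ(T, W ⊓ V) (I₁.ideal ⟨V, hV⟩) d (r - 1) ∪
          twistSet Γ(T, W ⊓ V) (I₂.ideal ⟨V, hV⟩) d r ∪
          twistSet Γ(T, W ⊓ V) (I₁.ideal ⟨V, hV⟩) d' (r - 1) ∪
          twistSet Γ(T, W ⊓ V) (I₂.ideal ⟨V, hV⟩) d' r)) := by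
  have h (I : T.IdealSheafData) (m : ℕ) : twistSet Γ(T, W ⊓ V) (I.ideal ⟨V, hV⟩) d m =
      twist W I D m ⟨V, hV⟩ := by
    ext s
    rw [mem_twist_iff_of_span (hD m), twistSet, halg]
    rfl
  have h' (I : T.IdealSheafData) (m : ℕ) : twistSet Γ(T, W ⊓ V) (I.ideal ⟨V, hV⟩) d' m =
      twist W I D' m ⟨V, hV⟩ := by
    ext s
    rw [mem_twist_iff_of_span (hD' m), twistSet, halg]
    rfl
  rw [h, h, h', h', halg]
  rfl

lemma span_map_eq_of_isUnit {S M M' ι : Type*} [CommRing S] [CommRing M] [CommRing M']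
    (f : M →+* M') {α β : S →+* M} {y : ι → S} {h : M} (hu : IsUnit (f h))
    (hh : ∀ x, h * (α x - β x) ∈ Ideal.span (Set.range fun j ↦ α (y j) - β (y j))) :
    Ideal.map f (Ideal.span (Set.range fun x ↦ α x - β x)) =
      Ideal.span (Set.range fun j ↦ f (α (y j) - β (y j))) := by
  have h1 : Ideal.span (Set.range fun j ↦ f (α (y j) - β (y j))) =
      Ideal.map f (Ideal.span (Set.range fun j ↦ α (y j) - β (y j))) := by
    rw [Ideal.map_span, ← Set.range_comp]
    rfl
  refine le_antisymm ?_ ?_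
  · rw [Ideal.map_span, Ideal.span_le]
    rintro _ ⟨_, ⟨x, rfl⟩, rfl⟩
    have h2 := Ideal.mem_map_of_mem f (hh x)
    rw [map_mul] at h2
    rw [h1]
    exact (Ideal.unit_mul_mem_iff_mem _ hu).mp h2
  · rw [Ideal.span_le]
    rintro _ ⟨j, rfl⟩
    exact Ideal.mem_map_of_mem f (Ideal.subset_span ⟨y j, rfl⟩)

/-- Where `h` is invertible, the ideal of `X ×_Y X` is generated by the differences of the
coordinates `y_j` alone, as the comparison with the model requires. -/
lemma flat_newtonAlgebra_basicOpen [IsSeparated (φ ≫ q)] [IsSeparated q]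
    (hc : ∀ x : X, ∃ c : Chart φ q, x ∈ c.V) {r : ℕ} (hr : 2 ≤ r) (c : Chart φ q)
    (h : Γ(pullback (φ ≫ q) (φ ≫ q), squareOpen (φ ≫ q) c.V))
    (hh : ∀ x, h * (leftHom (φ ≫ q) c.V (φ.appLE c.O c.V c.le x) -
      rightHom (φ ≫ q) c.V (φ.appLE c.O c.V c.le x)) ∈ Ideal.span (Set.range fun j ↦
        leftHom (φ ≫ q) c.V (φ.appLE c.O c.V c.le (c.s (.X j))) -
          rightHom (φ ≫ q) c.V (φ.appLE c.O c.V c.le (c.s (.X j))))) :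
    (((newtonAlgebra φ q r).algebraHom ⟨(pullback (φ ≫ q) (φ ≫ q)).basicOpen h,
      (isAffineOpen_squareOpen (φ ≫ q) c.hV).basicOpen h⟩).comp
      ((pullback.fst (φ ≫ q) (φ ≫ q)).appLE c.V ((pullback (φ ≫ q) (φ ≫ q)).basicOpen h)
        ((Scheme.basicOpen_le _ h).trans (squareOpen_le_fst (φ ≫ q) c.V))).hom).Flat := by
  have hVV := isAffineOpen_squareOpen (φ ≫ q) c.hV
  have hl := squareOpen_le_fst (φ ≫ q) c.V
  have hr' := squareOpen_le_snd (φ ≫ q) c.V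
  obtain ⟨B, hBh⟩ : ∃ B, B = (pullback (φ ≫ q) (φ ≫ q)).basicOpen h := ⟨_, rfl⟩
  have hB : IsAffineOpen B := hBh ▸ hVV.basicOpen h
  have hBV : B ≤ squareOpen (φ ≫ q) c.V := hBh ▸ Scheme.basicOpen_le _ h
  suffices hs : (((newtonAlgebra φ q r).algebraHom ⟨B, hB⟩).comp
      ((pullback.fst (φ ≫ q) (φ ≫ q)).appLE c.V B (hBV.trans hl)).hom).Flat by
    subst hBh
    exact hs
  let alg₁ : Algebra Γ(pullback (φ ≫ q) (φ ≫ q), squareOpen (φ ≫ q) c.V)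
    Γ(pullback (φ ≫ q) (φ ≫ q), B) :=
    ((pullback (φ ≫ q) (φ ≫ q)).presheaf.map (homOfLE hBV).op).hom.toAlgebra
  let alg₂ : Algebra Γ(pullback (φ ≫ q) (φ ≫ q), B)
    Γ(pullback (φ ≫ q) (φ ≫ q), squareLocus φ q ⊓ B) := (res (squareLocus φ q) B).toAlgebra
  have hloc₁ : IsLocalization.Away h Γ(pullback (φ ≫ q) (φ ≫ q), B) :=
    hVV.isLocalization_of_eq_basicOpen h (homOfLE hBV) hBh
  let f := algebraMap Γ(pullback (φ ≫ q) (φ ≫ q), squareOpen (φ ≫ q) c.V)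
    Γ(pullback (φ ≫ q) (φ ≫ q), B)
  have hfl (s) : f (leftHom (φ ≫ q) c.V s) =
      (pullback.fst (φ ≫ q) (φ ≫ q)).appLE c.V B (hBV.trans hl) s :=
    congr($((pullback.fst (φ ≫ q) (φ ≫ q)).appLE_map hl (homOfLE hBV).op) s)
  have hfr (s) : f (rightHom (φ ≫ q) c.V s) =
      (pullback.snd (φ ≫ q) (φ ≫ q)).appLE c.V B (hBV.trans hr') s :=
    congr($((pullback.snd (φ ≫ q) (φ ≫ q)).appLE_map hr' (homOfLE hBV).op) s)
  -- The part of `U × U` in `B` is where both determinants are invertible, so its ring of functions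
  -- is a localization.
  have hWB : squareLocus φ q ⊓ B = (pullback (φ ≫ q) (φ ≫ q)).basicOpen
      (f (leftHom (φ ≫ q) c.V c.P.det) * f (rightHom (φ ≫ q) c.V c.P.det)) := by
    have h1 := Scheme.basicOpen_appLE (pullback.fst (φ ≫ q) (φ ≫ q)) B c.V (hBV.trans hl) c.P.det
    have h2 := Scheme.basicOpen_appLE (pullback.snd (φ ≫ q) (φ ≫ q)) B c.V (hBV.trans hr') c.P.det
    rw [c.basicOpen_det] at h1 h2
    rw [Scheme.basicOpen_mul, hfl, hfr]
    refine Eq.trans ?_ (congrArg₂ (· ⊓ ·) h1 h2).symm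
    ext y
    constructor
    · rintro ⟨⟨hy₁, hy₂⟩, hyB⟩
      exact ⟨⟨hyB, hy₁, hl (hBV hyB)⟩, hyB, hy₂, hr' (hBV hyB)⟩
    · rintro ⟨⟨hyB, hy₁, -⟩, -, hy₂, -⟩
      exact ⟨⟨hy₁, hy₂⟩, hyB⟩
  have hloc₂ : IsLocalization.Away
      (f (leftHom (φ ≫ q) c.V c.P.det) * f (rightHom (φ ≫ q) c.V c.P.det))
      Γ(pullback (φ ≫ q) (φ ≫ q), squareLocus φ q ⊓ B) :=
    hB.isLocalization_of_eq_basicOpen _ (homOfLE inf_le_right) hWB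
  have hy (j) : φ.appLE c.O c.V c.le (c.s (.X j)) = c.P.y j :=
    (congr($(c.appLE_comp_s) (.X j))).trans (MvPolynomial.aeval_X _ _)
  have hI₁ : (pullback.diagonal (φ ≫ q)).ker.ideal ⟨B, hB⟩ = Ideal.span
      (Set.range fun s ↦ f (leftHom (φ ≫ q) c.V s - rightHom (φ ≫ q) c.V s)) := by
    rw [← (pullback.diagonal (φ ≫ q)).ker.map_ideal (U := ⟨B, hB⟩) (V := ⟨_, hVV⟩) hBV,
      diagonal_ker_ideal (φ ≫ q) c.hV, differenceIdeal, Ideal.map_span, ← Set.range_comp]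
    rfl
  have hI₂ : (pullback.mapDesc φ φ q).ker.ideal ⟨B, hB⟩ = Ideal.span
      (Set.range fun j ↦ f (leftHom (φ ≫ q) c.V (c.P.y j) - rightHom (φ ≫ q) c.V (c.P.y j))) := by
    rw [← (pullback.mapDesc φ φ q).ker.map_ideal (U := ⟨B, hB⟩) (V := ⟨_, hVV⟩) hBV,
      mapDesc_ker_ideal φ q c.hV c.hO c.le, differenceIdeal]
    refine (span_map_eq_of_isUnit (M' := Γ(pullback (φ ≫ q) (φ ≫ q), B)) f
      (α := (φ.appLE c.O c.V c.le ≫ leftHom (φ ≫ q) c.V).hom)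
      (β := (φ.appLE c.O c.V c.le ≫ rightHom (φ ≫ q) c.V).hom) (y := fun j ↦ c.s (.X j))
      (IsLocalization.Away.algebraMap_isUnit h) hh).trans ?_
    simp only [← hy]
    rfl
  have hA : (newtonAlgebra φ q r).carrier ⟨B, hB⟩ = _ := blowUpAlgebra_carrier_eq hB _ _ _ _ r
    (fun m ↦ c.comap_different_pow_ideal hc hB (hBV.trans hl) m)
    (fun m ↦ c.comap_different_pow_ideal hc hB (hBV.trans hr') m) rfl
  rw [← hfl, ← hfr] at hA
  have hext (E : Type u) [CommRing E]
      (F G : Γ(pullback (φ ≫ q) (φ ≫ q), squareOpen (φ ≫ q) c.V) →+* E)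
      (h₁ : F.comp (leftHom (φ ≫ q) c.V).hom = G.comp (leftHom (φ ≫ q) c.V).hom)
      (h₂ : F.comp (rightHom (φ ≫ q) c.V).hom = G.comp (rightHom (φ ≫ q) c.V).hom) : F = G :=
    congrArg CommRingCat.Hom.hom (squareOpen_hom_ext (φ ≫ q) c.hV (E := .of E)
      (F := CommRingCat.ofHom F) (G := CommRingCat.ofHom G)
      (CommRingCat.hom_ext h₁) (CommRingCat.hom_ext h₂))
  have hk : (leftHom (φ ≫ q) c.V).hom.comp (algebraMap k Γ(X, c.V)) =
      (rightHom (φ ≫ q) c.V).hom.comp (algebraMap k Γ(X, c.V)) :=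
    congrArg CommRingCat.Hom.hom (leftHom_comp_algebraMap (φ ≫ q) c.hV c.fromSpec_comp)
  have hpush (E : Type u) [CommRing E] (α β : Γ(X, c.V) →+* E)
      (h : α.comp (algebraMap k Γ(X, c.V)) = β.comp (algebraMap k Γ(X, c.V))) :
      ∃ F : Γ(pullback (φ ≫ q) (φ ≫ q), squareOpen (φ ≫ q) c.V) →+* E,
        F.comp (leftHom (φ ≫ q) c.V).hom = α ∧ F.comp (rightHom (φ ≫ q) c.V).hom = β := by
    obtain ⟨F, h₁, h₂⟩ := exists_squareOpen_hom (φ ≫ q) c.hV c.fromSpec_comp (E := .of E)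
      (CommRingCat.ofHom α) (CommRingCat.ofHom β) (CommRingCat.hom_ext h)
    exact ⟨F.hom, congrArg CommRingCat.Hom.hom h₁, congrArg CommRingCat.Hom.hom h₂⟩
  have hg (s : Γ(X, c.V)) : ((((newtonAlgebra φ q r).algebraHom ⟨B, hB⟩).comp
      ((pullback.fst (φ ≫ q) (φ ≫ q)).appLE c.V B (hBV.trans hl)).hom) s).1 =
        res (squareLocus φ q) B (f (leftHom (φ ≫ q) c.V s)) := by
    rw [hfl]
    rfl
  exact c.P.flat_twistAlgebra (M := Γ(pullback (φ ≫ q) (φ ≫ q), B))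
    (N := Γ(pullback (φ ≫ q) (φ ≫ q), squareLocus φ q ⊓ B)) hr c.det_mem
    (leftHom (φ ≫ q) c.V).hom (rightHom (φ ≫ q) c.V).hom hext hk hpush h _ _ hI₁ hI₂ _ hA _ hg

lemma ι_specHom_comp {T X : Scheme.{u}} [IsLocallyNoetherian T] {W : T.Opens}
    (A : QCohSubalgebra W) (pr : T ⟶ X) {V : T.Opens} (hV : IsAffineOpen V) {O : X.Opens}
    (hO : IsAffineOpen O) (e : V ≤ pr ⁻¹ᵁ O) :
    A.ι ⟨V, hV⟩ ≫ A.specHom ≫ pr =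
      Spec.map (CommRingCat.ofHom ((A.algebraHom ⟨V, hV⟩).comp (pr.appLE O V e).hom)) ≫
        hO.fromSpec := by
  rw [A.ι_specHom_assoc hV, ← IsAffineOpen.SpecMap_appLE_fromSpec pr hO hV e,
    ← Spec.map_comp_assoc]
  rfl

lemma mem_opensRange_ι {T : Scheme.{u}} [IsLocallyNoetherian T] {W : T.Opens}
    (A : QCohSubalgebra W) {V : T.Opens} (hV : IsAffineOpen V) {γ : A.spec}
    (h : A.specHom γ ∈ V) : γ ∈ (A.ι ⟨V, hV⟩).opensRange := by
  rw [← A.specHom_preimage hV]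
  exact h

lemma flat_specHom_comp {T X : Scheme.{u}} [IsLocallyNoetherian T] {W : T.Opens}
    (A : QCohSubalgebra W) (pr : T ⟶ X) (h : ∀ γ : A.spec, ∃ (V : T.Opens) (hV : IsAffineOpen V),
      A.specHom γ ∈ V ∧ Flat (A.ι ⟨V, hV⟩ ≫ A.specHom ≫ pr)) : Flat (A.specHom ≫ pr) := by
  refine flat_of_local _ fun γ ↦ ?_
  obtain ⟨V, hV, hγ, hf⟩ := h γ
  exact ⟨_, A.ι ⟨V, hV⟩, inferInstance, mem_opensRange_ι A hV hγ, hf⟩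

lemma flat_SpecMap_ofHom {A B : Type u} [CommRing A] [CommRing B] {f : A →+* B} (hf : f.Flat) :
    Flat (Spec.map (CommRingCat.ofHom f)) :=
  Flat.SpecMap_iff.mpr hf

/-- Over `U × U` the structure map of `Γ_r` is an isomorphism, and the first projection of `X × X`
is flat because `X` is flat over a field. All other points lie over the diagonal, where the model
applies. -/
lemma flat_newtonP₁ [LocallyOfFiniteType (φ ≫ q)] [IsSeparated (φ ≫ q)] [IsSeparated q]
    (hc : ∀ x : X, ∃ c : Chart φ q, x ∈ c.V) {r : ℕ} (hr : 2 ≤ r) :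
    Flat (newtonP₁ φ q r) := by
  refine flat_specHom_comp (newtonAlgebra φ q r) _ fun γ ↦ ?_
  rcases mem_squareLocus_or_mem_range_diagonal hc hr γ with hγ | ⟨x, hx⟩
  · obtain ⟨V, hV, hγV, hVW⟩ := exists_affine_mem_le hγ
    refine ⟨V, hV, hγV, ?_⟩
    rw [(newtonAlgebra φ q r).ι_specHom_assoc hV]
    have h1 : Flat (Spec.map (CommRingCat.ofHom ((newtonAlgebra φ q r).algebraHom ⟨V, hV⟩))) :=
      flat_SpecMap_ofHom (RingHom.Flat.of_bijective
        ((newtonAlgebra φ q r).algebraHom_bijective_of_le (V := ⟨V, hV⟩) hVW))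
    have h2 : Flat (φ ≫ q) := by
      have : IsIntegral (Spec (.of k)) := inferInstance
      have : Subsingleton (Spec (.of k)) := inferInstanceAs (Subsingleton (PrimeSpectrum k))
      infer_instance
    infer_instance
  · obtain ⟨c, hxc⟩ := hc x
    obtain ⟨h, hh, hxh⟩ := exists_basicOpen_diagonal c x hxc
    refine ⟨_, (isAffineOpen_squareOpen (φ ≫ q) c.hV).basicOpen h, hx ▸ hxh, ?_⟩
    rw [ι_specHom_comp (newtonAlgebra φ q r) _ _ c.hV
      ((Scheme.basicOpen_le _ h).trans (squareOpen_le_fst (φ ≫ q) c.V))]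
    have h1 := flat_SpecMap_ofHom (flat_newtonAlgebra_basicOpen hc hr c h hh)
    have h2 : Flat c.hV.fromSpec := inferInstance
    exact Flat.comp _ _

end

end

end NewtonGroupoid

/-! ### The groupoid structure -/

namespace NewtonGroupoid

section Groupoid

variable {k : Type u} [Field k] {X Y : Scheme.{u}} {φ : X ⟶ Y} {q : Y ⟶ Spec (.of k)}

/-- Flatness of either leg suffices, since a good pair has the same preimage of `U` along both. -/
lemma schDense_comp_of_flat (hc : ∀ x : X, ∃ c : Chart φ q, x ∈ c.V) {r : ℕ} {Z Z' : Scheme.{u}}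
    {a b : Z ⟶ X} (hg : Good φ q r a b) (hf : Flat a ∨ Flat b) (j : Z' ⟶ Z) [IsOpenImmersion j] :
    SchDense ((j ≫ a) ⁻¹ᵁ etaleLocus φ) := by
  rcases hf with hf | hf
  · exact schDense_of_flat hc (j ≫ a)
  · rw [(hg.precomp j).preimage_eq]
    exact schDense_of_flat hc (j ≫ b)

variable [LocallyOfFiniteType (φ ≫ q)] {r : ℕ}

lemma newtonP₁_comp_eq : newtonP₁ φ q r ≫ φ ≫ q = newtonP₂ φ q r ≫ φ ≫ q := by
  rw [newtonP₁, newtonP₂, Category.assoc, Category.assoc, pullback.condition]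

variable [IsSeparated (φ ≫ q)] [IsSeparated q]

lemma newton_hom_ext_of_flat (hc : ∀ x : X, ∃ c : Chart φ q, x ∈ c.V) (hr : 2 ≤ r)
    {Z : Scheme.{u}} {f g : Z ⟶ newtonScheme φ q r} {a b : Z ⟶ X}
    (hf₁ : f ≫ newtonP₁ φ q r = a) (hf₂ : f ≫ newtonP₂ φ q r = b)
    (hg₁ : g ≫ newtonP₁ φ q r = a) (hg₂ : g ≫ newtonP₂ φ q r = b) (hf : Flat a ∨ Flat b) :
    f = g := by
  subst hf₁ hf₂
  have hgood := (good_newton hc hr).precomp f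
  refine newton_hom_ext hg₁.symm hg₂.symm hgood ?_
  have := schDense_comp_of_flat hc hgood hf (𝟙 Z)
  rwa [Category.id_comp] at this

lemma exists_newton_lift_of_flat (hc : ∀ x : X, ∃ c : Chart φ q, x ∈ c.V) {Z : Scheme.{u}}
    (a b : Z ⟶ X) (hab : a ≫ φ ≫ q = b ≫ φ ≫ q) (hg : Good φ q r a b)
    (hf : Flat a ∨ Flat b) :
    ∃ l : Z ⟶ newtonScheme φ q r, l ≫ newtonP₁ φ q r = a ∧ l ≫ newtonP₂ φ q r = b :=
  exists_newton_lift hc a b hab hg fun _ j _ ↦ schDense_comp_of_flat hc hg hf j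

/-- Maps from an arbitrary `T` are not determined by their projections. The identity is therefore
proved on the universal scheme of composable triples, which is flat over `X` by base change of the
first projection, and then pulled back to `T`. -/
lemma newton_assoc (hc : ∀ x : X, ∃ c : Chart φ q, x ∈ c.V) (hr : 2 ≤ r)
    (c : pullback (newtonP₂ φ q r) (newtonP₁ φ q r) ⟶ newtonScheme φ q r)
    (hc₁ : c ≫ newtonP₁ φ q r = pullback.fst _ _ ≫ newtonP₁ φ q r)
    (hc₂ : c ≫ newtonP₂ φ q r = pullback.snd _ _ ≫ newtonP₂ φ q r) {T : Scheme.{u}}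
    (g₁ g₂ g₃ : T ⟶ newtonScheme φ q r) (h₁₂ : g₁ ≫ newtonP₂ φ q r = g₂ ≫ newtonP₁ φ q r)
    (h₂₃ : g₂ ≫ newtonP₂ φ q r = g₃ ≫ newtonP₁ φ q r)
    (h : (pullback.lift g₁ g₂ h₁₂ ≫ c) ≫ newtonP₂ φ q r = g₃ ≫ newtonP₁ φ q r)
    (h' : g₁ ≫ newtonP₂ φ q r = (pullback.lift g₂ g₃ h₂₃ ≫ c) ≫ newtonP₁ φ q r) :
    pullback.lift (pullback.lift g₁ g₂ h₁₂ ≫ c) g₃ h ≫ c =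
      pullback.lift g₁ (pullback.lift g₂ g₃ h₂₃ ≫ c) h' ≫ c := by
  have := flat_newtonP₁ hc hr
  let π₁ := pullback.fst (newtonP₂ φ q r) (newtonP₁ φ q r)
  let π₂ := pullback.snd (newtonP₂ φ q r) (newtonP₁ φ q r)
  let ρ₁ := pullback.fst (π₂ ≫ newtonP₂ φ q r) (newtonP₁ φ q r)
  let ρ₂ := pullback.snd (π₂ ≫ newtonP₂ φ q r) (newtonP₁ φ q r)
  have hπ : π₁ ≫ newtonP₂ φ q r = π₂ ≫ newtonP₁ φ q r := pullback.condition
  have hρ : ρ₁ ≫ π₂ ≫ newtonP₂ φ q r = ρ₂ ≫ newtonP₁ φ q r := pullback.condition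
  have hρ' : (ρ₁ ≫ π₂) ≫ newtonP₂ φ q r = ρ₂ ≫ newtonP₁ φ q r := by
    rw [Category.assoc, hρ]
  have w₁ : (ρ₁ ≫ c) ≫ newtonP₂ φ q r = ρ₂ ≫ newtonP₁ φ q r := by
    rw [Category.assoc, hc₂, hρ]
  have w₂ : (ρ₁ ≫ π₁) ≫ newtonP₂ φ q r =
      (pullback.lift (ρ₁ ≫ π₂) ρ₂ hρ' ≫ c) ≫ newtonP₁ φ q r := by
    rw [Category.assoc, hπ, Category.assoc, hc₁, pullback.lift_fst_assoc, Category.assoc]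
  have key : pullback.lift (ρ₁ ≫ c) ρ₂ w₁ ≫ c =
      pullback.lift (ρ₁ ≫ π₁) (pullback.lift (ρ₁ ≫ π₂) ρ₂ hρ' ≫ c) w₂ ≫ c := by
    refine newton_hom_ext_of_flat hc hr (a := ρ₁ ≫ π₁ ≫ newtonP₁ φ q r)
      (b := ρ₂ ≫ newtonP₂ φ q r) ?_ ?_ ?_ ?_ (.inl inferInstance)
    · rw [Category.assoc, hc₁, pullback.lift_fst_assoc, Category.assoc, hc₁]
    · rw [Category.assoc, hc₂, pullback.lift_snd_assoc]
    · rw [Category.assoc, hc₁, pullback.lift_fst_assoc, Category.assoc]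
    · rw [Category.assoc, hc₂, pullback.lift_snd_assoc, Category.assoc, hc₂,
        pullback.lift_snd_assoc]
  obtain ⟨m, hm₁, hm₂⟩ : ∃ m : T ⟶ pullback (π₂ ≫ newtonP₂ φ q r) (newtonP₁ φ q r),
      m ≫ ρ₁ = pullback.lift g₁ g₂ h₁₂ ∧ m ≫ ρ₂ = g₃ :=
    ⟨pullback.lift (pullback.lift g₁ g₂ h₁₂) g₃ (by rw [pullback.lift_snd_assoc, h₂₃]),
      pullback.lift_fst _ _ _, pullback.lift_snd _ _ _⟩
  have hm₃ : m ≫ ρ₁ ≫ π₁ = g₁ := by rw [reassoc_of% hm₁, pullback.lift_fst]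
  have hm₄ : m ≫ ρ₁ ≫ π₂ = g₂ := by rw [reassoc_of% hm₁, pullback.lift_snd]
  have e₁ : pullback.lift (pullback.lift g₁ g₂ h₁₂ ≫ c) g₃ h =
      m ≫ pullback.lift (ρ₁ ≫ c) ρ₂ w₁ := by
    apply pullback.hom_ext
    · rw [pullback.lift_fst, Category.assoc, pullback.lift_fst, reassoc_of% hm₁]
    · rw [pullback.lift_snd, Category.assoc, pullback.lift_snd, hm₂]
  have e₂ : pullback.lift g₂ g₃ h₂₃ = m ≫ pullback.lift (ρ₁ ≫ π₂) ρ₂ hρ' := by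
    apply pullback.hom_ext
    · rw [pullback.lift_fst, Category.assoc, pullback.lift_fst, hm₄]
    · rw [pullback.lift_snd, Category.assoc, pullback.lift_snd, hm₂]
  have e₃ : pullback.lift g₁ (pullback.lift g₂ g₃ h₂₃ ≫ c) h' =
      m ≫ pullback.lift (ρ₁ ≫ π₁) (pullback.lift (ρ₁ ≫ π₂) ρ₂ hρ' ≫ c) w₂ := by
    apply pullback.hom_ext
    · rw [pullback.lift_fst, Category.assoc, pullback.lift_fst, hm₃]
    · rw [pullback.lift_snd, Category.assoc, pullback.lift_snd, e₂, Category.assoc]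
  rw [e₁, e₃, Category.assoc, Category.assoc, key]

lemma nonempty_groupoidStructure (hc : ∀ x : X, ∃ c : Chart φ q, x ∈ c.V) (hr : 2 ≤ r) :
    Nonempty (GroupoidStructure (newtonP₁ φ q r) (newtonP₂ φ q r)) := by
  have hflat := flat_newtonP₁ (φ := φ) (q := q) hc hr
  have hgood := good_newton (φ := φ) (q := q) hc hr
  have hcond : pullback.fst (newtonP₂ φ q r) (newtonP₁ φ q r) ≫ newtonP₂ φ q r =
    pullback.snd (newtonP₂ φ q r) (newtonP₁ φ q r) ≫ newtonP₁ φ q r := pullback.condition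
  obtain ⟨c, hc₁, hc₂⟩ := exists_newton_lift_of_flat (r := r) hc
    (pullback.fst (newtonP₂ φ q r) (newtonP₁ φ q r) ≫ newtonP₁ φ q r)
    (pullback.snd (newtonP₂ φ q r) (newtonP₁ φ q r) ≫ newtonP₂ φ q r)
    (by
      rw [Category.assoc, Category.assoc, newtonP₁_comp_eq, ← Category.assoc, hcond, Category.assoc,
        newtonP₁_comp_eq])
    -- The outer points of a composable pair are good by transitivity through the common middle
    -- point.
    ((hgood.precomp _).trans (hcond ▸ hgood.precomp _)) (.inl inferInstance)
  obtain ⟨e, he₁, he₂⟩ := exists_newton_lift_of_flat (r := r) hc (𝟙 X) (𝟙 X) rfl (.refl _)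
    (.inl inferInstance)
  obtain ⟨i, hi₁, hi₂⟩ := exists_newton_lift_of_flat (r := r) hc (newtonP₂ φ q r)
    (newtonP₁ φ q r) newtonP₁_comp_eq.symm hgood.symm (.inr hflat)
  have ext₁ {f g : newtonScheme φ q r ⟶ newtonScheme φ q r} {a b : newtonScheme φ q r ⟶ X}
      (h : Flat a ∨ Flat b)
      (hf₁ : f ≫ newtonP₁ φ q r = a) (hf₂ : f ≫ newtonP₂ φ q r = b)
      (hg₁ : g ≫ newtonP₁ φ q r = a) (hg₂ : g ≫ newtonP₂ φ q r = b) : f = g :=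
    newton_hom_ext_of_flat hc hr hf₁ hf₂ hg₁ hg₂ h
  exact ⟨{
    c := c
    e := e
    i := i
    c_p₁ := hc₁
    c_p₂ := hc₂
    e_p₁ := he₁
    e_p₂ := he₂
    i_p₁ := hi₁
    i_p₂ := hi₂
    assoc := fun g₁ g₂ g₃ h₁₂ h₂₃ ↦ newton_assoc hc hr c hc₁ hc₂ g₁ g₂ g₃ h₁₂ h₂₃ _ _
    unit_left := by
      refine ext₁ (.inl hflat) ?_ ?_ (Category.id_comp _) (Category.id_comp _)
      · rw [Category.assoc, hc₁, pullback.lift_fst_assoc, Category.assoc, he₁, Category.comp_id]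
      · rw [Category.assoc, hc₂, pullback.lift_snd_assoc, Category.id_comp]
    unit_right := by
      refine ext₁ (.inl hflat) ?_ ?_ (Category.id_comp _) (Category.id_comp _)
      · rw [Category.assoc, hc₁, pullback.lift_fst_assoc, Category.id_comp]
      · rw [Category.assoc, hc₂, pullback.lift_snd_assoc, Category.assoc, he₂, Category.comp_id]
    inv_right := by
      refine ext₁ (a := newtonP₁ φ q r) (b := newtonP₁ φ q r) (.inl hflat) ?_ ?_ ?_ ?_
      · rw [Category.assoc, hc₁, pullback.lift_fst_assoc, Category.id_comp]
      · rw [Category.assoc, hc₂, pullback.lift_snd_assoc, hi₂]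
      · rw [Category.assoc, he₁, Category.comp_id]
      · rw [Category.assoc, he₂, Category.comp_id]
    inv_left := by
      -- Here both projections of the two maps are `newtonP₂`, whose flatness is not yet known. It
      -- follows from that of `newtonP₁`, because the inversion is an involution exchanging the two.
      have hflat₂ : Flat (newtonP₂ φ q r) := by
        have hii : i ≫ i = 𝟙 _ := by
          refine ext₁ (.inl hflat) ?_ ?_ (Category.id_comp _) (Category.id_comp _)
          · rw [Category.assoc, hi₁, hi₂]
          · rw [Category.assoc, hi₂, hi₁]
        have : IsIso i := ⟨i, hii, hii⟩
        rw [← hi₁]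
        infer_instance
      refine ext₁ (a := newtonP₂ φ q r) (b := newtonP₂ φ q r) (.inl hflat₂) ?_ ?_ ?_ ?_
      · rw [Category.assoc, hc₁, pullback.lift_fst_assoc, hi₁]
      · rw [Category.assoc, hc₂, pullback.lift_snd_assoc, Category.id_comp]
      · rw [Category.assoc, he₁, Category.comp_id]
      · rw [Category.assoc, he₂, Category.comp_id] }⟩

/-- The axioms prescribing source and target already determine the three maps. -/
lemma subsingleton_groupoidStructure (hc : ∀ x : X, ∃ c : Chart φ q, x ∈ c.V) (hr : 2 ≤ r) :
    Subsingleton (GroupoidStructure (newtonP₁ φ q r) (newtonP₂ φ q r)) := by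
  have hflat := flat_newtonP₁ (φ := φ) (q := q) hc hr
  refine ⟨fun G G' ↦ GroupoidStructure.ext ?_ ?_ ?_⟩
  · exact newton_hom_ext_of_flat hc hr G.c_p₁ G.c_p₂ G'.c_p₁ G'.c_p₂ (.inl inferInstance)
  · exact newton_hom_ext_of_flat hc hr G.e_p₁ G.e_p₂ G'.e_p₁ G'.e_p₂ (.inl inferInstance)
  · exact newton_hom_ext_of_flat hc hr G.i_p₁ G.i_p₂ G'.i_p₁ G'.i_p₂ (.inr hflat)

end Groupoid

end NewtonGroupoid

theorem mainTheorem3 {k : Type u} [Field k] {X Y : Scheme.{u}}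
    (φ : X ⟶ Y) (q : Y ⟶ Spec (.of k))
    [LocallyOfFiniteType (φ ≫ q)] [IsSeparated (φ ≫ q)]
    [LocallyOfFiniteType q] [IsSeparated q] [Smooth q]
    (hX : NewtonGroupoid.IsLocallyCompleteIntersection (φ ≫ q))
    (hU : Dense (NewtonGroupoid.etaleLocus φ : Set X))
    (r : ℕ) (hr : 2 ≤ r) :
    Nonempty (Unique (NewtonGroupoid.GroupoidStructure
      (NewtonGroupoid.newtonP₁ φ q r) (NewtonGroupoid.newtonP₂ φ q r))) := by
  have hc := NewtonGroupoid.exists_chart φ q hX hU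
  have := NewtonGroupoid.subsingleton_groupoidStructure (φ := φ) (q := q) hc hr
  obtain ⟨G⟩ := NewtonGroupoid.nonempty_groupoidStructure (φ := φ) (q := q) hc hr
  exact ⟨⟨⟨G⟩, fun _ ↦ Subsingleton.elim _ _⟩⟩
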